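/- Let $n \ge d \ge 1$ be integers and let $\ell_i(x) = a_{i1}x_1 + \dots + a_{id}x_d + b_i$, $i = 0,\dots,n$, be affine-linear forms with complex coefficients, each with $(a_{i1},\dots,a_{id}) \neq 0$. Put $A = (a_{ij}) \in \mathbb{C}^{(n+1)\times d}$, $b = (b_i) \in \mathbb{C}^{n+1}$, $L = [\,b \mid A\,]^{\mathsf T} \in \mathbb{C}^{(d+1)\times(n+1)}$, and let $$X = \mathbb{C}^d \setminus V(\ell_0\cdots\ell_n)$$ be the complement of the arrangement of the $n+1$ hyperplanes $\ell_i = 0$. For $u \in \mathbb{P}^n$ write $\mathcal{L}_u = \sum_i u_i \log \ell_i$, and let $\mathrm{Crit}_X(u) \subseteq X$ be the scheme of critical points, defined by $\partial\mathcal{L}_u/\partial x_j = \sum_i u_i a_{ij}/\ell_i = 0$ for $j = 1,\dots,d$. The likelihood correspondence is the closed subscheme $$\mathcal{L}_X^\circ = \{(u,x) : \nabla\mathcal{L}_u(x) = 0\} \subseteq \mathbb{P}^n \times X$$ defined by these $d$ equations, and $f\colon \mathcal{L}_X^\circ \to \mathbb{P}^n$ is the projection. Its ramification scheme $\mathrm{Ram}(f)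 \subseteq \mathcal{L}_X^\circ$ is the closed subscheme locally defined by the vanishing of the Jacobian determinant of $f$, i.e. by the zeroth Fitting ideal of the sheaf of relative differentials $\Omega_f$. The logarithmic discriminant $\nabla_{\log}(X) \subseteq \mathbb{P}^n$ is the Zariski closure of the set of $u$ for which $\mathrm{Crit}_X(u)$ is infinite or non-reduced, with scheme structure given by the branch locus of $f$, that is, the scheme-theoretic image of $\mathrm{Ram}(f)$ under $f$. A matrix is called uniform if all its maximal minors are non-zero. **Theorem 5.1.** Let $n+1 \ge d+2$. Suppose that there are $d+2$ columns of $L$ such that the corresponding $(d+1)\times(d+2)$ submatrix of $L$ is uniform and the corresponding $d\times(d+2)$ submatrix of $A^{\mathsf T}$ is uniform as well. Then the ramification scheme $\mathrm{Ram}(f)$ and the logarithmic discriminant $\nabla_{\log}(X)$ (both as the branch scheme of $f$ and as the closed subset of $\mathbb{P}^n$ above) are irreducible, and the schemes $\mathrm{Ram}(f)$ and $\nabla_{\log}(X)$ are reduced. -/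

import Mathlib

open CategoryTheory Limits AlgebraicGeometry

noncomputable section

namespace LogDisc

/-! ### Uniform matrices -/

/-- An `r × m` matrix with `r ≤ m` is uniform if all its maximal minors are non-zero. -/
def IsUniform {r m : ℕ} (M : Matrix (Fin r) (Fin m) ℂ) : Prop :=
  r ≤ m ∧ ∀ e : Fin r ↪ Fin m, (M.submatrix id e).det ≠ 0

/-- The `(d+1) × (n+1)` matrix `L = [b | A]ᵀ`. -/
def matrixL {n d : ℕ} (A : Matrix (Fin (n + 1)) (Fin d) ℂ) (b : Fin (n + 1) → ℂ) :
    Matrix (Fin (d + 1)) (Fin (n + 1)) ℂ :=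
  Matrix.of (Fin.cons b A.transpose)

/-! ### The ramification scheme and the branch locus of a morphism -/

/-- The zeroth Fitting ideal of a finitely generated module `M`: the ideal generated by the
determinants of all square matrices of relations between the members of a finite generating
family of `M`. (One generating family suffices, and all of them give the same ideal.) -/
def fittingIdealZero (R M : Type*) [CommRing R] [AddCommGroup M] [Module R M] : Ideal R :=
  Ideal.span {r | ∃ (m : ℕ) (x : Fin m → M) (P : Matrix (Fin m) (Fin m) R),
    Submodule.span R (Set.range x) = ⊤ ∧ (∀ i, ∑ j, P i j • x j = 0) ∧ r = P.det}

/-- The stalk at `x` of the zeroth Fitting ideal of the sheaf `Ω_f` of relative differentials of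
`f : X ⟶ Y`; recall `(Ω_f)_x = Ω[𝒪_{X,x}⁄𝒪_{Y,f(x)}]`. If `X` and `Y` are smooth of the same
dimension at `x` and `f x`, then `Ω_f` is the cokernel of the square Jacobi matrix of `f`, and
this ideal is generated by the Jacobian determinant `det J_f`. -/
def ramificationStalk {X Y : Scheme.{0}} (f : X ⟶ Y) (x : X) : Ideal (X.presheaf.stalk x) :=
  letI : Algebra (Y.presheaf.stalk (f x)) (X.presheaf.stalk x) := (f.stalkMap x).hom.toAlgebra
  fittingIdealZero (X.presheaf.stalk x)
    (KaehlerDifferential (Y.presheaf.stalk (f x)) (X.presheaf.stalk x))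

/-- The ideal sheaf of the ramification scheme of `f`: its sections are the functions whose germ
at every point `x` lies in the ideal of `𝒪_{X,x}` generated by the Jacobian determinant. -/
def ramificationIdeal {X Y : Scheme.{0}} (f : X ⟶ Y) : X.IdealSheafData :=
  Scheme.IdealSheafData.ofIdeals fun V =>
    ⨅ x : V.1, (ramificationStalk f x.1).comap (X.presheaf.germ V.1 x.1 x.2).hom

/-- The ramification scheme `Ram(f)`, a closed subscheme of the source of `f`. -/
abbrev Ram {X Y : Scheme.{0}} (f : X ⟶ Y) : Scheme.{0} := (ramificationIdeal f).subscheme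

/-- The inclusion of the ramification scheme. -/
abbrev Ram.ι {X Y : Scheme.{0}} (f : X ⟶ Y) : Ram f ⟶ X := (ramificationIdeal f).subschemeι

/-- The branch locus `Branch(f)`: the scheme-theoretic image of `Ram(f)` under `f`, a closed
subscheme of the target of `f`. -/
abbrev Branch {X Y : Scheme.{0}} (f : X ⟶ Y) : Scheme.{0} := (Ram.ι f ≫ f).image

/-! ### Projective space and the arrangement complement -/

/-- The grading of `ℂ[u₀, …, uₙ]` by degree. -/
abbrev grading (n : ℕ) : ℕ → Submodule ℂ (MvPolynomial (Fin (n + 1)) ℂ) :=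
  MvPolynomial.homogeneousSubmodule (Fin (n + 1)) ℂ

instance (n : ℕ) : GradedAlgebra (grading n) := MvPolynomial.gradedAlgebra

/-- Complex projective space `ℙⁿ` with homogeneous coordinates `u₀, …, uₙ`. -/
abbrev PSpace (n : ℕ) : Scheme.{0} := Proj (grading n)

/-- The structure morphism `ℙⁿ ⟶ Spec ℂ`. -/
def PSpace.toSpec (n : ℕ) : PSpace n ⟶ Spec (.of ℂ) :=
  Proj.toSpecZero (grading n) ≫ Spec.map (CommRingCat.ofHom (algebraMap ℂ (grading n 0)))

theorem X_mem_grading {n : ℕ} (i : Fin (n + 1)) : MvPolynomial.X i ∈ grading n 1 :=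
  (MvPolynomial.mem_homogeneousSubmodule 1 _).2 (MvPolynomial.isHomogeneous_X ℂ i)

/-- The function `u_k / u_i` on the chart `{u_i ≠ 0}` of `ℙⁿ`. -/
def PSpace.ratio {n : ℕ} (i k : Fin (n + 1)) :
    Γ(PSpace n, Proj.basicOpen (grading n) (MvPolynomial.X i)) :=
  (Proj.awayToSection (grading n) (MvPolynomial.X i)).hom
    (HomogeneousLocalization.Away.mk (grading n) (X_mem_grading i) 1
      (MvPolynomial.X k) (by simpa only [one_smul] using X_mem_grading k))

variable {n d : ℕ} (A : Matrix (Fin (n + 1)) (Fin d) ℂ) (b : Fin (n + 1) → ℂ)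

/-- The affine-linear form `ℓ_i`, the `i`-th entry of `A x + b`. -/
def form (i : Fin (n + 1)) : MvPolynomial (Fin d) ℂ :=
  ∑ j, MvPolynomial.C (A i j) * MvPolynomial.X j + MvPolynomial.C (b i)

/-- The coordinate ring `ℂ[x₁, …, x_d]_{ℓ₀⋯ℓₙ}` of the complement of the arrangement. -/
abbrev CoordRing : Type := Localization.Away (∏ i, form A b i)

/-- The complement `X = ℂᵈ ∖ V(ℓ₀⋯ℓₙ)`. -/
abbrev Complement : Scheme.{0} := Spec (.of (CoordRing A b))

/-- The structure morphism `X ⟶ Spec ℂ`. -/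
def Complement.toSpec : Complement A b ⟶ Spec (.of ℂ) :=
  Spec.map (CommRingCat.ofHom (algebraMap ℂ (CoordRing A b)))

theorem isUnit_form (i : Fin (n + 1)) :
    IsUnit (algebraMap (MvPolynomial (Fin d) ℂ) (CoordRing A b) (form A b i)) :=
  isUnit_of_dvd_unit (map_dvd _ (Finset.dvd_prod_of_mem _ (Finset.mem_univ i)))
    (IsLocalization.Away.algebraMap_isUnit (∏ i, form A b i))

/-- The logarithmic derivative `∂ log ℓ_k / ∂x_j = (∂ℓ_k / ∂x_j) / ℓ_k`, a function on `X`. -/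
def logDerivForm (j : Fin d) (k : Fin (n + 1)) : CoordRing A b :=
  algebraMap (MvPolynomial (Fin d) ℂ) (CoordRing A b) (MvPolynomial.pderiv j (form A b k)) *
    ((isUnit_form A b k).unit⁻¹ : (CoordRing A b)ˣ)

/-! ### The likelihood correspondence -/

/-- The product `ℙⁿ × X` over `ℂ`. -/
abbrev Ambient : Scheme.{0} := pullback (PSpace.toSpec n) (Complement.toSpec A b)

/-- The open subscheme `{u_i ≠ 0} × X` of `ℙⁿ × X`. -/
abbrev chart (i : Fin (n + 1)) : (Ambient A b).Opens :=
  pullback.fst (PSpace.toSpec n) (Complement.toSpec A b) ⁻¹ᵁ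
    Proj.basicOpen (grading n) (MvPolynomial.X i)

/-- The function `u_k / u_i` on `{u_i ≠ 0} × X`. -/
def ratio (i k : Fin (n + 1)) : Γ(Ambient A b, chart A b i) :=
  ((pullback.fst (PSpace.toSpec n) (Complement.toSpec A b)).app _).hom (PSpace.ratio i k)

/-- A function on `X`, seen as a function on `{u_i ≠ 0} × X`. -/
def pullFun (i : Fin (n + 1)) (r : CoordRing A b) : Γ(Ambient A b, chart A b i) :=
  ((pullback.snd (PSpace.toSpec n) (Complement.toSpec A b)).appLE ⊤ (chart A b i) le_top).hom
    ((Scheme.ΓSpecIso (.of (CoordRing A b))).inv.hom r)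

/-- The partial derivative `∂𝓛_u / ∂x_j = ∑ k, u_k ∂ log ℓ_k / ∂x_j`, which is linear in `u`,
dehomogenized on `{u_i ≠ 0} × X`. -/
def critEq (i : Fin (n + 1)) (j : Fin d) : Γ(Ambient A b, chart A b i) :=
  ∑ k, ratio A b i k * pullFun A b i (logDerivForm A b j k)

/-- The ideal sheaf on `ℙⁿ × X` which on each `{u_i ≠ 0} × X` is generated by the `d` critical
point equations. -/
def likelihoodIdeal : (Ambient A b).IdealSheafData :=
  Scheme.IdealSheafData.ofIdeals fun V =>
    ⨅ (i : Fin (n + 1)) (h : V.1 ≤ chart A b i),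
      Ideal.span (Set.range fun j => ((Ambient A b).presheaf.map (homOfLE h).op).hom
        (critEq A b i j))

/-- The likelihood correspondence `{(u, x) | ∇𝓛_u(x) = 0}`, a closed subscheme of `ℙⁿ × X`. -/
abbrev Likelihood : Scheme.{0} := (likelihoodIdeal A b).subscheme

/-- The projection `f` of the likelihood correspondence to `ℙⁿ`. -/
def likelihoodProj : Likelihood A b ⟶ PSpace n :=
  (likelihoodIdeal A b).subschemeι ≫ pullback.fst (PSpace.toSpec n) (Complement.toSpec A b)

/-- The scheme `Crit_X(u)` of critical points of `𝓛_u`: the fibre of the likelihood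
correspondence over `u`. -/
abbrev Crit (u : PSpace n) : Scheme.{0} := (likelihoodProj A b).fiber u

/-- The underlying closed set of the logarithmic discriminant: the Zariski closure of the set of
(closed) points `u` of `ℙⁿ` for which `Crit_X(u)` is infinite or non-reduced. -/
def logDiscriminantSet : Set (PSpace n) :=
  closure {u | IsClosed {u} ∧ (Infinite (Crit A b u) ∨ ¬ IsReduced (Crit A b u))}

/-- The logarithmic discriminant with its scheme structure: the branch locus of the projection of
the likelihood correspondence to `ℙⁿ`. -/
abbrev logDiscriminant : Scheme.{0} := Branch (likelihoodProj A b)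

end LogDisc

end

/-! Put `v_k = u_k / ℓ_k(x)`. The critical equations say exactly that `Aᵀ v = 0`, so a point of the
likelihood correspondence is a point `x` of `X` together with a nonzero relation `v` between the
rows of `A`, up to scaling, and `u_k = ℓ_k v_k`. The correspondence is thus `ℙ(ker Aᵀ) × X`. The
Jacobian matrix of the equations in the variables `x` is, up to sign, the Gram matrix `∑ a_kj a_kl
v_k / ℓ_k`, and it presents `Ω_f` (`IsCritAlgebra.isPresentedBy`). Hence `Ram(f)` is cut out by its
determinant, the Hessian `H`, a polynomial of degree at most `d` in `v` over the coordinate ring of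
`X`.

The heart is that `H` is prime (`hessian_prime`). Restrict `v` to the pencil `α c + e` supported on
the `d + 2` given columns, where `c` consists of the maximal minors of `[b | A]ᵀ` and `Aᵀ e = 0`, `b
⬝ e = 1`. A bordered determinant (`det_gram_mul`) shows that `H` becomes, up to the unit `∏ ℓ_i`,
the polynomial `∑ c_i² ℓ_i ∏_{k ≠ i} (c_k α + e_k)`. It has degree one in `x`, and uniformity
excludes a common root `α` of its coefficients, so it is prime (`pencilPoly_prime`). Its degree in
`α` is exactly `d`, so restriction to the pencil loses no degree, and a proper factorization of `H`
would survive it.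

Since `b ⬝ v = 1` on the pencil, `H` does not divide all `v_k`; the generic zero of `H` therefore
has a nonzero `v` and defines a point `q : Spec K ⟶ Likelihood A b` over a field. On each chart
`{u_i ≠ 0}` the kernel of `q` is generated by `H` (`exists_likelihood_point`), so `Ram(f)` is the
scheme-theoretic image of `Spec K`: reduced and irreducible. Both properties pass to the branch
scheme.

For the closed set: in characteristic zero a fibre is finite and reduced iff it is unramified, that
is, iff it avoids the zeros of `H`. The bad `u` are thus the image of `Ram(f)`, and restricting to
closed points does not change the closure. -/

noncomputable section

namespace LogDisc

/-! ### Linear algebra of uniform matrices -/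

/-- The matrix obtained by putting a row on top of `M`. -/
def consRow {R : Type*} {r m : ℕ} (q : Fin m → R) (M : Matrix (Fin r) (Fin m) R) :
    Matrix (Fin (r + 1)) (Fin m) R :=
  Matrix.of (Fin.cons q M)

@[simp]
theorem consRow_zero {R : Type*} {r m : ℕ} (q : Fin m → R) (M : Matrix (Fin r) (Fin m) R)
    (j : Fin m) : consRow q M 0 j = q j := rfl

@[simp]
theorem consRow_succ {R : Type*} {r m : ℕ} (q : Fin m → R) (M : Matrix (Fin r) (Fin m) R)
    (i : Fin r) (j : Fin m) : consRow q M i.succ j = M i j := rfl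

/-- The vector of signed maximal minors of an `r × (r + 1)` matrix. -/
def maxMinor {R : Type*} [CommRing R] {r : ℕ} (M : Matrix (Fin r) (Fin (r + 1)) R)
    (i : Fin (r + 1)) : R :=
  (-1) ^ (i : ℕ) * (M.submatrix id i.succAbove).det

theorem det_cons_eq_sum_maxMinor {R : Type*} [CommRing R] {r : ℕ}
    (M : Matrix (Fin r) (Fin (r + 1)) R) (q : Fin (r + 1) → R) :
    (consRow q M).det = ∑ i, q i * maxMinor M i := by
  rw [Matrix.det_succ_row_zero]
  refine Finset.sum_congr rfl fun i _ => ?_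
  have : (consRow q M).submatrix Fin.succ i.succAbove
      = M.submatrix id i.succAbove := by
    ext a b; simp [Matrix.submatrix]
  rw [this, maxMinor]
  simp only [consRow_zero]
  ring

/-- Each entry is the expansion of a determinant in which a row of `M` is repeated. -/
theorem mulVec_maxMinor {R : Type*} [CommRing R] {r : ℕ}
    (M : Matrix (Fin r) (Fin (r + 1)) R) : M.mulVec (maxMinor M) = 0 := by
  ext k
  have h := det_cons_eq_sum_maxMinor M (M k)
  rw [Matrix.det_zero_of_row_eq (i := 0) (j := k.succ) (Fin.succ_ne_zero k).symm (by ext; simp)] at h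
  simpa [Matrix.mulVec, dotProduct] using h.symm

theorem maxMinor_map {R S : Type*} [CommRing R] [CommRing S] (f : R →+* S) {r : ℕ}
    (M : Matrix (Fin r) (Fin (r + 1)) R) (i : Fin (r + 1)) :
    maxMinor (M.map f) i = f (maxMinor M i) := by
  simp only [maxMinor, map_mul, map_pow, map_neg, map_one, RingHom.map_det]
  rfl

/-- A vector in the kernel of a uniform matrix which is supported on as many columns as there are
rows is zero. -/
theorem IsUniform.eq_zero_of_mulVec {r m : ℕ} {M : Matrix (Fin r) (Fin m) ℂ} (hM : IsUniform M)
    {w : Fin m → ℂ} (hw : M.mulVec w = 0) (e : Fin r ↪ Fin m) (he : ∀ i ∉ Set.range e, w i = 0) :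
    w = 0 := by
  have h : (M.submatrix id e).mulVec (w ∘ e) = 0 := by
    ext k
    have := congrFun hw k
    simp only [Matrix.mulVec, dotProduct, Matrix.submatrix_apply, id, Function.comp] at this ⊢
    rw [← this, ← Finset.sum_map Finset.univ e (fun j => M k j * w j)]
    refine Finset.sum_subset (Finset.subset_univ _) fun i _ hi => ?_
    rw [he i (by simpa using hi), mul_zero]
  have h2 := Matrix.eq_zero_of_mulVec_eq_zero (hM.2 e) h
  ext i
  by_cases hi : i ∈ Set.range e
  · obtain ⟨j, rfl⟩ := hi
    exact congrFun h2 j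
  · exact he i hi

theorem IsUniform.maxMinor_ne_zero {r : ℕ} {M : Matrix (Fin r) (Fin (r + 1)) ℂ} (hM : IsUniform M)
    (i : Fin (r + 1)) : maxMinor M i ≠ 0 :=
  mul_ne_zero (pow_ne_zero _ (by norm_num)) (hM.2 i.succAboveEmb)

/-- Subtracting the multiple of the minors that kills entry `0` leaves a kernel vector supported on
`r` columns, which are independent. -/
theorem IsUniform.eq_smul_maxMinor {r : ℕ} {M : Matrix (Fin r) (Fin (r + 1)) ℂ} (hM : IsUniform M)
    {w : Fin (r + 1) → ℂ} (hw : M.mulVec w = 0) : ∃ t : ℂ, w = t • maxMinor M := by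
  refine ⟨w 0 / maxMinor M 0, sub_eq_zero.1 ?_⟩
  refine hM.eq_zero_of_mulVec (e := (Fin.succAboveEmb 0)) ?_ fun i hi => ?_
  · rw [Matrix.mulVec_sub, Matrix.mulVec_smul, mulVec_maxMinor, hw]; simp
  · have : i = 0 := by
      by_contra h
      exact hi ⟨i.pred h, by simp⟩
    subst this
    simp [hM.maxMinor_ne_zero 0]

/-- Two entries of a nonzero kernel vector of a uniform `d × (d + 2)` matrix cannot vanish. -/
theorem IsUniform.eq_zero_of_two_zeros {d : ℕ} {M : Matrix (Fin d) (Fin (d + 2)) ℂ}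
    (hM : IsUniform M) {w : Fin (d + 2) → ℂ} (hw : M.mulVec w = 0) {i j : Fin (d + 2)}
    (hij : i ≠ j) (hi : w i = 0) (hj : w j = 0) : w = 0 := by
  obtain ⟨j', rfl⟩ := Fin.exists_succAbove_eq hij.symm
  refine hM.eq_zero_of_mulVec hw
    (e := (Fin.succAboveEmb j').trans (Fin.succAboveEmb i)) fun k hk => ?_
  by_cases hki : k = i
  · rw [hki, hi]
  obtain ⟨k', rfl⟩ := Fin.exists_succAbove_eq hki
  by_cases hkj : k' = j'
  · rw [hkj, hj]
  obtain ⟨k'', rfl⟩ := Fin.exists_succAbove_eq hkj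
  exact absurd ⟨k'', rfl⟩ hk

/-- The determinant of the weighted Gram matrix of `d + 2` vectors in terms of two linear
relations `v`, `w` between them. -/
theorem det_gram_mul {K : Type*} [Field K] {d : ℕ} (A : Matrix (Fin (d + 2)) (Fin d) K)
    (l v w c : Fin (d + 2) → K) (hl : ∀ i, l i ≠ 0) (hv : ∀ i, v i ≠ 0)
    (hAv : A.transpose.mulVec v = 0) (hAw : A.transpose.mulVec w = 0)
    (hc : ∀ q : Fin (d + 2) → K,
      (consRow q (consRow l A.transpose)).det = ∑ i, q i * c i) :
    (A.transpose * Matrix.diagonal (fun i => v i / l i) * A).det *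
      ((∑ i, l i * v i) * (∑ i, w i ^ 2 * l i / v i) - (∑ i, w i * l i) ^ 2) =
    (∑ i, w i * l i / v i * c i) ^ 2 * ∏ i, v i / l i := by
  -- The top row `q` is chosen so that `q D = w`, while `l D = v`. Both products are relations, so
  -- they annihilate the columns of `A`, and `N D Nᵀ` is block diagonal with blocks of size `2` and
  -- `d`.
  set q : Fin (d + 2) → K := fun i => w i * l i / v i with hq
  set N : Matrix (Fin (d + 2)) (Fin (d + 2)) K := consRow q (consRow l A.transpose) with hN
  set D : Fin (d + 2) → K := fun i => v i / l i with hD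
  have h1 : (N * Matrix.diagonal D * N.transpose).det =
      (∑ i, w i * l i / v i * c i) ^ 2 * ∏ i, v i / l i := by
    rw [Matrix.det_mul, Matrix.det_mul, Matrix.det_transpose, Matrix.det_diagonal, hN, hc q]
    ring
  rw [← h1]
  set e : Fin 2 ⊕ Fin d ≃ Fin (d + 2) := finSumFinEquiv.trans (finCongr (add_comm 2 d)) with he
  have e0 : e (Sum.inl 0) = 0 := by ext; simp [he]
  have e1 : e (Sum.inl 1) = 1 := by ext; simp [he]
  have e2 : ∀ j, e (Sum.inr j) = j.succ.succ := by intro j; ext; simp [he]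
  have N0 : N 0 = q := rfl
  have N1 : N 1 = l := rfl
  have N2 : ∀ j : Fin d, N j.succ.succ = fun i => A i j := fun j => rfl
  have key : ∀ a b, (N * Matrix.diagonal D * N.transpose) a b = ∑ i, N a i * D i * N b i := by
    intro a b
    rw [Matrix.mul_apply]
    simp [Matrix.mul_diagonal]
  have hlD : ∀ i, l i * D i = v i := fun i => by simp only [hD]; field_simp [hl i]
  have hqD : ∀ i, q i * D i = w i := fun i => by
    simp only [hD, hq]; field_simp [hl i, hv i]
  have s1 : ∀ j, ∑ i, v i * A i j = 0 := fun j => by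
    have := congrFun hAv j
    simpa [Matrix.mulVec, dotProduct, mul_comm] using this
  have s2 : ∀ j, ∑ i, w i * A i j = 0 := fun j => by
    have := congrFun hAw j
    simpa [Matrix.mulVec, dotProduct, mul_comm] using this
  have hblock : (N * Matrix.diagonal D * N.transpose).submatrix e e =
      Matrix.fromBlocks !![∑ i, w i ^ 2 * l i / v i, ∑ i, w i * l i; ∑ i, w i * l i, ∑ i, l i * v i]
        0 0 (A.transpose * Matrix.diagonal D * A) := by
    ext a b
    rw [Matrix.submatrix_apply, key]
    rcases a with a | a <;> rcases b with b | b
    · fin_cases a <;> fin_cases b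
      · simp only [Fin.zero_eta, e0, N0, hqD]
        simp only [Matrix.fromBlocks_apply₁₁]
        simp only [Matrix.of_apply, Matrix.cons_val_zero, hq]
        exact Finset.sum_congr rfl fun i _ => by ring
      · simp only [Fin.zero_eta, Fin.mk_one, e0, e1, N0, N1, hqD]
        simp [Matrix.fromBlocks_apply₁₁]
      · simp only [Fin.zero_eta, Fin.mk_one, e0, e1, N0, N1, hlD]
        simp only [Matrix.fromBlocks_apply₁₁]
        simp only [Matrix.of_apply, Matrix.cons_val_zero, Matrix.cons_val_one, hq]
        exact Finset.sum_congr rfl fun i _ => by field_simp [hv i]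
      · simp only [Fin.mk_one, e1, N1, hlD]
        simp [Matrix.fromBlocks_apply₁₁, mul_comm]
    · simp only [Matrix.fromBlocks_apply₁₂, Matrix.zero_apply, e2, N2]
      fin_cases a
      · simp only [Fin.zero_eta, e0, N0, hqD, s2]
      · simp only [Fin.mk_one, e1, N1, hlD, s1]
    · simp only [Matrix.fromBlocks_apply₂₁, Matrix.zero_apply, e2, N2]
      fin_cases b
      · simp only [Fin.zero_eta, e0, N0]
        rw [← s2 a]
        exact Finset.sum_congr rfl fun i _ => by rw [← hqD]; ring
      · simp only [Fin.mk_one, e1, N1]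
        rw [← s1 a]
        exact Finset.sum_congr rfl fun i _ => by rw [← hlD]; ring
    · simp only [Matrix.fromBlocks_apply₂₂, e2, N2]
      rw [Matrix.mul_apply]
      simp [Matrix.mul_diagonal]
  rw [← Matrix.det_submatrix_equiv_self e, hblock, Matrix.det_fromBlocks_zero₂₁,
    Matrix.det_fin_two_of]
  ring

/-- A row operation: replacing `b` by `b + A x` does not change `det [q, b, Aᵀ]`. -/
theorem det_cons_cons_add {K : Type*} [CommRing K] {d : ℕ} (A : Matrix (Fin (d + 2)) (Fin d) K)
    (b : Fin (d + 2) → K) (x : Fin d → K) (q : Fin (d + 2) → K) :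
    (consRow q (consRow (A.mulVec x + b) A.transpose)).det =
    (consRow q (consRow b A.transpose)).det := by
  set N := consRow q (consRow b A.transpose) with hN
  -- Row `1` is replaced by the combination of all rows with coefficients `0, 1, x`; only its own
  -- coefficient `1` enters the determinant.
  have h := Matrix.det_updateRow_sum N 1
    (Fin.cons 0 (Fin.cons 1 x : Fin (d + 1) → K) : Fin (d + 2) → K)
  have h1 : (Fin.cons 0 (Fin.cons 1 x : Fin (d + 1) → K) : Fin (d + 2) → K) 1 = 1 := rfl
  rw [h1, one_smul] at h
  rw [← h]
  congr 1
  ext i j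
  refine Fin.cases ?_ (fun i => Fin.cases ?_ (fun i => ?_) i) i
  · rw [Matrix.updateRow_ne (by simp)]
    simp [hN]
  · rw [show (Fin.succ 0 : Fin (d + 2)) = 1 from rfl, Matrix.updateRow_self]
    change (A.mulVec x + b) j = _
    simp [hN, Fin.sum_univ_succ, Matrix.mulVec, dotProduct, mul_comm, add_comm]
  · rw [Matrix.updateRow_ne (by intro h; simpa using Fin.succ_injective _ (h.trans (show (1 : Fin (d + 2)) = Fin.succ 0 from rfl)))]
    simp [hN]

end LogDisc

/-! ### The pencil of relations and the primality of its polynomial -/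

namespace LogDisc

/-- For `d + 2` columns with both matrices uniform, the kernel of `Aᵀ` has a basis `c, e` with
`b ⬝ c = 0`, `b ⬝ e = 1`, where `c` consists of the maximal minors of `[b | A]ᵀ`. -/
theorem exists_dual_vector {d : ℕ} {A : Matrix (Fin (d + 2)) (Fin d) ℂ} {b : Fin (d + 2) → ℂ}
    (hL : IsUniform (consRow b A.transpose)) :
    ∃ e : Fin (d + 2) → ℂ, A.transpose.mulVec e = 0 ∧ ∑ i, b i * e i = 1 := by
  -- Dropping column `0` leaves an invertible square matrix, so `e` can be found with `e_0 = 0`.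
  set N := (consRow b A.transpose).submatrix id (Fin.succ : Fin (d + 1) → Fin (d + 2)) with hN
  have hdet : IsUnit N.det := (hL.2 ⟨Fin.succ, Fin.succ_injective _⟩).isUnit
  set y := N⁻¹.mulVec (Pi.single 0 1) with hy
  have hNy : N.mulVec y = Pi.single 0 1 := by
    rw [hy, Matrix.mulVec_mulVec, Matrix.mul_nonsing_inv _ hdet, Matrix.one_mulVec]
  refine ⟨Fin.cons 0 y, ?_, ?_⟩
  · ext j
    have := congrFun hNy j.succ
    simpa [Matrix.mulVec, dotProduct, Fin.sum_univ_succ (n := d + 1), hN] using this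
  · have := congrFun hNy 0
    simpa [Matrix.mulVec, dotProduct, Fin.sum_univ_succ (n := d + 1), hN] using this

theorem consRow_mulVec_eq_zero {R : Type*} [CommRing R] {d m : ℕ} {A : Matrix (Fin m) (Fin d) R}
    {b w : Fin m → R} : (consRow b A.transpose).mulVec w = 0 ↔
      ∑ i, b i * w i = 0 ∧ A.transpose.mulVec w = 0 := by
  constructor
  · intro h
    exact ⟨congrFun h 0, funext fun j => congrFun h j.succ⟩
  · rintro ⟨h1, h2⟩
    ext j
    refine Fin.cases h1 (fun j => congrFun h2 j) j

section Pencil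

variable {d : ℕ} {A : Matrix (Fin (d + 2)) (Fin d) ℂ} {b c e : Fin (d + 2) → ℂ}

/-- Off the member `c` of the pencil spanned by `c` and `e`, the vector
`(c_i² ∏_{k ≠ i} v_k)_i` is not a relation between the rows of `[b | A]`. -/
theorem sq_mul_prod_not_relation (hL : IsUniform (consRow b A.transpose))
    (hA : IsUniform A.transpose) (hc : c = maxMinor (consRow b A.transpose))
    {v : Fin (d + 2) → ℂ} (hAv : A.transpose.mulVec v = 0) (hbv : ∑ i, b i * v i = 1)
    (hrow : ∀ i, A i ≠ 0) :
    (consRow b A.transpose).mulVec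
      (fun i => c i ^ 2 * ∏ k ∈ Finset.univ.erase i, v k) ≠ 0 := by
  intro h
  have hc0 : ∀ i, c i ≠ 0 := fun i => hc ▸ hL.maxMinor_ne_zero i
  have hv0 : v ≠ 0 := by rintro rfl; simp at hbv
  obtain ⟨t, ht⟩ := hL.eq_smul_maxMinor h
  rw [← hc] at ht
  have hbc : ∑ i, b i * c i = 0 :=
    (consRow_mulVec_eq_zero.1 (hc ▸ mulVec_maxMinor (consRow b A.transpose))).1
  -- If `v_i = 0`, no other entry vanishes, so only the `i`-th entry of the vector survives, and row
  -- `i` of `A` would be zero.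
  by_cases hz : ∃ i, v i = 0
  · obtain ⟨i, hi⟩ := hz
    have hne : ∀ k, k ≠ i → v k ≠ 0 := fun k hk h0 => hv0 (hA.eq_zero_of_two_zeros hAv hk h0 hi)
    obtain ⟨j, hj⟩ := Function.ne_iff.1 (hrow i)
    have h1 := congrFun (consRow_mulVec_eq_zero.1 h).2 j
    simp only [Matrix.mulVec, dotProduct, Matrix.transpose_apply, Pi.zero_apply] at h1
    rw [Finset.sum_eq_single i] at h1
    · refine mul_ne_zero hj (mul_ne_zero (pow_ne_zero 2 (hc0 i)) ?_) h1
      exact Finset.prod_ne_zero_iff.2 fun k hk => hne k (Finset.ne_of_mem_erase hk)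
    · intro k _ hk
      rw [Finset.prod_eq_zero (Finset.mem_erase.2 ⟨hk.symm, Finset.mem_univ i⟩) hi]
      simp
    · simp
  -- Otherwise the vector is `t c`, whence `c ∏ v_k = t v`. Pairing with `b`, where `b ⬝ c = 0` and
  -- `b ⬝ v = 1`, gives `t = 0`, which is impossible.
  · push Not at hz
    have h1 : ∀ i, c i * ∏ k, v k = t * v i := fun i => by
      have := congrFun ht i
      simp only [Pi.smul_apply, smul_eq_mul] at this
      rw [← Finset.mul_prod_erase Finset.univ v (Finset.mem_univ i)]
      have h2 : c i * (c i * ∏ k ∈ Finset.univ.erase i, v k) = c i * t := by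
        rw [mul_comm (c i) t, ← this]; ring
      have := mul_left_cancel₀ (hc0 i) h2
      rw [← this]; ring
    have hP : ∏ k, v k ≠ 0 := Finset.prod_ne_zero_iff.2 fun k _ => hz k
    have h3 : t = 0 := by
      have : ∑ i, b i * (c i * ∏ k, v k) = t := by
        simp_rw [h1]
        calc ∑ i, b i * (t * v i) = t * ∑ i, b i * v i := by
              rw [Finset.mul_sum]
              exact Finset.sum_congr rfl fun i _ => by ring
          _ = t := by rw [hbv, mul_one]
      rw [← this]
      simp_rw [← mul_assoc]
      rw [← Finset.sum_mul, hbc, zero_mul]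
    have := h1 0
    rw [h3, zero_mul] at this
    exact mul_ne_zero (hc0 0) hP this

open Polynomial in
/-- The polynomial `∑ i, c_i² a_i ∏_{k ≠ i} (c_k α + e_k)`. -/
def pencilCoeff (c e a : Fin (d + 2) → ℂ) : ℂ[X] :=
  ∑ i, C (c i ^ 2 * a i) * ∏ k ∈ Finset.univ.erase i, (C (c k) * X + C (e k))

variable (A b c e) in
open Polynomial in
/-- The polynomial `∑ i, c_i² ℓ_i ∏_{k ≠ i} (c_k α + e_k)` in `α`. -/
def pencilPoly : (MvPolynomial (Fin d) ℂ)[X] :=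
  ∑ i, C (MvPolynomial.C (c i ^ 2) * form A b i) *
    ∏ k ∈ Finset.univ.erase i, (C (MvPolynomial.C (c k)) * X + C (MvPolynomial.C (e k)))

/-- Exchanging the roles of the variable `α` and the variables `x_j`. -/
def swapVariables (d : ℕ) :
    Polynomial (MvPolynomial (Fin d) ℂ) ≃ₐ[ℂ] MvPolynomial (Fin d) (Polynomial ℂ) :=
  (MvPolynomial.optionEquivLeft ℂ (Fin d)).symm.trans (MvPolynomial.optionEquivRight ℂ (Fin d))

theorem swapVariables_C_C (r : ℂ) : swapVariables d (Polynomial.C (MvPolynomial.C r)) =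
    MvPolynomial.C (Polynomial.C r) := by
  simp [swapVariables]

theorem swapVariables_C_X (j : Fin d) : swapVariables d (Polynomial.C (MvPolynomial.X j)) =
    MvPolynomial.X j := by
  simp [swapVariables]

theorem swapVariables_X : swapVariables d Polynomial.X = MvPolynomial.C Polynomial.X := by
  simp [swapVariables]

theorem swapVariables_pencilPoly : swapVariables d (pencilPoly A b c e) =
    ∑ j, MvPolynomial.C (pencilCoeff c e fun i => A i j) * MvPolynomial.X j +
      MvPolynomial.C (pencilCoeff c e b) := by
  simp only [pencilPoly, form, map_sum, map_mul, map_prod, map_add, swapVariables_C_C,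
    swapVariables_C_X, swapVariables_X, pencilCoeff, Finset.sum_mul, mul_add, add_mul, Finset.mul_sum,
    Finset.sum_add_distrib]
  rw [Finset.sum_comm]
  exact congrArg₂ _ (Finset.sum_congr rfl fun j _ => Finset.sum_congr rfl fun i _ => by ring)
    (Finset.sum_congr rfl fun i _ => by ring)

theorem eval_pencilCoeff (a : Fin (d + 2) → ℂ) (z : ℂ) : (pencilCoeff c e a).eval z =
    ∑ i, a i * (c i ^ 2 * ∏ k ∈ Finset.univ.erase i, (c k * z + e k)) := by
  simp only [pencilCoeff, Polynomial.eval_finsetSum, Polynomial.eval_mul, Polynomial.eval_C,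
    Polynomial.eval_prod, Polynomial.eval_add, Polynomial.eval_X]
  exact Finset.sum_congr rfl fun i _ => by ring

theorem relation_pencil (hc : c = maxMinor (consRow b A.transpose))
    (hAe : A.transpose.mulVec e = 0) (hbe : ∑ i, b i * e i = 1) (z : ℂ) :
    A.transpose.mulVec (fun k => c k * z + e k) = 0 ∧ ∑ i, b i * (c i * z + e i) = 1 := by
  have h := consRow_mulVec_eq_zero.1 (hc ▸ mulVec_maxMinor (consRow b A.transpose))
  constructor
  · have : (fun k => c k * z + e k) = z • c + e := by ext; simp [mul_comm]
    rw [this, Matrix.mulVec_add, Matrix.mulVec_smul, h.2, hAe]; simp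
  · simp_rw [mul_add, ← mul_assoc]
    rw [Finset.sum_add_distrib, ← Finset.sum_mul, h.1, hbe]; simp

/-- Read as a polynomial in `x` over `ℂ[α]`, it has total degree one, so irreducibility only
requires that its coefficients have no common factor. Such a factor would have a root `z`, and there
`c_i² ∏_{k ≠ i} (c_k z + e_k)` would be a relation between the rows of `[b | A]`. -/
theorem pencilPoly_prime (hL : IsUniform (consRow b A.transpose))
    (hA : IsUniform A.transpose) (hc : c = maxMinor (consRow b A.transpose))
    (hAe : A.transpose.mulVec e = 0) (hbe : ∑ i, b i * e i = 1)
    (hrow : ∀ i, A i ≠ 0) : Prime (pencilPoly A b c e) := by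
  have hroot : ∀ z, ¬ ((∀ j, (pencilCoeff c e fun i => A i j).eval z = 0) ∧
      (pencilCoeff c e b).eval z = 0) := by
    rintro z ⟨h1, h2⟩
    obtain ⟨h3, h4⟩ := relation_pencil hc hAe hbe z
    refine sq_mul_prod_not_relation hL hA hc h3 h4 hrow (consRow_mulVec_eq_zero.2 ⟨?_, ?_⟩)
    · rwa [eval_pencilCoeff] at h2
    · ext j
      have := h1 j
      rwa [eval_pencilCoeff] at this
  have hc0 : ∀ i, c i ≠ 0 := fun i => hc ▸ hL.maxMinor_ne_zero i
  have hne : ∃ j, (pencilCoeff c e fun i => A i j) ≠ 0 := by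
    obtain ⟨j, hj⟩ := Function.ne_iff.1 (hrow 0)
    refine ⟨j, fun h0 => ?_⟩
    -- At the root of the factor with index `0` only the summand `i = 0` survives, and it is nonzero
    -- because no second factor vanishes there.
    have h := congrArg (Polynomial.eval (-e 0 / c 0)) h0
    obtain ⟨h3, h4⟩ := relation_pencil hc hAe hbe (-e 0 / c 0)
    have hz : c 0 * (-e 0 / c 0) + e 0 = 0 := by field_simp [hc0 0]; ring
    rw [eval_pencilCoeff, Finset.sum_eq_single 0] at h
    · simp only [Polynomial.eval_zero] at h
      refine mul_ne_zero hj (mul_ne_zero (pow_ne_zero 2 (hc0 0)) ?_) h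
      refine Finset.prod_ne_zero_iff.2 fun k hk hk0 => ?_
      have := hA.eq_zero_of_two_zeros h3 (Finset.ne_of_mem_erase hk) hk0 hz
      rw [show (fun i => b i * (c i * (-e 0 / c 0) + e i)) = fun i => 0 from funext fun i => by
        rw [show c i * (-e 0 / c 0) + e i = 0 from congrFun this i, mul_zero]] at h4
      simp at h4
    · intro k _ hk
      rw [Finset.prod_eq_zero (Finset.mem_erase.2 ⟨hk.symm, Finset.mem_univ 0⟩) hz]
      simp
    · simp
  have hirr : Irreducible (swapVariables d (pencilPoly A b c e)) := by
    rw [swapVariables_pencilPoly]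
    have hcoeff : ∀ j, (∑ j, MvPolynomial.C (pencilCoeff c e fun i => A i j) * MvPolynomial.X j +
      MvPolynomial.C (pencilCoeff c e b)).coeff (Finsupp.single j 1) =
        pencilCoeff c e fun i => A i j := fun j => by
      classical
      rw [MvPolynomial.coeff_add, MvPolynomial.coeff_sum, Finset.sum_eq_single j]
      · rw [MvPolynomial.coeff_C_mul, MvPolynomial.coeff_X, MvPolynomial.coeff_C]
        simp only [if_true, mul_one, add_eq_left, ite_eq_right_iff]
        exact fun h => absurd h.symm (Finsupp.single_ne_zero.2 one_ne_zero)
      · intro k _ hk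
        rw [MvPolynomial.coeff_C_mul, MvPolynomial.coeff_X, if_neg, mul_zero]
        exact fun h => hk (Finsupp.single_left_injective one_ne_zero h)
      · simp
    apply MvPolynomial.irreducible_of_totalDegree_eq_one
    · refine le_antisymm ?_ ?_
      · refine (MvPolynomial.totalDegree_add _ _).trans (max_le ?_ (by simp))
        refine MvPolynomial.totalDegree_finsetSum_le fun j _ => ?_
        refine (MvPolynomial.totalDegree_mul _ _).trans ?_
        simp
      · obtain ⟨j, hj⟩ := hne
        have := MvPolynomial.le_totalDegree (MvPolynomial.mem_support_iff.2 ((hcoeff j).symm ▸ hj))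
        simpa using this
    · intro p hp
      have h1 : ∀ j, p ∣ pencilCoeff c e fun i => A i j := fun j => hcoeff j ▸ hp _
      have h2 : p ∣ pencilCoeff c e b := by
        have := hp 0
        rwa [MvPolynomial.coeff_add, MvPolynomial.coeff_sum, Finset.sum_eq_zero,
          zero_add, MvPolynomial.coeff_zero_C] at this
        intro k _
        simp
      by_contra hu
      have hdeg : p.degree ≠ 0 := fun h => hu (Polynomial.isUnit_iff_degree_eq_zero.2 h)
      obtain ⟨z, hz⟩ := IsAlgClosed.exists_root p hdeg
      exact hroot z ⟨fun j => Polynomial.eval_eq_zero_of_dvd_of_eval_eq_zero (h1 j) hz,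
        Polynomial.eval_eq_zero_of_dvd_of_eval_eq_zero h2 hz⟩
  exact (MulEquiv.prime_iff (swapVariables d)).1 hirr.prime

end Pencil

end LogDisc

/-! ### The coordinate ring of the complement and Gram matrices over it -/

namespace LogDisc

variable {n d : ℕ} (A : Matrix (Fin (n + 1)) (Fin d) ℂ) (b : Fin (n + 1) → ℂ)

/-- The affine-linear form `ℓ_i` as a function on the complement. -/
def ell (i : Fin (n + 1)) : CoordRing A b :=
  algebraMap (MvPolynomial (Fin d) ℂ) (CoordRing A b) (form A b i)

/-- The inverse of `ℓ_i` on the complement. -/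
def ellInv (i : Fin (n + 1)) : CoordRing A b := ((isUnit_form A b i).unit⁻¹ : (CoordRing A b)ˣ)

/-- The coordinate function `x_j` on the complement. -/
def coord (j : Fin d) : CoordRing A b :=
  algebraMap (MvPolynomial (Fin d) ℂ) (CoordRing A b) (MvPolynomial.X j)

theorem ell_mul_ellInv (i : Fin (n + 1)) : ell A b i * ellInv A b i = 1 :=
  (isUnit_form A b i).mul_val_inv

theorem ell_eq (i : Fin (n + 1)) : ell A b i =
    ∑ j, algebraMap ℂ (CoordRing A b) (A i j) * coord A b j +
      algebraMap ℂ (CoordRing A b) (b i) := by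
  simp only [ell, form, map_add, map_sum, map_mul, coord]
  rw [← MvPolynomial.algebraMap_eq, ← IsScalarTower.algebraMap_apply]
  simp only [← IsScalarTower.algebraMap_apply]

theorem pderiv_form (j : Fin d) (k : Fin (n + 1)) :
    MvPolynomial.pderiv j (form A b k) = MvPolynomial.C (A k j) := by
  classical
  simp only [form, map_add, map_sum, Derivation.leibniz, MvPolynomial.pderiv_C,
    MvPolynomial.pderiv_X, add_zero, smul_eq_mul]
  rw [Finset.sum_eq_single j]
  · simp
  · intro i _ hi; simp [hi]
  · simp

theorem logDerivForm_eq (j : Fin d) (k : Fin (n + 1)) :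
    logDerivForm A b j k = algebraMap ℂ (CoordRing A b) (A k j) * ellInv A b k := by
  rw [logDerivForm, pderiv_form, ← MvPolynomial.algebraMap_eq, ← IsScalarTower.algebraMap_apply]
  rfl

variable {A b}

theorem form_ne_zero {i : Fin (n + 1)} (h : A i ≠ 0) : form A b i ≠ 0 := by
  obtain ⟨j, hj⟩ := Function.ne_iff.1 h
  intro h0
  have := congrArg (MvPolynomial.pderiv j) h0
  rw [pderiv_form, map_zero, ← MvPolynomial.C_0] at this
  exact hj (MvPolynomial.C_injective _ _ this)

theorem powers_prod_form_le (hA : ∀ i, A i ≠ 0) :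
    Submonoid.powers (∏ i, form A b i) ≤ nonZeroDivisors (MvPolynomial (Fin d) ℂ) :=
  powers_le_nonZeroDivisors_of_noZeroDivisors
    (Finset.prod_ne_zero_iff.2 fun i _ => form_ne_zero (hA i))

theorem isDomain_coordRing (hA : ∀ i, A i ≠ 0) : IsDomain (CoordRing A b) :=
  IsLocalization.isDomain_localization (powers_prod_form_le (b := b) hA)

theorem algebraMap_coordRing_injective (hA : ∀ i, A i ≠ 0) :
    Function.Injective (algebraMap (MvPolynomial (Fin d) ℂ) (CoordRing A b)) :=
  IsLocalization.injective _ (powers_prod_form_le (b := b) hA)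

/-- The matrix `(∑ k, a_{kj} a_{kl} y_k / ℓ_k)_{jl}` for elements `y_k` of an algebra over the
coordinate ring of the complement. -/
def gram {S : Type*} [CommRing S] (φ : CoordRing A b →+* S) (y : Fin (n + 1) → S) :
    Matrix (Fin d) (Fin d) S :=
  Matrix.of fun j l => ∑ k, φ (algebraMap ℂ _ (A k j * A k l) * ellInv A b k) * y k

theorem gram_map {S S' : Type*} [CommRing S] [CommRing S'] (φ : CoordRing A b →+* S)
    (f : S →+* S') (y : Fin (n + 1) → S) :
    (gram φ y).map f = gram (f.comp φ) (f ∘ y) := by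
  ext j l
  simp [gram, Matrix.map_apply]

theorem map_det_gram {S S' : Type*} [CommRing S] [CommRing S'] (φ : CoordRing A b →+* S)
    (f : S →+* S') (y : Fin (n + 1) → S) :
    f (gram φ y).det = (gram (f.comp φ) (f ∘ y)).det := by
  rw [← gram_map, RingHom.map_det]; rfl

theorem sum_mul_extend {R : Type*} [Semiring R] {m N : ℕ} (s : Fin m ↪ Fin N) (f : Fin N → R)
    (g : Fin m → R) : ∑ k, f k * Function.extend s g 0 k = ∑ i, f (s i) * g i := by
  rw [← Finset.sum_subset (Finset.subset_univ (Finset.univ.map s))]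
  · rw [Finset.sum_map]
    simp [s.injective.extend_apply]
  · intro k _ hk
    rw [Function.extend_apply', Pi.zero_apply, mul_zero]
    rintro ⟨i, rfl⟩
    exact hk (Finset.mem_map_of_mem _ (Finset.mem_univ i))

section Field

variable (s : Fin (d + 2) ↪ Fin (n + 1)) {K : Type*} [Field K] (φ : CoordRing A b →+* K)

theorem gram_extend (v : Fin (d + 2) → K) :
    gram φ (Function.extend s v 0) =
      ((A.submatrix s id).map (φ.comp (algebraMap ℂ _))).transpose *
        Matrix.diagonal (fun i => v i / φ (ell A b (s i))) *
        (A.submatrix s id).map (φ.comp (algebraMap ℂ _)) := by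
  ext j l
  simp only [gram, Matrix.of_apply, sum_mul_extend]
  rw [Matrix.mul_apply]
  simp only [Matrix.mul_diagonal, Matrix.transpose_apply, Matrix.map_apply,
    Matrix.submatrix_apply, id]
  refine Finset.sum_congr rfl fun i _ => ?_
  have h : φ (ell A b (s i)) * φ (ellInv A b (s i)) = 1 := by
    rw [← map_mul, ell_mul_ellInv, map_one]
  rw [div_eq_mul_inv, ← eq_inv_of_mul_eq_one_right h]
  simp only [map_mul, RingHom.comp_apply]
  ring

/-- With `ℓ = A x + b`, the part `A x` pairs to zero with every relation, so the sum is independent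
of `x`. -/
theorem sum_ell_mul {v : Fin (d + 2) → K}
    (hv : ((A.submatrix s id).map (φ.comp (algebraMap ℂ _))).transpose.mulVec v = 0) :
    ∑ i, φ (ell A b (s i)) * v i = ∑ i, φ (algebraMap ℂ _ (b (s i))) * v i := by
  simp only [ell_eq, map_add, map_sum, map_mul, add_mul, Finset.sum_mul, Finset.sum_add_distrib]
  rw [Finset.sum_comm, add_eq_right]
  refine Finset.sum_eq_zero fun j _ => ?_
  have := congrFun hv j
  simp only [Matrix.mulVec, dotProduct, Matrix.transpose_apply, Matrix.map_apply,
    Matrix.submatrix_apply, id, Pi.zero_apply, RingHom.comp_apply] at this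
  rw [← mul_zero (φ (coord A b j)), ← this, Finset.mul_sum]
  exact Finset.sum_congr rfl fun i _ => by ring

/-- An instance of `det_gram_mul` for `l = ℓ`. The bordered determinant involves only the constant
minors of `[b | A]ᵀ`, because `ℓ` differs from `b` by a combination of the columns of `A`. -/
theorem det_gram_extend_mul {v w : Fin (d + 2) → K} (hv : ∀ i, v i ≠ 0)
    (hAv : ((A.submatrix s id).map (φ.comp (algebraMap ℂ _))).transpose.mulVec v = 0)
    (hAw : ((A.submatrix s id).map (φ.comp (algebraMap ℂ _))).transpose.mulVec w = 0) :
    (gram φ (Function.extend s v 0)).det *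
      ((∑ i, φ (ell A b (s i)) * v i) * (∑ i, w i ^ 2 * φ (ell A b (s i)) / v i) -
        (∑ i, w i * φ (ell A b (s i))) ^ 2) =
    (∑ i, w i * φ (ell A b (s i)) / v i *
      φ (algebraMap ℂ _ (maxMinor (consRow (b ∘ s) (A.submatrix s id).transpose) i))) ^ 2 *
        ∏ i, v i / φ (ell A b (s i)) := by
  rw [gram_extend]
  refine det_gram_mul _ _ v w _ (fun i => ?_) hv hAv hAw fun q => ?_
  · exact (((isUnit_form A b (s i)).map φ)).ne_zero
  · have h1 : (fun i => φ (ell A b (s i))) =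
        ((A.submatrix s id).map (φ.comp (algebraMap ℂ _))).mulVec (fun j => φ (coord A b j)) +
          fun i => φ (algebraMap ℂ _ (b (s i))) := by
      ext i
      simp [ell_eq, Matrix.mulVec, dotProduct]
    rw [h1, det_cons_cons_add, det_cons_eq_sum_maxMinor]
    refine Finset.sum_congr rfl fun i _ => ?_
    rw [← RingHom.comp_apply, ← maxMinor_map]
    congr 2
    ext i j
    refine Fin.cases rfl (fun i => rfl) i

end Field

end LogDisc

/-! ### The Gram determinant along the pencil -/

namespace LogDisc

variable {n d : ℕ} {A : Matrix (Fin (n + 1)) (Fin d) ℂ} {b : Fin (n + 1) → ℂ}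

variable (A b) in
open Polynomial in
/-- The pencil `α c + e`, supported on the image of `s`, over the coordinate ring. -/
def pencil (s : Fin (d + 2) ↪ Fin (n + 1)) (c e : Fin (d + 2) → ℂ) :
    Fin (n + 1) → (CoordRing A b)[X] :=
  Function.extend s (fun i => C (algebraMap ℂ _ (c i)) * X + C (algebraMap ℂ _ (e i))) 0

theorem algebraMap_mulVec_eq_zero {m r : ℕ} {M : Matrix (Fin m) (Fin r) ℂ}
    {v : Fin r → ℂ} (h : M.mulVec v = 0) {S : Type*} [CommRing S] (f : ℂ →+* S) :
    (M.map f).mulVec (fun i => f (v i)) = 0 := by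
  ext j
  have := congrArg f (congrFun h j)
  simpa [Matrix.mulVec, dotProduct] using this

section Pencil

variable (hA : ∀ i, A i ≠ 0) {s : Fin (d + 2) ↪ Fin (n + 1)} {c e : Fin (d + 2) → ℂ}
  (hL : IsUniform (consRow (b ∘ s) (A.submatrix s id).transpose))
  (hc : c = maxMinor (consRow (b ∘ s) (A.submatrix s id).transpose))
  (hAe : (A.submatrix s id).transpose.mulVec e = 0) (hbe : ∑ i, b (s i) * e i = 1)

include hA hL hc hAe hbe

/-- This is the leading coefficient in `α` along the pencil. In `det_gram_extend_mul` with `v = c`,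
`w = e`, the relations `ℓ ⬝ c = 0` and `ℓ ⬝ e = 1` reduce the identity to `-det = ∏ c_i / ℓ_i`. -/
theorem det_gram_extend_ne_zero :
    (gram (RingHom.id (CoordRing A b))
      (Function.extend s (fun i => algebraMap ℂ _ (c i)) 0)).det ≠ 0 := by
  have := isDomain_coordRing (b := b) hA
  set φ := algebraMap (CoordRing A b) (FractionRing (CoordRing A b)) with hφ
  set ι := φ.comp (algebraMap ℂ (CoordRing A b)) with hι
  intro h0
  have h1 := congrArg φ h0
  rw [map_det_gram, RingHom.comp_id, map_zero] at h1
  have hcomp : φ ∘ Function.extend s (fun i => algebraMap ℂ (CoordRing A b) (c i)) 0 =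
      Function.extend s (fun i => ι (c i)) 0 := by
    ext k
    by_cases hk : ∃ i, s i = k
    · obtain ⟨i, rfl⟩ := hk
      simp [s.injective.extend_apply, hι]
    · simp [Function.extend_apply' _ _ _ hk]
  rw [hcomp] at h1
  have hrel := consRow_mulVec_eq_zero.1
    (hc ▸ mulVec_maxMinor (consRow (b ∘ s) (A.submatrix s id).transpose))
  have hc0 : ∀ i, ι (c i) ≠ 0 := fun i => (map_ne_zero ι).2 (hc ▸ hL.maxMinor_ne_zero i)
  have hl0 : ∀ i, φ (ell A b i) ≠ 0 := fun i => ((isUnit_form A b i).map φ).ne_zero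
  have key := det_gram_extend_mul (A := A) (b := b) s φ (v := fun i => ι (c i))
    (w := fun i => ι (e i)) hc0 (algebraMap_mulVec_eq_zero hrel.2 ι)
    (algebraMap_mulVec_eq_zero hAe ι)
  have h2 : ∑ i, φ (ell A b (s i)) * ι (c i) = 0 := by
    rw [sum_ell_mul s φ (algebraMap_mulVec_eq_zero hrel.2 ι)]
    have := congrArg ι hrel.1
    simpa [hι] using this
  have h3 : ∑ i, φ (ell A b (s i)) * ι (e i) = 1 := by
    rw [sum_ell_mul s φ (algebraMap_mulVec_eq_zero hAe ι)]
    have := congrArg ι hbe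
    simpa [hι] using this
  rw [h1, zero_mul] at key
  refine mul_ne_zero (pow_ne_zero 2 ?_) ?_ key.symm
  · rw [← hc]
    have : ∀ i, ι (e i) * φ (ell A b (s i)) / ι (c i) * φ (algebraMap ℂ _ (c i)) =
        φ (ell A b (s i)) * ι (e i) := fun i => by
      rw [← RingHom.comp_apply φ, ← hι]
      field_simp [hc0 i]
    simp_rw [this]
    rw [h3]
    exact one_ne_zero
  · exact Finset.prod_ne_zero_iff.2 fun i _ => div_ne_zero (hc0 i) (hl0 _)

open Polynomial in
-- Take `v = α c + e` and `w = c` in `det_gram_extend_mul`. As `ℓ ⬝ v = 1` and `ℓ ⬝ c = 0`, it reads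
-- `det * S = S² ∏ v_i / ℓ_i` with `S = ∑ c_i² ℓ_i / v_i`, and `S ∏ v_i` is the pencil polynomial.
-- The embedding `κ` into a field makes the divisions possible.
theorem det_gram_pencil_mul (hU : IsUniform (A.submatrix s id).transpose)
    {K : Type} [Field K] (κ : (CoordRing A b)[X] →+* K) (hκi : Function.Injective κ) :
    (gram C (pencil A b s c e)).det * ∏ i, C (ell A b (s i)) =
    (pencilPoly (A.submatrix s id) (b ∘ s) c e).map
      (algebraMap (MvPolynomial (Fin d) ℂ) (CoordRing A b)) := by
  have := isDomain_coordRing (b := b) hA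
  set φ : CoordRing A b →+* K := κ.comp C with hφ
  set ι := φ.comp (algebraMap ℂ (CoordRing A b)) with hι
  have hrel := consRow_mulVec_eq_zero.1
    (hc ▸ mulVec_maxMinor (consRow (b ∘ s) (A.submatrix s id).transpose))
  have hc0 : ∀ i, c i ≠ 0 := fun i => hc ▸ hL.maxMinor_ne_zero i
  have hιc : ∀ i, ι (c i) ≠ 0 := fun i => (map_ne_zero ι).2 (hc0 i)
  have hl0 : ∀ i, φ (ell A b i) ≠ 0 := fun i => ((isUnit_form A b i).map φ).ne_zero
  set v : Fin (d + 2) → K := fun i => ι (c i) * κ X + ι (e i) with hv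
  have hv0 : ∀ i, v i ≠ 0 := fun i h0 => by
    have h1 : C (algebraMap ℂ (CoordRing A b) (c i)) * X + C (algebraMap ℂ (CoordRing A b) (e i))
        = 0 := hκi (by simpa [hv, hι, hφ] using h0)
    have h2 := congrArg (fun p => p.coeff 1) h1
    simp only [coeff_add, coeff_C_mul, coeff_X_one, mul_one, coeff_C_succ, add_zero,
      coeff_zero] at h2
    exact hc0 i ((map_eq_zero (algebraMap ℂ (CoordRing A b))).1 h2)
  have hAv : ((A.submatrix s id).map ι).transpose.mulVec v = 0 := by
    have : v = κ X • (fun i => ι (c i)) + fun i => ι (e i) := by ext; simp [hv, mul_comm]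
    rw [this, Matrix.mulVec_add, Matrix.mulVec_smul]
    erw [algebraMap_mulVec_eq_zero hrel.2 ι, algebraMap_mulVec_eq_zero hAe ι]
    simp
  have key := det_gram_extend_mul (A := A) (b := b) s φ (v := v)
    (w := fun i => ι (c i)) hv0 hAv (algebraMap_mulVec_eq_zero hrel.2 ι)
  have h2 : ∑ i, ι (c i) * φ (ell A b (s i)) = 0 := by
    simp_rw [mul_comm (ι _)]
    rw [sum_ell_mul s φ (algebraMap_mulVec_eq_zero hrel.2 ι)]
    have := congrArg ι hrel.1
    simpa [hι] using this
  have h3 : ∑ i, φ (ell A b (s i)) * v i = 1 := by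
    rw [sum_ell_mul s φ hAv]
    simp only [hv, mul_add, Finset.sum_add_distrib, ← mul_assoc, ← Finset.sum_mul]
    have e1 := congrArg ι hrel.1
    have e2 := congrArg ι hbe
    simp only [map_sum, map_mul, map_zero, map_one, Function.comp] at e1 e2
    change (∑ i, ι (b (s i)) * ι (c i)) * κ X + ∑ i, ι (b (s i)) * ι (e i) = 1
    rw [e1, e2]; simp
  set S := ∑ i, ι (c i) ^ 2 * φ (ell A b (s i)) / v i with hS
  have h4 : ∑ i, ι (c i) * φ (ell A b (s i)) / v i * φ (algebraMap ℂ _ (c i)) = S :=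
    Finset.sum_congr rfl fun i _ => by
      rw [← RingHom.comp_apply φ, ← hι]; ring
  rw [← hc, h2, h3, h4, one_mul, zero_pow two_ne_zero, sub_zero] at key
  have h5 : S * ∏ i, v i = κ ((pencilPoly (A.submatrix s id) (b ∘ s) c e).map
      (algebraMap (MvPolynomial (Fin d) ℂ) (CoordRing A b))) := by
    rw [pencilPoly, Polynomial.map_sum, map_sum]
    rw [hS, Finset.sum_mul]
    refine Finset.sum_congr rfl fun i _ => ?_
    rw [← Finset.mul_prod_erase Finset.univ v (Finset.mem_univ i)]
    have hC : ∀ r : ℂ, κ (C (algebraMap (MvPolynomial (Fin d) ℂ) (CoordRing A b)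
        (MvPolynomial.C r))) = ι r := fun r => by
      rw [← MvPolynomial.algebraMap_eq, ← IsScalarTower.algebraMap_apply]; rfl
    simp only [Polynomial.map_mul, Polynomial.map_prod, Polynomial.map_add, map_C, map_X, map_mul,
      map_prod, map_add, hC]
    have : κ (C (algebraMap (MvPolynomial (Fin d) ℂ) (CoordRing A b)
        (form (A.submatrix s id) (b ∘ s) i))) = φ (ell A b (s i)) := rfl
    rw [this, map_pow]
    change _ = _ * ∏ k ∈ Finset.univ.erase i, v k
    field_simp [hv0 i]
  have hP0 : pencilPoly (A.submatrix s id) (b ∘ s) c e ≠ 0 :=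
    (pencilPoly_prime hL hU hc hAe hbe fun i => hA (s i)).ne_zero
  -- `S` may be cancelled because the pencil polynomial, being prime, is nonzero.
  have hS0 : S ≠ 0 := by
    rintro h0
    rw [h0, zero_mul, eq_comm, map_eq_zero_iff κ hκi, Polynomial.map_eq_zero_iff
      (algebraMap_coordRing_injective hA)] at h5
    exact hP0 h5
  have h6 : (gram φ (Function.extend s v 0)).det * ∏ i, φ (ell A b (s i)) = S * ∏ i, v i := by
    have : (gram φ (Function.extend s v 0)).det = S * ∏ i, v i / φ (ell A b (s i)) :=
      mul_right_cancel₀ hS0 (by rw [key]; ring)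
    rw [this, Finset.prod_div_distrib, mul_assoc, div_mul_cancel₀]
    exact Finset.prod_ne_zero_iff.2 fun i _ => hl0 _
  apply hκi
  rw [← h5, ← h6, map_mul, map_det_gram, map_prod]
  congr 3
  ext k
  by_cases hk : ∃ i, s i = k
  · obtain ⟨i, rfl⟩ := hk
    simp [pencil, s.injective.extend_apply, hι, hφ, hv]
  · simp [pencil, Function.extend_apply' _ _ _ hk]

end Pencil

end LogDisc

/-! ### The Hessian and its primality -/

namespace LogDisc

variable {n d : ℕ} {A : Matrix (Fin (n + 1)) (Fin d) ℂ} {b : Fin (n + 1) → ℂ}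

section RelVar

variable (A b) in
/-- The generic relation between the rows of `A`: the entries of `(1 - σ Aᵀ) y`, for a right
inverse `σ` of `Aᵀ` and indeterminates `y`. -/
def relVar (σ : Matrix (Fin (n + 1)) (Fin d) ℂ) (k : Fin (n + 1)) :
    MvPolynomial (Fin (n + 1)) (CoordRing A b) :=
  MvPolynomial.X k - ∑ j, MvPolynomial.C (algebraMap ℂ _ (σ k j)) *
    ∑ l, MvPolynomial.C (algebraMap ℂ _ (A l j)) * MvPolynomial.X l

variable {σ : Matrix (Fin (n + 1)) (Fin d) ℂ}

/-- On an actual relation the correction term `σ Aᵀ y` vanishes, so the generic relation specializes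
to every given one. -/
theorem eval₂Hom_relVar {S : Type*} [CommRing S] (φ : CoordRing A b →+* S) (y : Fin (n + 1) → S)
    (hy : ∀ j, ∑ l, φ (algebraMap ℂ _ (A l j)) * y l = 0) (k : Fin (n + 1)) :
    MvPolynomial.eval₂Hom φ y (relVar A b σ k) = y k := by
  simp [relVar, hy]

theorem sum_mul_relVar (hσ : A.transpose * σ = 1) (j : Fin d) :
    ∑ k, MvPolynomial.C (algebraMap ℂ _ (A k j)) * relVar A b σ k = 0 := by
  simp only [relVar, mul_sub, Finset.sum_sub_distrib, Finset.mul_sum]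
  rw [sub_eq_zero, Finset.sum_comm]
  have h : ∀ i, ∑ k, A k j * σ k i = if j = i then 1 else 0 := fun i => by
    have := congrFun (congrFun hσ j) i
    rwa [Matrix.mul_apply, Matrix.one_apply] at this
  simp only [← mul_assoc, ← map_mul]
  symm
  calc _ = ∑ i, ∑ l, (∑ k, MvPolynomial.C (algebraMap ℂ (CoordRing A b) (A k j * σ k i * A l i))) *
        (MvPolynomial.X l : MvPolynomial (Fin (n + 1)) (CoordRing A b)) := by
        refine Finset.sum_congr rfl fun i _ => ?_
        rw [Finset.sum_comm]
        exact Finset.sum_congr rfl fun l _ => by rw [Finset.sum_mul]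
    _ = _ := by
      simp_rw [← map_sum, ← Finset.sum_mul, h]
      rw [Finset.sum_eq_single j]
      · simp
      · intro i _ hi; simp [hi.symm]
      · simp

variable (A b) in
/-- The Hessian determinant of the log-likelihood function as a polynomial on
`(ker Aᵀ) × X`. -/
def hessian (σ : Matrix (Fin (n + 1)) (Fin d) ℂ) : MvPolynomial (Fin (n + 1)) (CoordRing A b) :=
  (gram MvPolynomial.C (relVar A b σ)).det

theorem eval₂Hom_hessian {S : Type*} [CommRing S] (φ : CoordRing A b →+* S) (y : Fin (n + 1) → S)
    (hy : ∀ j, ∑ l, φ (algebraMap ℂ _ (A l j)) * y l = 0) :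
    MvPolynomial.eval₂Hom φ y (hessian A b σ) = (gram φ y).det := by
  rw [hessian, map_det_gram]
  congr 2
  · ext r; simp
  · exact funext fun k => eval₂Hom_relVar φ y hy k

theorem totalDegree_relVar_le [Nontrivial (CoordRing A b)] (k : Fin (n + 1)) : (relVar A b σ k).totalDegree ≤ 1 := by
  rw [relVar]
  refine (MvPolynomial.totalDegree_sub _ _).trans (max_le (MvPolynomial.totalDegree_X k).le ?_)
  refine MvPolynomial.totalDegree_finsetSum_le fun j _ => ?_
  refine (MvPolynomial.totalDegree_mul _ _).trans ?_
  rw [MvPolynomial.totalDegree_C, zero_add]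
  refine MvPolynomial.totalDegree_finsetSum_le fun l _ => ?_
  refine (MvPolynomial.totalDegree_mul _ _).trans ?_
  rw [MvPolynomial.totalDegree_C, zero_add]
  exact (MvPolynomial.totalDegree_X l).le

theorem totalDegree_hessian_le [Nontrivial (CoordRing A b)] : (hessian A b σ).totalDegree ≤ d := by
  rw [hessian, Matrix.det_apply']
  refine MvPolynomial.totalDegree_finsetSum_le fun τ _ => ?_
  refine (MvPolynomial.totalDegree_mul _ _).trans ?_
  rw [← map_intCast (MvPolynomial.C : CoordRing A b →+* _), MvPolynomial.totalDegree_C, zero_add]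
  refine (MvPolynomial.totalDegree_finsetProd _ _).trans ?_
  calc _ ≤ ∑ _i : Fin d, 1 := Finset.sum_le_sum fun i _ => ?_
    _ = d := by simp
  rw [gram, Matrix.of_apply]
  refine MvPolynomial.totalDegree_finsetSum_le fun l _ => ?_
  refine (MvPolynomial.totalDegree_mul _ _).trans ?_
  rw [MvPolynomial.totalDegree_C, zero_add]
  exact totalDegree_relVar_le l

end RelVar

section Pencil

variable (hd : 1 ≤ d) (hA : ∀ i, A i ≠ 0) {s : Fin (d + 2) ↪ Fin (n + 1)}
  {c e : Fin (d + 2) → ℂ}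
  (hL : IsUniform (consRow (b ∘ s) (A.submatrix s id).transpose))
  (hU : IsUniform (A.submatrix s id).transpose)
  (hc : c = maxMinor (consRow (b ∘ s) (A.submatrix s id).transpose))
  (hAe : (A.submatrix s id).transpose.mulVec e = 0) (hbe : ∑ i, b (s i) * e i = 1)

include hc hAe in
open Polynomial in
theorem pencil_relation (j : Fin d) :
    ∑ l, C (algebraMap ℂ _ (A l j)) * pencil A b s c e l = 0 := by
  have hrel := consRow_mulVec_eq_zero.1
    (hc ▸ mulVec_maxMinor (consRow (b ∘ s) (A.submatrix s id).transpose))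
  rw [pencil, sum_mul_extend s (fun l => C (algebraMap ℂ (CoordRing A b) (A l j)))]
  simp only [mul_add, Finset.sum_add_distrib, ← mul_assoc, ← Finset.sum_mul, ← map_mul, ← map_sum]
  have h1 : ∑ i, A (s i) j * c i = 0 := congrFun hrel.2 j
  have h2 : ∑ i, A (s i) j * e i = 0 := congrFun hAe j
  rw [h1, h2]; simp

include hA hL hc hAe hbe in
open Polynomial in
-- The Gram matrix is `α P + Q` with `P` the Gram matrix of `c`, so the coefficient of `α ^ d` is
-- `det P`, which is nonzero.
theorem natDegree_det_gram_pencil : (gram C (pencil A b s c e)).det.natDegree = d := by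
  set P := gram (RingHom.id (CoordRing A b)) (Function.extend s (fun i => algebraMap ℂ _ (c i)) 0)
    with hP
  set Q := gram (RingHom.id (CoordRing A b)) (Function.extend s (fun i => algebraMap ℂ _ (e i)) 0)
    with hQ
  have h : gram C (pencil A b s c e) = (X : (CoordRing A b)[X]) • P.map C + Q.map C := by
    ext1 j l
    simp only [gram, pencil, hP, hQ, Matrix.of_apply, Matrix.add_apply, Matrix.smul_apply,
      Matrix.map_apply, smul_eq_mul]
    rw [sum_mul_extend s (fun k => C (algebraMap ℂ _ (A k j * A k l) * ellInv A b k)),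
      sum_mul_extend s (fun k => RingHom.id _ (algebraMap ℂ _ (A k j * A k l) * ellInv A b k)),
      sum_mul_extend s (fun k => RingHom.id _ (algebraMap ℂ _ (A k j * A k l) * ellInv A b k)),
      map_sum, map_sum, Finset.mul_sum, ← Finset.sum_add_distrib]
    refine Finset.sum_congr rfl fun i _ => ?_
    simp only [map_mul, RingHom.id_apply]
    ring
  have h1 := natDegree_det_X_add_C_le P Q
  have h2 := coeff_det_X_add_C_card P Q
  rw [← h, Fintype.card_fin] at h1 h2
  exact le_antisymm h1 (le_natDegree_of_ne_zero
    (h2 ▸ det_gram_extend_ne_zero hA hL hc hAe hbe))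

include hd hA hL hU hc hAe hbe in
open Polynomial in
-- Inverting `∏ ℓ_i` keeps the pencil polynomial prime unless it becomes zero or a unit; its degree
-- `d ≥ 1` in `α` excludes both.
theorem det_gram_pencil_prime : Prime (gram C (pencil A b s c e)).det := by
  have := isDomain_coordRing (b := b) hA
  have h := det_gram_pencil_mul hA hL hc hAe hbe hU
    (algebraMap (CoordRing A b)[X] (FractionRing (CoordRing A b)[X]))
    (IsFractionRing.injective _ _)
  have hu : IsUnit (∏ i, C (ell A b (s i)) : (CoordRing A b)[X]) :=
    IsUnit.prod_iff.2 fun i _ => (isUnit_form A b (s i)).map C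
  have hassoc : Associated (gram C (pencil A b s c e)).det
      ((pencilPoly (A.submatrix s id) (b ∘ s) c e).map
      (algebraMap (MvPolynomial (Fin d) ℂ) (CoordRing A b))) := h ▸ associated_mul_unit_right _ _ hu
  rw [hassoc.prime_iff]
  let _ := Polynomial.algebra (MvPolynomial (Fin d) ℂ) (CoordRing A b)
  have hloc : IsLocalization (Algebra.algebraMapSubmonoid (MvPolynomial (Fin d) ℂ)[X]
      (Submonoid.powers (∏ i, form A b i))) (CoordRing A b)[X] := by
    rw [Algebra.isLocalization_iff_isPushout (Submonoid.powers (∏ i, form A b i)) (CoordRing A b)]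
    infer_instance
  have hdeg := natDegree_det_gram_pencil hA hL hc hAe hbe
  refine Submonoid.LocalizationMap.map_prime
    (IsLocalization.toLocalizationMap (Algebra.algebraMapSubmonoid (MvPolynomial (Fin d) ℂ)[X]
      (Submonoid.powers (∏ i, form A b i))) (CoordRing A b)[X])
    (pencilPoly_prime hL hU hc hAe hbe fun i => hA (s i)) ?_ ?_
  · refine hassoc.ne_zero_iff.1 fun h0 => ?_
    rw [h0] at hdeg
    simp at hdeg
    omega
  · intro hu
    have := natDegree_eq_zero_of_isUnit (hassoc.isUnit_iff.2 hu)
    omega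

include hd hA hL hU hc hAe hbe in
-- Restriction to the pencil does not raise degrees, and it sends the Hessian, of degree at most
-- `d`, to a prime of degree exactly `d`. If `H = P Q` and `P` becomes a unit, then `Q` already
-- accounts for the degree `d`, so `P` is constant and hence a unit. Irreducible elements are prime
-- by unique factorization.
theorem hessian_prime {σ : Matrix (Fin (n + 1)) (Fin d) ℂ} : Prime (hessian A b σ) := by
  have := isDomain_coordRing (b := b) hA
  set res := MvPolynomial.eval₂Hom Polynomial.C (pencil A b s c e) with hres
  have hresdeg : ∀ P, (res P).natDegree ≤ P.totalDegree := fun P => by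
    have := MvPolynomial.aeval_natDegree_le P le_rfl (pencil A b s c e) (n := 1) fun k => by
      by_cases hk : ∃ i, s i = k
      · obtain ⟨i, rfl⟩ := hk
        rw [pencil, s.injective.extend_apply]
        exact Polynomial.natDegree_linear_le
      · rw [pencil, Function.extend_apply' _ _ _ hk]
        simp
    rw [mul_one] at this
    exact this
  have hresH : res (hessian A b σ) = (gram Polynomial.C (pencil A b s c e)).det :=
    eval₂Hom_hessian _ _ (pencil_relation hc hAe)
  have hprime := det_gram_pencil_prime hd hA hL hU hc hAe hbe
  have hdeg := natDegree_det_gram_pencil hA hL hc hAe hbe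
  have hne : hessian A b σ ≠ 0 := fun h0 => hprime.ne_zero (by rw [← hresH, h0, map_zero])
  have hunit : ∀ P Q, hessian A b σ = P * Q → IsUnit (res P) → IsUnit P := by
    intro P Q h hu
    have hP : P ≠ 0 := by rintro rfl; exact hne (by rw [h, zero_mul])
    have hQ : Q ≠ 0 := by rintro rfl; exact hne (by rw [h, mul_zero])
    have h1 : P.totalDegree + Q.totalDegree ≤ d := by
      rw [← MvPolynomial.totalDegree_mul_of_isDomain hP hQ, ← h]
      exact totalDegree_hessian_le
    have h2 : (res P).natDegree + (res Q).natDegree = d := by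
      refine Eq.trans ?_ hdeg
      rw [← hresH, h, map_mul, Polynomial.natDegree_mul]
      · exact hu.ne_zero
      · intro h0
        apply hprime.ne_zero
        rw [← hresH, h, map_mul, h0, mul_zero]
    have h3 := hresdeg P
    have h4 := hresdeg Q
    have h5 := Polynomial.natDegree_eq_zero_of_isUnit hu
    have h6 : P.totalDegree = 0 := by omega
    rw [MvPolynomial.totalDegree_eq_zero_iff_eq_C] at h6
    rw [h6] at hu ⊢
    simp only [hres, MvPolynomial.eval₂Hom_C] at hu
    exact (Polynomial.isUnit_C.1 hu).map MvPolynomial.C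
  refine Irreducible.prime ⟨fun hu => hprime.not_isUnit (hresH ▸ hu.map res), fun P Q h => ?_⟩
  have h1 : (gram Polynomial.C (pencil A b s c e)).det = res P * res Q := by
    rw [← hresH, h, map_mul]
  rcases hprime.irreducible.isUnit_or_isUnit h1 with hu | hu
  · exact Or.inl (hunit P Q h hu)
  · exact Or.inr (hunit Q P (by rw [h, mul_comm]) hu)

include hd hA hL hU hc hAe hbe in
-- This makes the generic zero of the Hessian a nonzero relation, hence a point of projective space.
-- Otherwise the restricted Hessian would divide every `c_i α + e_i`, and so also `∑ b_i (c_i α +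
-- e_i) = 1`.
theorem exists_not_hessian_dvd_relVar {σ : Matrix (Fin (n + 1)) (Fin d) ℂ} :
    ∃ k, ¬ hessian A b σ ∣ relVar A b σ k := by
  by_contra! hdvd
  have hprime := det_gram_pencil_prime hd hA hL hU hc hAe hbe
  have h1 : ∀ i, (gram Polynomial.C (pencil A b s c e)).det ∣
      Polynomial.C (algebraMap ℂ (CoordRing A b) (c i)) * Polynomial.X +
        Polynomial.C (algebraMap ℂ _ (e i)) := fun i => by
    have := map_dvd (MvPolynomial.eval₂Hom Polynomial.C (pencil A b s c e)) (hdvd (s i))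
    rwa [eval₂Hom_hessian _ _ (pencil_relation hc hAe), eval₂Hom_relVar _ _ (pencil_relation hc hAe),
      pencil, s.injective.extend_apply] at this
  have hrel := consRow_mulVec_eq_zero.1
    (hc ▸ mulVec_maxMinor (consRow (b ∘ s) (A.submatrix s id).transpose))
  have h2 : (gram Polynomial.C (pencil A b s c e)).det ∣ 1 := by
    have : ∑ i, Polynomial.C (algebraMap ℂ (CoordRing A b) (b (s i))) *
        (Polynomial.C (algebraMap ℂ (CoordRing A b) (c i)) * Polynomial.X +
        Polynomial.C (algebraMap ℂ _ (e i))) = 1 := by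
      simp only [mul_add, Finset.sum_add_distrib, ← mul_assoc, ← Finset.sum_mul, ← map_mul,
        ← map_sum]
      have h3 : ∑ i, b (s i) * c i = 0 := hrel.1
      rw [h3, hbe]; simp
    rw [← this]
    exact Finset.dvd_sum fun i _ => (h1 i).mul_left _
  exact hprime.not_isUnit (isUnit_of_dvd_one h2)

end Pencil

end LogDisc

/-! ### A right inverse of `Aᵀ` and the data used below -/

namespace LogDisc

variable {n d : ℕ} {A : Matrix (Fin (n + 1)) (Fin d) ℂ} {b : Fin (n + 1) → ℂ}

theorem IsUniform.exists_right_inverse {s : Fin (d + 2) ↪ Fin (n + 1)}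
    (h : IsUniform (A.submatrix s id).transpose) :
    ∃ σ : Matrix (Fin (n + 1)) (Fin d) ℂ, A.transpose * σ = 1 := by
  let e0 : Fin d ↪ Fin (d + 2) := Fin.castLEEmb h.1
  set N := (A.submatrix s id).transpose.submatrix id e0 with hN
  have hdet : IsUnit N.det := isUnit_iff_ne_zero.2 (h.2 e0)
  refine ⟨Matrix.of fun k l => Function.extend (e0.trans s) (fun j => N⁻¹ j l) 0 k, ?_⟩
  rw [← Matrix.mul_nonsing_inv N hdet]
  ext j l
  rw [Matrix.mul_apply, Matrix.mul_apply]
  exact sum_mul_extend (e0.trans s) (fun k => A k j) fun i => N⁻¹ i l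

theorem exists_hessian_prime (hd : 1 ≤ d) (hA : ∀ i, A i ≠ 0)
    (hU : ∃ s : Fin (d + 2) ↪ Fin (n + 1),
      IsUniform ((matrixL A b).submatrix id s) ∧ IsUniform (A.transpose.submatrix id s)) :
    ∃ σ : Matrix (Fin (n + 1)) (Fin d) ℂ, A.transpose * σ = 1 ∧ Prime (hessian A b σ) ∧
      ∃ k, ¬ hessian A b σ ∣ relVar A b σ k := by
  obtain ⟨s, hL, hU⟩ := hU
  have hM : (matrixL A b).submatrix id s = consRow (b ∘ s) (A.submatrix s id).transpose := by
    ext i j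
    refine Fin.cases rfl (fun i => rfl) i
  rw [hM] at hL
  obtain ⟨σ, hσ⟩ := IsUniform.exists_right_inverse (s := s) hU
  obtain ⟨e, he, hbe⟩ := exists_dual_vector hL
  exact ⟨σ, hσ, hessian_prime hd hA hL hU rfl he hbe,
    exists_not_hessian_dvd_relVar hd hA hL hU rfl he hbe⟩

end LogDisc

/-! ### Ideals of points in an affine chart of the correspondence -/

namespace LogDisc

variable {n d : ℕ} {A : Matrix (Fin (n + 1)) (Fin d) ℂ} {b : Fin (n + 1) → ℂ}

section Chart

variable {R : Type*} [CommRing R] (φ : CoordRing A b →+* R) (t : Fin (n + 1) → R)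

/-- The `j`-th critical point equation in terms of homogeneous coordinates `t`. -/
def gradEq (j : Fin d) : R := ∑ k, t k * φ (logDerivForm A b j k)

/-- The elements `t_k / ℓ_k`. -/
def quot (k : Fin (n + 1)) : R := φ (ellInv A b k) * t k

theorem gradEq_eq (j : Fin d) :
    gradEq φ t j = ∑ k, φ (algebraMap ℂ _ (A k j)) * quot φ t k := by
  refine Finset.sum_congr rfl fun k _ => ?_
  rw [logDerivForm_eq, quot, map_mul]
  ring

theorem map_gradEq {S : Type*} [CommRing S] (f : R →+* S) (j : Fin d) :
    f (gradEq φ t j) = gradEq (f.comp φ) (f ∘ t) j := by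
  simp [gradEq]

theorem ell_mul_quot (k : Fin (n + 1)) : φ (ell A b k) * quot φ t k = t k := by
  rw [quot, ← mul_assoc, ← map_mul, ell_mul_ellInv, map_one, one_mul]

/-- The evaluation of polynomials at the point `t_k / ℓ_k`. -/
def evalQuot : MvPolynomial (Fin (n + 1)) (CoordRing A b) →+* R :=
  MvPolynomial.eval₂Hom φ (quot φ t)

theorem evalQuot_C (r : CoordRing A b) : evalQuot φ t (MvPolynomial.C r) = φ r := by
  simp [evalQuot]

theorem comp_evalQuot {S : Type*} [CommRing S] (f : R →+* S) :
    f.comp (evalQuot φ t) = evalQuot (f.comp φ) (f ∘ t) := by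
  refine MvPolynomial.ringHom_ext (fun r => ?_) fun k => ?_ <;> simp [evalQuot, quot]

variable {φ t} (σ : Matrix (Fin (n + 1)) (Fin d) ℂ)

theorem evalQuot_relVar (h : ∀ j, gradEq φ t j = 0) (k : Fin (n + 1)) :
    evalQuot φ t (relVar A b σ k) = quot φ t k :=
  eval₂Hom_relVar φ _ (fun j => by rw [← gradEq_eq, h]) k

theorem evalQuot_hessian (h : ∀ j, gradEq φ t j = 0) :
    evalQuot φ t (hessian A b σ) = (gram φ (quot φ t)).det :=
  eval₂Hom_hessian φ _ (fun j => by rw [← gradEq_eq, h])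

end Chart

/-- The homogeneous coordinates `ℓ_k v_k` of the universal critical point. -/
def homCoord (σ : Matrix (Fin (n + 1)) (Fin d) ℂ) (k : Fin (n + 1)) :
    MvPolynomial (Fin (n + 1)) (CoordRing A b) :=
  MvPolynomial.C (ell A b k) * relVar A b σ k

variable {σ : Matrix (Fin (n + 1)) (Fin d) ℂ}

theorem isUnit_C_ell (k : Fin (n + 1)) :
    IsUnit (MvPolynomial.C (ell A b k) : MvPolynomial (Fin (n + 1)) (CoordRing A b)) :=
  (isUnit_form A b k).map MvPolynomial.C

theorem gradEq_homCoord (hσ : A.transpose * σ = 1) (j : Fin d) :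
    gradEq (MvPolynomial.C : CoordRing A b →+* _) (homCoord σ) j = 0 := by
  rw [← sum_mul_relVar (b := b) hσ j, gradEq_eq]
  refine Finset.sum_congr rfl fun k _ => ?_
  have h : quot MvPolynomial.C (homCoord σ) k = relVar A b σ k := by
    rw [quot, homCoord, ← mul_assoc, ← map_mul, mul_comm (ellInv A b k), ell_mul_ellInv, map_one,
      one_mul]
  rw [h]

section Chart

variable {R : Type*} [CommRing R] {φ : CoordRing A b →+* R} {t : Fin (n + 1) → R}

theorem evalQuot_homCoord (h : ∀ j, gradEq φ t j = 0) (k : Fin (n + 1)) :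
    evalQuot φ t (homCoord σ k) = t k := by
  rw [homCoord, map_mul, evalQuot_C, evalQuot_relVar σ h, ell_mul_quot]

variable (φ t) in
/-- The ideal of the critical point equations. -/
def gradIdeal : Ideal R := Ideal.span (Set.range (gradEq φ t))

theorem gradEq_mk (j : Fin d) :
    gradEq ((Ideal.Quotient.mk (gradIdeal φ t)).comp φ) (Ideal.Quotient.mk (gradIdeal φ t) ∘ t) j
      = 0 := by
  rw [← map_gradEq, Ideal.Quotient.eq_zero_iff_mem]
  exact Ideal.subset_span ⟨j, rfl⟩

theorem mk_evalQuot (G : MvPolynomial (Fin (n + 1)) (CoordRing A b)) :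
    Ideal.Quotient.mk (gradIdeal φ t) (evalQuot φ t G) =
      evalQuot ((Ideal.Quotient.mk (gradIdeal φ t)).comp φ)
        (Ideal.Quotient.mk (gradIdeal φ t) ∘ t) G := by
  rw [← comp_evalQuot]; rfl

theorem mk_evalQuot_homCoord (k : Fin (n + 1)) :
    Ideal.Quotient.mk (gradIdeal φ t) (evalQuot φ t (homCoord σ k)) =
      Ideal.Quotient.mk (gradIdeal φ t) (t k) := by
  rw [mk_evalQuot, evalQuot_homCoord gradEq_mk, Function.comp_apply]

/-- The case of a point outside the chart: modulo the critical equations, `ℓ_i v_i` becomes `t_i =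
1`. -/
theorem gradIdeal_sup_map_eq_top {i : Fin (n + 1)} (hi : t i = 1)
    {P : Ideal (MvPolynomial (Fin (n + 1)) (CoordRing A b))} (hP : homCoord σ i ∈ P) :
    gradIdeal φ t ⊔ P.map (evalQuot φ t) = ⊤ := by
  have h1 := mk_evalQuot_homCoord (σ := σ) (φ := φ) (t := t) i
  rw [hi, Ideal.Quotient.eq] at h1
  rw [Ideal.eq_top_iff_one, ← sub_sub_cancel (evalQuot φ t (homCoord σ i)) 1]
  exact sub_mem (Ideal.mem_sup_right (Ideal.mem_map_of_mem _ hP)) (Ideal.mem_sup_left h1)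

section Point

variable {K : Type*} [Field K] {χ : MvPolynomial (Fin (n + 1)) (CoordRing A b) →+* K}
  {ev : R →+* K} {i : Fin (n + 1)} (hφ : ev.comp φ = χ.comp MvPolynomial.C)
  (ht : ∀ k, ev (t k) * χ (homCoord σ i) = χ (homCoord σ k))

include hφ ht

/-- Homogenization: substituting `ℓ_k v_k` for `t_k` and padding with powers of `ℓ_i v_i` clears
denominators. The padding is invisible modulo the critical equations because `t_i = 1`. -/
theorem exists_lift_mul_pow (hi : t i = 1) (hs : Function.Surjective (MvPolynomial.eval₂Hom φ t))
    (g : R) : ∃ (D : ℕ) (G : MvPolynomial (Fin (n + 1)) (CoordRing A b)),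
      ev g * χ (homCoord σ i) ^ D = χ G ∧
      Ideal.Quotient.mk (gradIdeal φ t) (evalQuot φ t G) =
        Ideal.Quotient.mk (gradIdeal φ t) g := by
  obtain ⟨p, rfl⟩ := hs g
  induction p using MvPolynomial.induction_on with
  | C a =>
    refine ⟨0, MvPolynomial.C a, ?_, ?_⟩
    · rw [pow_zero, mul_one, MvPolynomial.coe_eval₂Hom, MvPolynomial.eval₂_C]
      exact RingHom.congr_fun hφ a
    · rw [evalQuot_C, MvPolynomial.coe_eval₂Hom, MvPolynomial.eval₂_C]
  | add p q hp hq =>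
    obtain ⟨D, G, h1, h2⟩ := hp
    obtain ⟨D', G', h1', h2'⟩ := hq
    refine ⟨D + D', G * homCoord σ i ^ D' + G' * homCoord σ i ^ D, ?_, ?_⟩
    · simp only [map_add, map_mul, map_pow, ← h1, ← h1']
      ring
    · simp only [map_add, map_mul, map_pow, mk_evalQuot_homCoord, h2, h2', hi, map_one, one_pow,
        mul_one]
  | mul_X p k hp =>
    obtain ⟨D, G, h1, h2⟩ := hp
    refine ⟨D + 1, G * homCoord σ k, ?_, ?_⟩
    · rw [map_mul, map_mul, map_mul, ← h1, ← ht k, MvPolynomial.coe_eval₂Hom, MvPolynomial.eval₂_X]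
      ring
    · rw [map_mul, map_mul, map_mul, mk_evalQuot_homCoord, h2, MvPolynomial.coe_eval₂Hom,
        MvPolynomial.eval₂_X, map_mul]

variable (hi0 : χ (homCoord σ i) ≠ 0)
include hi0

theorem gradEq_point (hσ : A.transpose * σ = 1) (j : Fin d) :
    gradEq (ev.comp φ) (ev ∘ t) j = 0 := by
  refine mul_right_cancel₀ hi0 ?_
  rw [zero_mul, ← map_zero χ, ← gradEq_homCoord (b := b) hσ j, map_gradEq, hφ, gradEq, gradEq,
    Finset.sum_mul]
  refine Finset.sum_congr rfl fun k _ => ?_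
  rw [Function.comp_apply, Function.comp_apply, ← ht k]
  ring

/-- If `g` vanishes at the point, its homogenization `G` lies in `ker χ`, and `g` agrees with the
dehomogenization of `G` modulo the critical equations. The hypothesis `hP` is needed since elements
of `ker χ` need not be homogeneous in `v`. -/
theorem ker_point_eq (hσ : A.transpose * σ = 1) (hi : t i = 1)
    (hs : Function.Surjective (MvPolynomial.eval₂Hom φ t))
    (hP : ∀ G ∈ RingHom.ker χ, ev (evalQuot φ t G) = 0) :
    RingHom.ker ev = gradIdeal φ t ⊔ (RingHom.ker χ).map (evalQuot φ t) := by
  refine le_antisymm (fun g hg => ?_) (sup_le ?_ ?_)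
  · obtain ⟨D, G, h1, h2⟩ := exists_lift_mul_pow hφ ht hi hs g
    rw [RingHom.mem_ker.1 hg, zero_mul] at h1
    rw [Ideal.Quotient.eq] at h2
    rw [← sub_sub_cancel (evalQuot φ t G) g]
    exact sub_mem (Ideal.mem_sup_right (Ideal.mem_map_of_mem _ h1.symm)) (Ideal.mem_sup_left h2)
  · refine Ideal.span_le.2 ?_
    rintro _ ⟨j, rfl⟩
    exact (map_gradEq φ t ev j).trans (gradEq_point hφ ht hi0 hσ j)
  · exact Ideal.map_le_iff_le_comap.2 hP

/-- The Gram matrix is linear in `v`, so rescaling `v` by the nonzero value of `ℓ_i v_i` multiplies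
the Hessian by the `d`-th power of that value. -/
theorem evalQuot_hessian_point (hσ : A.transpose * σ = 1) (hχ : χ (hessian A b σ) = 0) :
    ev (evalQuot φ t (hessian A b σ)) = 0 := by
  have h : gram (χ.comp MvPolynomial.C) (χ ∘ relVar A b σ) =
      χ (homCoord σ i) • gram (ev.comp φ) (quot (ev.comp φ) (ev ∘ t)) := by
    ext j l
    simp only [gram, Matrix.smul_apply, Matrix.of_apply, smul_eq_mul, Finset.mul_sum, hφ]
    refine Finset.sum_congr rfl fun k _ => ?_
    have : χ (relVar A b σ k) = χ (homCoord σ i) * quot (χ.comp MvPolynomial.C) (ev ∘ t) k := by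
      refine mul_left_cancel₀ ((isUnit_C_ell (b := b) k).map χ).ne_zero ?_
      rw [← map_mul, ← homCoord, mul_left_comm,
        show χ (MvPolynomial.C (ell A b k)) = χ.comp MvPolynomial.C (ell A b k) from rfl,
        ell_mul_quot, Function.comp_apply, ← ht k, mul_comm]
    rw [Function.comp_apply, this]
    ring
  rw [hessian, map_det_gram, h, Matrix.det_smul] at hχ
  rw [← RingHom.comp_apply, comp_evalQuot, evalQuot_hessian σ (gradEq_point hφ ht hi0 hσ)]
  exact (mul_eq_zero.1 hχ).resolve_left (pow_ne_zero _ hi0)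

end Point

end Chart

end LogDisc

/-! ### Standard charts of projective space -/

namespace LogDisc

theorem eval₂_mul_of_isHomogeneous {ι R S : Type*} [CommSemiring R] [CommSemiring S] (f : R →+* S)
    (r : S) (g : ι → S) {p : MvPolynomial ι R} {m : ℕ} (hp : p.IsHomogeneous m) :
    MvPolynomial.eval₂ f (fun k => r * g k) p = r ^ m * MvPolynomial.eval₂ f g p := by
  rw [MvPolynomial.eval₂_eq, MvPolynomial.eval₂_eq, Finset.mul_sum]
  refine Finset.sum_congr rfl fun s hs => ?_
  have := hp (MvPolynomial.mem_support_iff.1 hs)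
  rw [Finsupp.weight_apply, Finsupp.sum] at this
  simp only [Pi.one_apply, smul_eq_mul, mul_one] at this
  rw [← this]
  simp only [mul_pow, Finset.prod_mul_distrib, Finset.prod_pow_eq_pow_sum]
  ring

namespace PSpace

variable {n : ℕ}

/-- The standard affine open `{u_i ≠ 0}` of `ℙⁿ`. -/
abbrev stdOpen (i : Fin (n + 1)) : (PSpace n).Opens :=
  Proj.basicOpen (grading n) (MvPolynomial.X i)

/-- The fraction `u_k / u_i` as an element of the homogeneous localization. -/
def frac (i k : Fin (n + 1)) : HomogeneousLocalization.Away (grading n) (MvPolynomial.X i) :=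
  HomogeneousLocalization.Away.mk (grading n) (X_mem_grading i) 1
      (MvPolynomial.X k) (by simpa only [one_smul] using X_mem_grading k)

theorem ratio_eq (i k : Fin (n + 1)) :
    ratio i k = (Proj.awayToSection (grading n) (MvPolynomial.X i)).hom (frac i k) := rfl

/-- The localization of `ℂ[u₀, …, uₙ]` at `u_i`. -/
abbrev Loc (i : Fin (n + 1)) : Type :=
  Localization.Away (MvPolynomial.X i : MvPolynomial (Fin (n + 1)) ℂ)

/-- The localization map of `ℂ[u₀, …, uₙ]` at `u_i`. -/
abbrev toLoc (i : Fin (n + 1)) : MvPolynomial (Fin (n + 1)) ℂ →+* Loc i := algebraMap _ _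

theorem X_mul_val_frac (i k : Fin (n + 1)) :
    toLoc i (MvPolynomial.X i) * (frac i k).val = toLoc i (MvPolynomial.X k) := by
  rw [frac, HomogeneousLocalization.Away.val_mk, Localization.mk_eq_mk']
  have h : (⟨MvPolynomial.X i ^ 1, 1, rfl⟩ : Submonoid.powers _) =
    (⟨MvPolynomial.X i, 1, pow_one _⟩ : Submonoid.powers (MvPolynomial.X (R := ℂ) i)) :=
    Subtype.ext (pow_one _)
  rw [h]
  exact IsLocalization.mk'_spec' (Loc i) (MvPolynomial.X k)
    (⟨MvPolynomial.X i, 1, pow_one _⟩ : Submonoid.powers (MvPolynomial.X (R := ℂ) i))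

theorem isUnit_toLoc_X (i : Fin (n + 1)) : IsUnit (toLoc i (MvPolynomial.X i)) :=
  IsLocalization.Away.algebraMap_isUnit _

theorem frac_self (i : Fin (n + 1)) : frac i i = 1 := by
  refine HomogeneousLocalization.val_injective _ ?_
  refine (isUnit_toLoc_X i).mul_left_cancel ?_
  rw [X_mul_val_frac, HomogeneousLocalization.val_one, mul_one]

theorem ratio_self (i : Fin (n + 1)) : ratio i i = 1 := by
  rw [ratio_eq, frac_self, map_one]

/-- The constants in the homogeneous localization at `u_i`. -/
def awayC (i : Fin (n + 1)) : ℂ →+* HomogeneousLocalization.Away (grading n) (MvPolynomial.X i) :=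
  (HomogeneousLocalization.fromZeroRingHom (grading n) _).comp (algebraMap ℂ (grading n 0))

theorem val_awayC (i : Fin (n + 1)) (z : ℂ) :
    (awayC i z).val = toLoc i (MvPolynomial.C z) := by
  rfl

theorem eval₂_frac_surjective (i : Fin (n + 1)) :
    Function.Surjective (MvPolynomial.eval₂Hom (awayC i) (frac i)) := by
  intro x
  obtain ⟨m, a, ha, rfl⟩ := HomogeneousLocalization.Away.mk_surjective (grading n)
    (X_mem_grading i) x
  refine ⟨a, HomogeneousLocalization.val_injective _ ?_⟩
  have ha' : a.IsHomogeneous m := by simpa using ha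
  refine ((isUnit_toLoc_X i).pow m).mul_left_cancel ?_
  have h1 : (MvPolynomial.eval₂Hom (awayC i) (frac i) a).val = MvPolynomial.eval₂
      ((toLoc i).comp MvPolynomial.C) (fun k => (frac i k).val) a := by
    rw [← HomogeneousLocalization.algebraMap_apply, MvPolynomial.coe_eval₂Hom,
      MvPolynomial.hom_eval₂]
    rfl
  rw [h1, ← eval₂_mul_of_isHomogeneous _ _ _ ha']
  simp only [X_mul_val_frac]
  rw [HomogeneousLocalization.Away.val_mk, Localization.mk_eq_mk', ← map_pow,
    IsLocalization.mk'_spec' (M := Submonoid.powers (MvPolynomial.X i))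
      (S := Loc i) a ⟨MvPolynomial.X i ^ m, m, rfl⟩]
  exact (MvPolynomial.hom_eval₂ a MvPolynomial.C _ MvPolynomial.X).symm.trans
    (by rw [MvPolynomial.eval₂_eta])

/-- Evaluation of polynomials at `v` extends to the localization at `u_i` and is then restricted to
degree zero. -/
theorem exists_hom_away {K : Type*} [CommRing K] (α : ℂ →+* K) (v : Fin (n + 1) → K)
    (i : Fin (n + 1)) (hv : IsUnit (v i)) :
    ∃ ev : HomogeneousLocalization.Away (grading n) (MvPolynomial.X i) →+* K,
      ev.comp (awayC i) = α ∧ ∀ k, v i * ev (frac i k) = v k := by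
  have hu : IsUnit (MvPolynomial.eval₂Hom α v (MvPolynomial.X i)) := by simpa using hv
  refine ⟨(IsLocalization.Away.lift (S := Loc i) _ hu).comp
    (algebraMap _ (Loc i)), ?_, fun k => ?_⟩
  · ext z
    rw [RingHom.comp_apply, RingHom.comp_apply, HomogeneousLocalization.algebraMap_apply,
      val_awayC, IsLocalization.Away.lift_eq]
    simp
  · have := congrArg (IsLocalization.Away.lift _ hu) (X_mul_val_frac i k)
    rw [map_mul, IsLocalization.Away.lift_eq, IsLocalization.Away.lift_eq] at this
    simpa using this

/-- The constant functions on `{u_i ≠ 0}`. -/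
def const (i : Fin (n + 1)) : ℂ →+* Γ(PSpace n, stdOpen i) :=
  ((PSpace.toSpec n).appLE ⊤ (stdOpen i) le_top).hom.comp (Scheme.ΓSpecIso (.of ℂ)).inv.hom

theorem _root_.AlgebraicGeometry.Scheme.ΓSpecIso_inv_appLE_of_ι_comp {X : Scheme.{0}}
    {R : CommRingCat.{0}} (f : X ⟶ Spec R) (U : X.Opens) (g : R ⟶ Γ(X, U))
    (h : U.ι ≫ f = U.toSpecΓ ≫ Spec.map g) :
    (Scheme.ΓSpecIso R).inv ≫ f.appLE ⊤ U le_top = g := by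
  have h1 := congrArg (fun f => (Scheme.ΓSpecIso R).inv ≫ f.appTop ≫ U.topIso.hom) h
  simp only [Scheme.Hom.comp_appTop, Scheme.Opens.toSpecΓ_appTop, Category.assoc, Iso.inv_hom_id,
    Category.comp_id, ← Scheme.ΓSpecIso_inv_naturality_assoc] at h1
  rw [← h1, Scheme.Opens.ι_appTop, Scheme.Opens.topIso_hom]
  exact congrArg (fun g => (Scheme.ΓSpecIso R).inv ≫ f.appTop ≫ g) (X.presheaf.map_comp _ _)

theorem const_eq (i : Fin (n + 1)) : const i =
    (Proj.awayToSection (grading n) (MvPolynomial.X i)).hom.comp (awayC i) := by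
  have h := Proj.awayι_toSpecZero (grading n) (MvPolynomial.X i) (X_mem_grading i) one_pos
  rw [Proj.awayι, Category.assoc, Iso.inv_comp_eq, Proj.basicOpenIsoSpec_hom] at h
  have h2 : (stdOpen i).ι ≫ PSpace.toSpec n = (stdOpen i).toSpecΓ ≫
      Spec.map (CommRingCat.ofHom (awayC i) ≫ Proj.awayToSection (grading n) (MvPolynomial.X i)) := by
    rw [PSpace.toSpec, reassoc_of% h, Proj.basicOpenToSpec, Category.assoc, ← Spec.map_comp,
      ← Spec.map_comp]
    rfl
  exact congrArg (fun f => f.hom) (Scheme.ΓSpecIso_inv_appLE_of_ι_comp _ _ _ h2)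

theorem isIso_awayToSection (i : Fin (n + 1)) :
    IsIso (Proj.awayToSection (grading n) (MvPolynomial.X i)) := by
  rw [← Proj.basicOpenIsoAway_hom (grading n) _ (X_mem_grading i) one_pos]
  infer_instance

theorem eval₂_ratio_surjective (i : Fin (n + 1)) :
    Function.Surjective (MvPolynomial.eval₂Hom (const i) (ratio i)) := by
  have := isIso_awayToSection i
  have h : MvPolynomial.eval₂Hom (const i) (ratio i) =
      (Proj.awayToSection (grading n) (MvPolynomial.X i)).hom.comp
        (MvPolynomial.eval₂Hom (awayC i) (frac i)) := by
    refine MvPolynomial.ringHom_ext (fun z => ?_) fun k => ?_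
    · simp [const_eq]
    · simp [ratio_eq]
  rw [h]
  exact (ConcreteCategory.bijective_of_isIso
    (Proj.awayToSection (grading n) (MvPolynomial.X i))).2.comp (eval₂_frac_surjective i)

theorem exists_hom_section {K : Type*} [CommRing K] (α : ℂ →+* K) (v : Fin (n + 1) → K)
    (i : Fin (n + 1)) (hv : IsUnit (v i)) :
    ∃ ev : Γ(PSpace n, stdOpen i) →+* K,
      ev.comp (const i) = α ∧ ∀ k, v i * ev (ratio i k) = v k := by
  obtain ⟨ev, h1, h2⟩ := exists_hom_away α v i hv
  have := isIso_awayToSection i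
  have h : ∀ x, (inv (Proj.awayToSection (grading n) (MvPolynomial.X i))).hom
      ((Proj.awayToSection (grading n) (MvPolynomial.X i)).hom x) = x := fun x => by
    rw [← CommRingCat.comp_apply, IsIso.hom_inv_id]; rfl
  refine ⟨ev.comp (inv (Proj.awayToSection (grading n) (MvPolynomial.X i))).hom, ?_, fun k => ?_⟩
  · rw [← h1, const_eq]
    ext z
    simp only [RingHom.comp_apply, h]
  · rw [RingHom.comp_apply, ratio_eq, h, h2]

theorem map_ratio_mul (i j k : Fin (n + 1)) :
    ((PSpace n).presheaf.map (homOfLE (Proj.basicOpen_mono (grading n) (MvPolynomial.X j)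
      (MvPolynomial.X i * MvPolynomial.X j) (Dvd.intro_left _ rfl))).op).hom (ratio j k) *
    ((PSpace n).presheaf.map (homOfLE (Proj.basicOpen_mono (grading n) (MvPolynomial.X i)
      (MvPolynomial.X i * MvPolynomial.X j) (Dvd.intro _ rfl))).op).hom (ratio i j) =
    ((PSpace n).presheaf.map (homOfLE (Proj.basicOpen_mono (grading n) (MvPolynomial.X i)
      (MvPolynomial.X i * MvPolynomial.X j) (Dvd.intro _ rfl))).op).hom (ratio i k) := by
  have h1 := fun k => congrArg (fun f => f.hom (frac i k))
    (Proj.awayMap_awayToSection (grading n) (X_mem_grading j)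
      (x := MvPolynomial.X i * MvPolynomial.X j) rfl)
  have h2 := fun k => congrArg (fun f => f.hom (frac j k))
    (Proj.awayMap_awayToSection (grading n) (X_mem_grading i)
      (x := MvPolynomial.X i * MvPolynomial.X j) (mul_comm _ _))
  simp only [CommRingCat.hom_comp, RingHom.comp_apply, CommRingCat.hom_ofHom] at h1 h2
  simp only [ratio_eq]
  rw [← h1, ← h1, ← h2, ← map_mul]
  congr 1
  refine HomogeneousLocalization.val_injective _ ?_
  have hu : IsUnit (algebraMap (MvPolynomial (Fin (n + 1)) ℂ) (Localization.Away (MvPolynomial.X (R := ℂ) i *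
      MvPolynomial.X j)) (MvPolynomial.X i * MvPolynomial.X j)) :=
    IsLocalization.Away.algebraMap_isUnit _
  rw [map_mul] at hu
  have h3 : ∀ k, algebraMap (MvPolynomial (Fin (n + 1)) ℂ) (Localization.Away (MvPolynomial.X (R := ℂ) i *
      MvPolynomial.X j)) (MvPolynomial.X i) * (HomogeneousLocalization.awayMap (grading n)
        (X_mem_grading j) rfl (frac i k)).val = algebraMap _ _ (MvPolynomial.X k) := fun k => by
    rw [HomogeneousLocalization.val_awayMap]
    have := congrArg (Localization.awayLift (algebraMap (MvPolynomial (Fin (n + 1)) ℂ) (Localization.Away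
      (MvPolynomial.X (R := ℂ) i * MvPolynomial.X j))) (MvPolynomial.X i)
        (isUnit_of_mul_isUnit_left hu)) (X_mul_val_frac i k)
    rw [map_mul, Localization.awayLift, IsLocalization.Away.lift_eq,
      IsLocalization.Away.lift_eq] at this
    exact this
  have h4 : ∀ k, algebraMap (MvPolynomial (Fin (n + 1)) ℂ) (Localization.Away (MvPolynomial.X (R := ℂ) i *
      MvPolynomial.X j)) (MvPolynomial.X j) * (HomogeneousLocalization.awayMap (grading n)
        (X_mem_grading i) (mul_comm _ _) (frac j k)).val =
          algebraMap _ _ (MvPolynomial.X k) := fun k => by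
    rw [HomogeneousLocalization.val_awayMap]
    have := congrArg (Localization.awayLift (algebraMap (MvPolynomial (Fin (n + 1)) ℂ) (Localization.Away
      (MvPolynomial.X (R := ℂ) i * MvPolynomial.X j))) (MvPolynomial.X j)
        (isUnit_of_mul_isUnit_right hu)) (X_mul_val_frac j k)
    rw [map_mul, Localization.awayLift, IsLocalization.Away.lift_eq,
      IsLocalization.Away.lift_eq] at this
    exact this
  refine (isUnit_of_mul_isUnit_left hu).mul_left_cancel ?_
  rw [h3, HomogeneousLocalization.val_mul, mul_left_comm, h3]
  exact (mul_comm _ _).trans (h4 k)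

/-- It lets membership of a point in another chart be read off from the value of `u_j / u_i`. -/
theorem basicOpen_ratio (i j : Fin (n + 1)) : (PSpace n).basicOpen (ratio i j) =
    stdOpen i ⊓ stdOpen j := by
  refine le_antisymm (le_inf (Scheme.basicOpen_le _ _) fun x hx => ?_) fun x hx => ?_
  · have hxi : x ∈ stdOpen i := Scheme.basicOpen_le _ _ hx
    rw [Scheme.mem_basicOpen _ _ _ hxi] at hx
    have h := congrArg (fun f => f.hom (frac i j)) (ProjectiveSpectrum.Proj.awayToSection_germ
      (grading n) (MvPolynomial.X i) x hxi)
    replace h : (PSpace n).presheaf.germ _ x hxi (ratio i j) =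
      (AlgebraicGeometry.Proj.stalkIso' (grading n) x).toCommRingCatIso.inv.hom
        (HomogeneousLocalization.mapId (grading n) (Submonoid.powers_le.mpr hxi) (frac i j)) := h
    rw [h] at hx
    have hu := (MulEquiv.isUnit_map (AlgebraicGeometry.Proj.stalkIso' (grading n) x).symm).1 hx
    rw [← HomogeneousLocalization.isUnit_iff_isUnit_val] at hu
    have : x.asHomogeneousIdeal.toIdeal.IsPrime := x.isPrime
    have hv := congrArg (IsLocalization.map (M := Submonoid.powers (MvPolynomial.X i))
      (T := x.asHomogeneousIdeal.toIdeal.primeCompl)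
      (Localization.AtPrime x.asHomogeneousIdeal.toIdeal) (RingHom.id _)
      (Submonoid.powers_le.mpr hxi)) (X_mul_val_frac i j)
    rw [map_mul, IsLocalization.map_eq, IsLocalization.map_eq] at hv
    rw [Proj.mem_basicOpen]
    refine (IsLocalization.AtPrime.isUnit_to_map_iff
      (Localization.AtPrime x.asHomogeneousIdeal.toIdeal) x.asHomogeneousIdeal.toIdeal _).1 ?_
    refine hv ▸ IsUnit.mul ?_ ?_
    · exact (IsLocalization.AtPrime.isUnit_to_map_iff
        (Localization.AtPrime x.asHomogeneousIdeal.toIdeal) x.asHomogeneousIdeal.toIdeal _).2 hxi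
    · exact Eq.mp (congrArg IsUnit (ProjectiveSpectrum.Proj.awayToSection_apply (grading n)
        (MvPolynomial.X i) (frac i j) ⟨x, hxi⟩)) hu
  · have h := map_ratio_mul i j i
    rw [ratio_self, map_one] at h
    have hx' : x ∈ Proj.basicOpen (grading n) (MvPolynomial.X i * MvPolynomial.X j) := by
      rwa [Proj.basicOpen_mul]
    have h2 := congrArg ((PSpace n).presheaf.germ _ x hx').hom h
    rw [map_mul, map_one] at h2
    rw [Scheme.mem_basicOpen _ _ _ hx.1]
    refine cast (congrArg IsUnit ?_) (isUnit_of_mul_isUnit_right (h2 ▸ isUnit_one))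
    exact TopCat.Presheaf.germ_res_apply (PSpace n).presheaf _ x hx' (ratio i j)

end PSpace

end LogDisc

/-! ### Charts of the product `ℙⁿ × X` -/

namespace LogDisc

open PSpace (stdOpen)

variable {n d : ℕ} (A : Matrix (Fin (n + 1)) (Fin d) ℂ) (b : Fin (n + 1) → ℂ)

/-- The projection of `ℙⁿ × X` to `ℙⁿ`. -/
abbrev toP : Ambient A b ⟶ PSpace n := pullback.fst (PSpace.toSpec n) (Complement.toSpec A b)

/-- The projection of `ℙⁿ × X` to `X`. -/
abbrev toX : Ambient A b ⟶ Complement A b :=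
  pullback.snd (PSpace.toSpec n) (Complement.toSpec A b)

theorem PSpace.isAffineOpen_stdOpen (i : Fin (n + 1)) : IsAffineOpen (stdOpen i) :=
  Proj.isAffineOpen_basicOpen (grading n) _ (X_mem_grading i) one_pos

instance : IsAffineHom (Complement.toSpec A b) := by
  unfold Complement.toSpec; infer_instance

instance : IsAffineHom (toP A b) :=
  isAffineHom_isStableUnderBaseChange.of_isPullback
    (IsPullback.of_hasPullback (PSpace.toSpec n) (Complement.toSpec A b)).flip inferInstance

theorem isAffineOpen_chart (i : Fin (n + 1)) : IsAffineOpen (chart A b i) :=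
  (PSpace.isAffineOpen_stdOpen i).preimage (toP A b)

theorem isPushout_chart (i : Fin (n + 1)) :
    IsPushout ((PSpace.toSpec n).appLE ⊤ (stdOpen i) le_top)
      ((Complement.toSpec A b).appLE ⊤ ⊤ le_top)
      ((toP A b).app (stdOpen i)) ((toX A b).appLE ⊤ (chart A b i) le_top) := by
  rw [← Scheme.Hom.appLE_eq_app]
  exact (isIso_pushoutSection_iff (IsPullback.of_hasPullback (PSpace.toSpec n) (Complement.toSpec A b))
    (US := ⊤) (UT := ⊤) (UX := stdOpen i) (UY := chart A b i) le_top le_top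
    (by simp)).1 (isIso_pushoutSection_of_isAffineOpen _ _ _ _ (isAffineOpen_top _)
      (isAffineOpen_top _) (PSpace.isAffineOpen_stdOpen i))

/-- The pullback of functions on `X` to `{u_i ≠ 0} × X`. -/
def pullHom (i : Fin (n + 1)) : CoordRing A b →+* Γ(Ambient A b, chart A b i) :=
  ((toX A b).appLE ⊤ (chart A b i) le_top).hom.comp (Scheme.ΓSpecIso (.of (CoordRing A b))).inv.hom

/-- The pullback of functions on `{u_i ≠ 0}` to `{u_i ≠ 0} × X`. -/
def pullP (i : Fin (n + 1)) : Γ(PSpace n, stdOpen i) →+* Γ(Ambient A b, chart A b i) :=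
  ((toP A b).app (stdOpen i)).hom

theorem pullP_ratio (i k : Fin (n + 1)) : pullP A b i (PSpace.ratio i k) = ratio A b i k := rfl

theorem appLE_complement_toSpec :
    (Scheme.ΓSpecIso (.of ℂ)).inv ≫ (Complement.toSpec A b).appLE ⊤ ⊤ le_top =
      CommRingCat.ofHom (algebraMap ℂ (CoordRing A b)) ≫
        (Scheme.ΓSpecIso (.of (CoordRing A b))).inv := by
  rw [Scheme.ΓSpecIso_inv_naturality, Complement.toSpec]
  congr 1

theorem chart_hom_exists (i : Fin (n + 1)) {S : Type} [CommRing S]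
    (a : Γ(PSpace n, stdOpen i) →+* S) (o : CoordRing A b →+* S)
    (h : a.comp (PSpace.const i) = o.comp (algebraMap ℂ _)) :
    ∃ c : Γ(Ambient A b, chart A b i) →+* S, c.comp (pullP A b i) = a ∧
      c.comp (pullHom A b i) = o := by
  have H := isPushout_chart A b i
  have hw : (PSpace.toSpec n).appLE ⊤ (stdOpen i) le_top ≫ CommRingCat.ofHom (R := Γ(PSpace n, stdOpen i)) a =
      (Complement.toSpec A b).appLE ⊤ ⊤ le_top ≫ (Scheme.ΓSpecIso (.of (CoordRing A b))).hom ≫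
        CommRingCat.ofHom o := by
    rw [← cancel_epi (Scheme.ΓSpecIso (.of ℂ)).inv, reassoc_of% (appLE_complement_toSpec A b),
      Iso.inv_hom_id_assoc]
    ext z
    exact RingHom.congr_fun h z
  refine ⟨(H.desc _ _ hw).hom, ?_, ?_⟩
  · have := congrArg (fun f => f.hom) (H.inl_desc _ _ hw)
    exact this
  · have := congrArg (fun f => ((Scheme.ΓSpecIso (.of (CoordRing A b))).inv ≫ f).hom)
      (H.inr_desc _ _ hw)
    simp only [Iso.inv_hom_id_assoc] at this
    exact this

theorem chart_hom_ext (i : Fin (n + 1)) {S : Type} [CommRing S]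
    {c c' : Γ(Ambient A b, chart A b i) →+* S}
    (h1 : c.comp (pullP A b i) = c'.comp (pullP A b i))
    (h2 : c.comp (pullHom A b i) = c'.comp (pullHom A b i)) : c = c' := by
  have H := isPushout_chart A b i
  have h : (CommRingCat.ofHom c : Γ(Ambient A b, chart A b i) ⟶ .of S) = CommRingCat.ofHom c' := by
    refine H.hom_ext ?_ ?_
    · ext x
      exact RingHom.congr_fun h1 x
    · rw [← cancel_epi (Scheme.ΓSpecIso (.of (CoordRing A b))).inv]
      ext x
      exact RingHom.congr_fun h2 x
  exact congrArg (fun f : Γ(Ambient A b, chart A b i) ⟶ .of S => f.hom) h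

theorem pullP_comp_const (i : Fin (n + 1)) :
    (pullP A b i).comp (PSpace.const i) = (pullHom A b i).comp (algebraMap ℂ _) := by
  have H := (isPushout_chart A b i).w
  rw [← cancel_epi (Scheme.ΓSpecIso (.of ℂ)).inv,
    reassoc_of% (appLE_complement_toSpec A b)] at H
  exact congrArg (fun f => f.hom) H

theorem eval₂_chart_surjective (i : Fin (n + 1)) :
    Function.Surjective (MvPolynomial.eval₂Hom (pullHom A b i) (ratio A b i)) := by
  set E := MvPolynomial.eval₂Hom (pullHom A b i) (ratio A b i)
  have ha : ∀ x, pullP A b i x ∈ E.range := fun x => by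
    obtain ⟨p, rfl⟩ := PSpace.eval₂_ratio_surjective i x
    refine ⟨MvPolynomial.map (algebraMap ℂ _) p, ?_⟩
    rw [MvPolynomial.coe_eval₂Hom, MvPolynomial.eval₂_map, MvPolynomial.coe_eval₂Hom,
      MvPolynomial.hom_eval₂, pullP_comp_const]
    rfl
  have ho : ∀ x, pullHom A b i x ∈ E.range := fun x =>
    ⟨MvPolynomial.C x, by rw [MvPolynomial.coe_eval₂Hom, MvPolynomial.eval₂_C]⟩
  obtain ⟨c, h1, h2⟩ := chart_hom_exists A b i ((pullP A b i).codRestrict E.range ha)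
    ((pullHom A b i).codRestrict E.range ho) (by
      ext z
      exact RingHom.congr_fun (pullP_comp_const A b i) z)
  have h3 : E.range.subtype.comp c = RingHom.id _ := by
    refine chart_hom_ext A b i ?_ ?_
    · rw [RingHom.comp_assoc, h1]; rfl
    · rw [RingHom.comp_assoc, h2]; rfl
  intro x
  have := RingHom.congr_fun h3 x
  obtain ⟨p, hp⟩ := (c x).2
  exact ⟨p, hp.trans this⟩

theorem ratio_self (i : Fin (n + 1)) : ratio A b i i = 1 := by
  rw [← pullP_ratio, PSpace.ratio_self, map_one]

theorem exists_chart_point {K : Type} [CommRing K] (o : CoordRing A b →+* K) (v : Fin (n + 1) → K)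
    (i : Fin (n + 1)) (hv : IsUnit (v i)) :
    ∃ ev : Γ(Ambient A b, chart A b i) →+* K, ev.comp (pullHom A b i) = o ∧
      ∀ k, v i * ev (ratio A b i k) = v k := by
  obtain ⟨a, h1, h2⟩ := PSpace.exists_hom_section (o.comp (algebraMap ℂ _)) v i hv
  obtain ⟨c, h3, h4⟩ := chart_hom_exists A b i a o h1
  refine ⟨c, h4, fun k => ?_⟩
  rw [← pullP_ratio, ← RingHom.comp_apply, h3, h2]

theorem basicOpen_ratio (i j : Fin (n + 1)) :
    (Ambient A b).basicOpen (ratio A b i j) = chart A b i ⊓ chart A b j := by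
  rw [← pullP_ratio]
  exact (Scheme.preimage_basicOpen (toP A b) (PSpace.ratio i j)).symm.trans
    (by rw [PSpace.basicOpen_ratio]; rfl)

theorem map_ratio_mul (i j k : Fin (n + 1)) :
    ((Ambient A b).presheaf.map (homOfLE (inf_le_right : chart A b i ⊓ chart A b j ≤ _)).op).hom
      (ratio A b j k) *
    ((Ambient A b).presheaf.map (homOfLE (inf_le_left : chart A b i ⊓ chart A b j ≤ _)).op).hom
      (ratio A b i j) =
    ((Ambient A b).presheaf.map (homOfLE (inf_le_left : chart A b i ⊓ chart A b j ≤ _)).op).hom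
      (ratio A b i k) := by
  have hle : chart A b i ⊓ chart A b j ≤
      (toP A b) ⁻¹ᵁ Proj.basicOpen (grading n) (MvPolynomial.X i * MvPolynomial.X j) := by
    rw [Proj.basicOpen_mul]; rfl
  have h := congrArg ((toP A b).appLE _ _ hle).hom (PSpace.map_ratio_mul i j k)
  rw [map_mul] at h
  simp only [← RingHom.comp_apply, ← CommRingCat.hom_comp,
    Scheme.Hom.map_appLE] at h
  simpa only [ratio, ← CommRingCat.comp_apply, ← RingHom.comp_apply, ← CommRingCat.hom_comp,
    Scheme.Hom.app_eq_appLE, Scheme.Hom.appLE_map] using h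

theorem PSpace.iSup_stdOpen : ⨆ i, stdOpen (n := n) i = ⊤ := by
  refine Proj.iSup_basicOpen_eq_top' _ _ (fun i => ⟨1, X_mem_grading i⟩) ?_
  refine eq_top_iff.2 fun p _ => ?_
  induction p using MvPolynomial.induction_on with
  | C z => exact Subalgebra.algebraMap_mem _ (algebraMap ℂ (grading n 0) z)
  | add p q hp hq => exact add_mem (hp trivial) (hq trivial)
  | mul_X p k hp => exact mul_mem (hp trivial) (Algebra.subset_adjoin ⟨k, rfl⟩)

theorem iSup_chart : ⨆ i, chart A b i = ⊤ := by
  have := congrArg (fun U => (toP A b) ⁻¹ᵁ U) (PSpace.iSup_stdOpen (n := n))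
  simpa [Scheme.Hom.preimage_iSup] using this

end LogDisc

/-! ### Ring-valued and field-valued points of the product -/

namespace LogDisc

open PSpace (stdOpen)

theorem quasiCompact_of_finite {X Y : Scheme.{0}} [Finite X] (f : X ⟶ Y) : QuasiCompact f :=
  ⟨fun _ _ _ => (Set.toFinite _).isCompact⟩

variable {n d : ℕ} {A : Matrix (Fin (n + 1)) (Fin d) ℂ} {b : Fin (n + 1) → ℂ}

/-- The evaluation of functions on an open `U` containing the image of `p : Spec K ⟶ Y`. -/
def pointEval {Y : Scheme.{0}} {K : Type} [CommRing K] (p : Spec (.of K) ⟶ Y) (U : Y.Opens)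
    (h : ⊤ ≤ p ⁻¹ᵁ U) : Γ(Y, U) →+* K :=
  (p.appLE U ⊤ h ≫ (Scheme.ΓSpecIso (.of K)).hom).hom

theorem pointEval_map {Y : Scheme.{0}} {K : Type} [CommRing K] (p : Spec (.of K) ⟶ Y) {U V : Y.Opens}
    (h : ⊤ ≤ p ⁻¹ᵁ U) (i : V ≤ U) (h' : ⊤ ≤ p ⁻¹ᵁ V) (x : Γ(Y, U)) :
    pointEval p V h' ((Y.presheaf.map (homOfLE i).op).hom x) = pointEval p U h x := by
  rw [pointEval, pointEval, ← Scheme.Hom.map_appLE p h' (homOfLE i).op]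
  rfl

theorem exists_pointEval_eq {Y : Scheme.{0}} {K : Type} [CommRing K] (p : Spec (.of K) ⟶ Y)
    (U : Y.Opens) (h : ⊤ ≤ p ⁻¹ᵁ U) :
    ∃ e : Γ(Spec (.of K), p ⁻¹ᵁ U) ≃+* K, ∀ x, pointEval p U h x = e ((p.app U).hom x) := by
  have h' : p ⁻¹ᵁ U = ⊤ := top_le_iff.1 h
  have : IsIso ((Spec (.of K)).presheaf.map (homOfLE h).op) := by
    rw [show (homOfLE h).op = (eqToHom h'.symm).op from rfl]
    infer_instance
  exact ⟨(asIso ((Spec (.of K)).presheaf.map (homOfLE h).op) ≪≫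
      Scheme.ΓSpecIso (.of K)).commRingCatIsoToRingEquiv, fun x => rfl⟩

theorem ker_pointEval {Y : Scheme.{0}} {K : Type} [CommRing K] (p : Spec (.of K) ⟶ Y) (U : Y.Opens)
    (h : ⊤ ≤ p ⁻¹ᵁ U) : RingHom.ker (pointEval p U h) = RingHom.ker (p.app U).hom := by
  obtain ⟨e, he⟩ := exists_pointEval_eq p U h
  ext x
  rw [RingHom.mem_ker, RingHom.mem_ker, he, map_eq_zero_iff _ e.injective]

theorem pointEval_fromSpec {Y : Scheme.{0}} {K : Type} [CommRing K] {U : Y.Opens}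
    (hU : IsAffineOpen U) (ev : Γ(Y, U) →+* K) : ∃ h,
    pointEval (Spec.map (CommRingCat.ofHom ev) ≫ hU.fromSpec) U h = ev := by
  have h1 : ⊤ ≤ hU.fromSpec ⁻¹ᵁ U := hU.fromSpec_preimage_self.ge
  have h2 : hU.fromSpec.appLE U ⊤ h1 = (Scheme.ΓSpecIso Γ(Y, U)).inv := by
    rw [Scheme.Hom.appLE, hU.fromSpec_app_self, Category.assoc]
    exact (congrArg (_ ≫ ·) (((Spec Γ(Y, U)).presheaf.map_comp _ _).symm.trans
      ((Spec Γ(Y, U)).presheaf.map_id _))).trans (Category.comp_id _)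
  refine ⟨fun x _ => h1 (trivial : Spec.map (CommRingCat.ofHom ev) x ∈ ⊤), ?_⟩
  change ((Spec.map (CommRingCat.ofHom ev) ≫ hU.fromSpec).appLE U ⊤ _ ≫
    (Scheme.ΓSpecIso (.of K)).hom).hom = ev
  rw [← Scheme.Hom.appLE_comp_appLE _ _ U ⊤ ⊤ h1 le_top, h2, Category.assoc]
  have h3 : (Spec.map (CommRingCat.ofHom ev)).appLE ⊤ ⊤ le_top =
    (Spec.map (CommRingCat.ofHom ev)).appTop := Scheme.Hom.appLE_eq_app _
  rw [h3, Scheme.ΓSpecIso_naturality]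
  exact congrArg (fun f => f.hom) (Iso.inv_hom_id_assoc (Scheme.ΓSpecIso Γ(Y, U))
    (CommRingCat.ofHom ev))

theorem preimage_eq_top_of_isUnit {Y : Scheme.{0}} {K : Type} [CommRing K] (p : Spec (.of K) ⟶ Y)
    {U : Y.Opens} (h : ⊤ ≤ p ⁻¹ᵁ U) {f : Γ(Y, U)} (hf : IsUnit (pointEval p U h f)) :
    ⊤ ≤ p ⁻¹ᵁ (Y.basicOpen f) := by
  obtain ⟨e, he⟩ := exists_pointEval_eq p U h
  rw [he, MulEquiv.isUnit_map] at hf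
  rw [Scheme.preimage_basicOpen, Scheme.basicOpen_of_isUnit _ hf]
  exact h

theorem preimage_eq_bot_of_eq_zero {Y : Scheme.{0}} {K : Type} [CommRing K] (p : Spec (.of K) ⟶ Y)
    {U : Y.Opens} (h : ⊤ ≤ p ⁻¹ᵁ U) {f : Γ(Y, U)} (hf : pointEval p U h f = 0) :
    p ⁻¹ᵁ (Y.basicOpen f) = ⊥ := by
  rw [← RingHom.mem_ker, ker_pointEval, RingHom.mem_ker] at hf
  exact (Scheme.preimage_basicOpen p f).trans (hf ▸ Scheme.basicOpen_zero _ _)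

theorem pointEval_appLE {X Y : Scheme.{0}} {K : Type} [CommRing K] (p : Spec (.of K) ⟶ X)
    (g : X ⟶ Y) (U : X.Opens) (h : ⊤ ≤ p ⁻¹ᵁ U) (V : Y.Opens) (e : U ≤ g ⁻¹ᵁ V) (x : Γ(Y, V)) :
    pointEval p U h ((g.appLE V U e).hom x) = pointEval (p ≫ g) V (h.trans fun _ hx => e hx) x := by
  rw [pointEval, pointEval, ← Scheme.Hom.appLE_comp_appLE p g V U ⊤ e h]
  rfl

/-- The point is built in a chart where its coordinate is nonzero and then carried to all other
charts by the transition relations; its behaviour in every chart is needed to determine its ideal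
sheaf. -/
theorem exists_point {K : Type} [Field K] (o : CoordRing A b →+* K) (v : Fin (n + 1) → K)
    (hv : ∃ i, v i ≠ 0) : ∃ p : Spec (.of K) ⟶ Ambient A b, ∀ i,
      (v i = 0 → p ⁻¹ᵁ chart A b i = ⊥) ∧ (v i ≠ 0 → ∃ h : ⊤ ≤ p ⁻¹ᵁ chart A b i,
        (pointEval p _ h).comp (pullHom A b i) = o ∧
        ∀ k, pointEval p _ h (ratio A b i k) * v i = v k) := by
  obtain ⟨i₀, hi₀⟩ := hv
  obtain ⟨ev, h1, h2⟩ := exists_chart_point A b o v i₀ hi₀.isUnit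
  set p := Spec.map (CommRingCat.ofHom ev) ≫ (isAffineOpen_chart A b i₀).fromSpec with hp
  obtain ⟨h₀, hev⟩ : ∃ h, pointEval p (chart A b i₀) h = ev :=
    pointEval_fromSpec (isAffineOpen_chart A b i₀) ev
  refine ⟨p, fun i => ⟨fun hi => ?_, fun hi => ?_⟩⟩
  · have := preimage_eq_bot_of_eq_zero p h₀ (f := ratio A b i₀ i) (by
      rw [hev]; exact (mul_eq_zero.1 ((h2 i).trans hi)).resolve_left hi₀)
    rw [basicOpen_ratio, Scheme.Hom.preimage_inf, top_le_iff.1 h₀, top_inf_eq] at this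
    exact this
  · have h : ⊤ ≤ p ⁻¹ᵁ (chart A b i₀ ⊓ chart A b i) := by
      rw [← basicOpen_ratio]
      refine preimage_eq_top_of_isUnit p h₀ ?_
      rw [hev]
      refine IsUnit.mk0 _ fun h0 => hi ?_
      rw [← h2 i, h0, mul_zero]
    have hi' : ⊤ ≤ p ⁻¹ᵁ (chart A b i) := h.trans fun _ hx => hx.2
    refine ⟨hi', ?_, fun k => ?_⟩
    · rw [← h1, ← hev]
      ext r
      exact (pointEval_appLE p (toX A b) _ hi' ⊤ le_top _).trans
        (pointEval_appLE p (toX A b) _ h₀ ⊤ le_top _).symm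
    · have := congrArg (pointEval p _ h) (map_ratio_mul A b i₀ i k)
      rw [map_mul, pointEval_map p hi', pointEval_map p h₀, pointEval_map p h₀, hev] at this
      rw [← h2 i, ← h2 k, ← this]
      ring

/-- The chart `{u_i ≠ 0} × X` as an affine open. -/
abbrev affineChart (A : Matrix (Fin (n + 1)) (Fin d) ℂ) (b : Fin (n + 1) → ℂ) (i : Fin (n + 1)) :
    (Ambient A b).affineOpens := ⟨chart A b i, isAffineOpen_chart A b i⟩

/-- Used twice: `h = 0` gives the generic point of the whole correspondence, the Hessian that of the
ramification locus. Both are homogeneous in `v`, so their vanishing passes to the charts. -/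
theorem exists_point_ker {σ : Matrix (Fin (n + 1)) (Fin d) ℂ} (hσ : A.transpose * σ = 1)
    {K : Type} [Field K] (χ : MvPolynomial (Fin (n + 1)) (CoordRing A b) →+* K)
    (hv : ∃ i, χ (relVar A b σ i) ≠ 0) {h : MvPolynomial (Fin (n + 1)) (CoordRing A b)}
    (hχ : RingHom.ker χ = Ideal.span {h}) (hh : h = 0 ∨ h = hessian A b σ) :
    ∃ p : Spec (.of K) ⟶ Ambient A b, ∀ i, p.ker.ideal (affineChart A b i) =
      gradIdeal (pullHom A b i) (ratio A b i) ⊔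
        Ideal.span {evalQuot (pullHom A b i) (ratio A b i) h} := by
  obtain ⟨p, hp⟩ := exists_point (χ.comp MvPolynomial.C) (fun k => χ (homCoord σ k)) (by
    obtain ⟨i, hi⟩ := hv
    refine ⟨i, ?_⟩
    rw [homCoord, map_mul]
    exact mul_ne_zero ((isUnit_C_ell i).map χ).ne_zero hi)
  refine ⟨p, fun i => ?_⟩
  have : QuasiCompact p := quasiCompact_of_finite p
  rw [Scheme.Hom.ker_apply, ← Set.image_singleton, ← Ideal.map_span, ← hχ]
  by_cases hi : χ (homCoord σ i) = 0
  · rw [gradIdeal_sup_map_eq_top (ratio_self A b i) hi]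
    refine (Ideal.eq_top_iff_one _).2 (RingHom.mem_ker.2 ?_)
    have := (hp i).1 hi
    have : Subsingleton Γ(Spec (.of K), p ⁻¹ᵁ (affineChart A b i).1) := by
      change Subsingleton Γ(Spec (.of K), p ⁻¹ᵁ chart A b i)
      rw [this]
      infer_instance
    exact Subsingleton.elim _ _
  · obtain ⟨hle, h1, h2⟩ := (hp i).2 hi
    rw [← ker_point_eq h1 h2 hi hσ (ratio_self A b i) (eval₂_chart_surjective A b i) ?_,
      ker_pointEval]
    intro G hG
    rw [hχ, Ideal.mem_span_singleton] at hG
    obtain ⟨c, rfl⟩ := hG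
    rw [map_mul, map_mul]
    obtain rfl | rfl := hh
    · rw [map_zero, map_zero, zero_mul]
    · rw [evalQuot_hessian_point h1 h2 hi hσ, zero_mul]
      rw [← RingHom.mem_ker, hχ]
      exact Ideal.mem_span_singleton_self _

end LogDisc

/-! ### The likelihood ideal on charts, and the generic ramification point -/

namespace LogDisc

open PSpace (stdOpen)

variable {n d : ℕ} {A : Matrix (Fin (n + 1)) (Fin d) ℂ} {b : Fin (n + 1) → ℂ}

theorem iSup_affineChart : ⨆ i, (affineChart A b i).1 = ⊤ := iSup_chart A b

theorem exists_hom_field_ker {R : Type} [CommRing R] (P : Ideal R) [P.IsPrime] :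
    ∃ (K : Type) (_ : Field K) (χ : R →+* K), RingHom.ker χ = P :=
  ⟨P.ResidueField, inferInstance, algebraMap R P.ResidueField, P.ker_algebraMap_residueField⟩

variable (A b) in
/-- The ideal of the critical point equations on an open subset of some of the charts. -/
def critFamily (V : (Ambient A b).affineOpens) : Ideal Γ(Ambient A b, V) :=
  ⨅ (i : Fin (n + 1)) (h : V.1 ≤ chart A b i),
    Ideal.span (Set.range fun j => ((Ambient A b).presheaf.map (homOfLE h).op).hom (critEq A b i j))

theorem critFamily_le (V : (Ambient A b).affineOpens) (i : Fin (n + 1)) (h : V.1 ≤ chart A b i) :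
    critFamily A b V ≤ Ideal.span (Set.range fun j =>
      ((Ambient A b).presheaf.map (homOfLE h).op).hom (critEq A b i j)) :=
  iInf_le_of_le i (iInf_le_of_le h le_rfl)

theorem map_homOfLE_self {X : Scheme.{0}} (U : X.Opens) (h : U ≤ U) (x : Γ(X, U)) :
    (X.presheaf.map (homOfLE h).op).hom x = x :=
  RingHom.congr_fun (congrArg (fun f => f.hom) (X.presheaf.map_id (.op U))) x

theorem critFamily_affineChart_le (i : Fin (n + 1)) :
    critFamily A b (affineChart A b i) ≤ gradIdeal (pullHom A b i) (ratio A b i) := by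
  refine (critFamily_le (affineChart A b i) i le_rfl).trans (Ideal.span_mono ?_)
  rintro _ ⟨j, rfl⟩
  exact ⟨j, (map_homOfLE_self _ _ _).symm⟩

/-- `ofIdeals` is the largest ideal sheaf below the given family. It is at most `I` because this can
be tested on the covering charts, and `I` lies below the family because on a smaller affine open its
ideal is extended from any chart containing it. -/
theorem likelihoodIdeal_eq {I : (Ambient A b).IdealSheafData}
    (hI : ∀ i, I.ideal (affineChart A b i) = gradIdeal (pullHom A b i) (ratio A b i)) :
    likelihoodIdeal A b = I := by
  have h0 : likelihoodIdeal A b = Scheme.IdealSheafData.ofIdeals (critFamily A b) := rfl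
  rw [h0]
  refine le_antisymm (Scheme.IdealSheafData.le_of_iSup_eq_top (affineChart A b) iSup_affineChart
    fun i => ?_) ?_
  · rw [hI]
    exact (Scheme.IdealSheafData.ideal_ofIdeals_le (critFamily A b) _).trans
      (critFamily_affineChart_le i)
  · refine Scheme.IdealSheafData.le_ofIdeals_iff.2 fun V => le_iInf₂ fun i h => ?_
    have : V ≤ affineChart A b i := h
    rw [← I.map_ideal this, Ideal.map_le_iff_le_comap, hI]
    refine Ideal.span_le.2 ?_
    rintro _ ⟨j, rfl⟩
    exact Ideal.subset_span ⟨j, rfl⟩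

/-- `likelihoodIdeal_eq` needs some ideal sheaf with the expected values on the charts; the kernel
of the generic point is one. -/
theorem likelihoodIdeal_ideal [IsDomain (CoordRing A b)]
    {σ : Matrix (Fin (n + 1)) (Fin d) ℂ} (hσ : A.transpose * σ = 1)
    (hv : ∃ k, relVar A b σ k ≠ 0) (i : Fin (n + 1)) :
    (likelihoodIdeal A b).ideal (affineChart A b i) =
      gradIdeal (pullHom A b i) (ratio A b i) := by
  obtain ⟨K, _, χ, hχ⟩ := exists_hom_field_ker
    (⊥ : Ideal (MvPolynomial (Fin (n + 1)) (CoordRing A b)))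
  obtain ⟨p, hp⟩ := exists_point_ker hσ χ
    (hv.imp fun k hk => (map_ne_zero_iff _ ((RingHom.injective_iff_ker_eq_bot _).2 hχ)).2 hk)
    (h := 0) (by rw [hχ, Ideal.span_singleton_zero]) (Or.inl rfl)
  have hp' : ∀ i, p.ker.ideal (affineChart A b i) =
      gradIdeal (pullHom A b i) (ratio A b i) := fun i => by
    rw [hp, map_zero, Ideal.span_singleton_zero, sup_bot_eq]
  rw [likelihoodIdeal_eq hp', hp']

theorem ker_app_subscheme {Y Z : Scheme.{0}} (I : Y.IdealSheafData) (q : Z ⟶ I.subscheme)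
    [QuasiCompact (q ≫ I.subschemeι)] (V : Y.affineOpens) :
    RingHom.ker (q.app (I.subschemeι ⁻¹ᵁ V.1)).hom =
      ((q ≫ I.subschemeι).ker.ideal V).map (I.subschemeι.app V.1).hom := by
  rw [Scheme.Hom.ker_apply]
  have h3 : RingHom.ker ((q ≫ I.subschemeι).app V.1).hom =
      (RingHom.ker (q.app (I.subschemeι ⁻¹ᵁ V.1)).hom).comap (I.subschemeι.app V.1).hom := by
    ext x
    rw [Scheme.Hom.comp_app]
    exact Iff.rfl
  rw [h3]
  exact (Ideal.map_comap_of_surjective _ (I.subschemeι_app_surjective V) _).symm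

theorem map_subschemeι_app_ideal {Y : Scheme.{0}} (I : Y.IdealSheafData) (V : Y.affineOpens) :
    (I.ideal V).map (I.subschemeι.app V.1).hom = ⊥ := by
  rw [← Scheme.IdealSheafData.ker_subschemeι_app, eq_bot_iff, Ideal.map_le_iff_le_comap]
  exact Ideal.ker_le_comap _

/-- A point of the likelihood correspondence whose closure is the zero locus of the Hessian. -/
theorem exists_likelihood_point [IsDomain (CoordRing A b)]
    {σ : Matrix (Fin (n + 1)) (Fin d) ℂ} (hσ : A.transpose * σ = 1)
    (hprime : Prime (hessian A b σ)) (hv : ∃ k, ¬ hessian A b σ ∣ relVar A b σ k) :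
    ∃ (K : Type) (_ : Field K) (q : Spec (.of K) ⟶ Likelihood A b),
      ∀ i, RingHom.ker (q.app ((likelihoodIdeal A b).subschemeι ⁻¹ᵁ chart A b i)).hom =
        Ideal.span {((likelihoodIdeal A b).subschemeι.app (chart A b i)).hom
          (evalQuot (pullHom A b i) (ratio A b i) (hessian A b σ))} := by
  have hP : (Ideal.span {hessian A b σ}).IsPrime :=
    (Ideal.span_singleton_prime hprime.ne_zero).2 hprime
  have hlik := likelihoodIdeal_ideal hσ
    (hv.imp fun k hk h0 => hk (h0 ▸ dvd_zero (hessian A b σ)))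
  obtain ⟨K, _, χ, hχ⟩ := exists_hom_field_ker (Ideal.span {hessian A b σ})
  obtain ⟨p, hp⟩ := exists_point_ker hσ χ (hv.imp fun k hk h => hk (by
    rwa [← Ideal.mem_span_singleton, ← hχ])) hχ (Or.inr rfl)
  -- The critical equations vanish at `p`, so `p` factors through the closed subscheme they define.
  have hle : likelihoodIdeal A b ≤ p.ker :=
    Scheme.IdealSheafData.le_of_iSup_eq_top (affineChart A b) iSup_affineChart fun i => by
      rw [hlik, hp]
      exact le_sup_left
  have hle' : (likelihoodIdeal A b).subschemeι.ker ≤ p.ker := by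
    rwa [Scheme.IdealSheafData.ker_subschemeι]
  refine ⟨_, inferInstance, IsClosedImmersion.lift (likelihoodIdeal A b).subschemeι p hle',
    fun i => ?_⟩
  set q := IsClosedImmersion.lift (likelihoodIdeal A b).subschemeι p hle' with hq
  have hqp : q ≫ (likelihoodIdeal A b).subschemeι = p := IsClosedImmersion.lift_fac _ _ _
  have : QuasiCompact (q ≫ (likelihoodIdeal A b).subschemeι) := quasiCompact_of_finite _
  refine (ker_app_subscheme (likelihoodIdeal A b) q (affineChart A b i)).trans ?_
  rw [hqp, hp i, ← hlik i, Ideal.map_sup, map_subschemeι_app_ideal, bot_sup_eq, Ideal.map_span,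
    Set.image_singleton]

end LogDisc

/-! ### The zeroth Fitting ideal from a square presentation -/

namespace LogDisc

/-- The family `x` generates `M`, and the rows of `J` generate the relations between its members. -/
structure IsPresentedBy {R M : Type*} [CommRing R] [AddCommGroup M] [Module R M] {d : ℕ}
    (x : Fin d → M) (J : Matrix (Fin d) (Fin d) R) : Prop where
  span_eq_top : Submodule.span R (Set.range x) = ⊤
  sum_eq_zero : ∀ i, ∑ j, J i j • x j = 0
  exists_vecMul : ∀ c : Fin d → R, ∑ j, c j • x j = 0 → ∃ q : Fin d → R, c = Matrix.vecMul q J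

namespace IsPresentedBy

variable {R M : Type*} [CommRing R] [AddCommGroup M] [Module R M] {d : ℕ}
  {x : Fin d → M} {J : Matrix (Fin d) (Fin d) R} (h : IsPresentedBy x J)
include h

theorem exists_mul_eq {m : ℕ} (N : Matrix (Fin m) (Fin d) R) (hN : ∀ i, ∑ j, N i j • x j = 0) :
    ∃ Q : Matrix (Fin m) (Fin d) R, N = Q * J := by
  choose q hq using fun i => h.exists_vecMul (N i) (hN i)
  exact ⟨Matrix.of q, funext fun i => hq i⟩

theorem det_dvd {m : ℕ} {y : Fin m → M} (hy : Submodule.span R (Set.range y) = ⊤)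
    {P : Matrix (Fin m) (Fin m) R} (hP : ∀ i, ∑ j, P i j • y j = 0) : J.det ∣ P.det := by
  have hC : ∀ a, ∃ c : Fin d → R, ∑ j, c j • x j = y a := fun a =>
    (Submodule.mem_span_range_iff_exists_fun R).1 (h.span_eq_top ▸ Submodule.mem_top)
  have hD : ∀ j, ∃ c : Fin m → R, ∑ a, c a • y a = x j := fun a =>
    (Submodule.mem_span_range_iff_exists_fun R).1 (hy ▸ Submodule.mem_top)
  choose C hC using hC
  choose D hD using hD
  have key : ∀ (N : Fin m → R), ∑ j, (∑ a, N a * C a j) • x j = ∑ a, N a • y a := fun N => by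
    simp_rw [← hC, Finset.smul_sum, Finset.sum_smul, smul_smul]
    exact Finset.sum_comm
  obtain ⟨Q, hQ⟩ := h.exists_mul_eq (P * Matrix.of C) fun i => by
    simp only [Matrix.mul_apply, Matrix.of_apply]
    rw [key, hP]
  obtain ⟨E, hE⟩ := h.exists_mul_eq (1 - Matrix.of D * Matrix.of C) fun i => by
    simp only [Matrix.sub_apply, sub_smul, Finset.sum_sub_distrib, Matrix.mul_apply,
      Matrix.of_apply]
    rw [key, hD, sub_eq_zero, Finset.sum_eq_single i]
    · rw [Matrix.one_apply_eq, one_smul]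
    · intro j _ hj
      rw [Matrix.one_apply_ne hj.symm, zero_smul]
    · exact fun hi => absurd (Finset.mem_univ i) hi
  -- With `y = C x`, `x = D y`, both `P C` and `1 - D C` consist of relations between the `x_j`,
  -- hence are multiples `Q J` and `E J`. Taking determinants of this block identity exhibits `det
  -- J` as a factor of `det P`.
  have hblock : Matrix.fromBlocks P 0 (-Matrix.of D) (1 : Matrix (Fin d) (Fin d) R) *
      Matrix.fromBlocks 1 (Matrix.of C) 0 1 =
      Matrix.fromBlocks P Q (-Matrix.of D) E * Matrix.fromBlocks 1 0 0 J := by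
    simp only [Matrix.fromBlocks_multiply, Matrix.mul_one, Matrix.mul_zero, add_zero, zero_add,
      hQ, ← hE, Matrix.neg_mul]
    congr 1
    abel
  have hdet := congrArg Matrix.det hblock
  rw [Matrix.det_mul, Matrix.det_mul, Matrix.det_fromBlocks_zero₁₂, Matrix.det_fromBlocks_zero₂₁,
    Matrix.det_fromBlocks_zero₂₁, Matrix.det_one, Matrix.det_one, mul_one, mul_one, mul_one, one_mul] at hdet
  exact Dvd.intro_left _ hdet.symm

theorem fittingIdealZero_eq : fittingIdealZero R M = Ideal.span {J.det} := by
  refine le_antisymm (Ideal.span_le.2 ?_) (Ideal.span_le.2 ?_)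
  · rintro _ ⟨m, y, P, hy, hP, rfl⟩
    exact Ideal.mem_span_singleton.2 (h.det_dvd hy hP)
  · rintro _ rfl
    exact Ideal.subset_span ⟨d, x, J, h.span_eq_top, h.sum_eq_zero, rfl⟩

theorem subsingleton_iff : Subsingleton M ↔ IsUnit J.det := by
  constructor
  · intro hM
    obtain ⟨Q, hQ⟩ := h.exists_mul_eq (1 : Matrix (Fin d) (Fin d) R) fun i => Subsingleton.elim _ _
    have := congrArg Matrix.det hQ
    rw [Matrix.det_one, Matrix.det_mul] at this
    exact IsUnit.of_mul_eq_one_right _ this.symm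
  · intro hJ
    have hx : ∀ i, x i = 0 := fun i => by
      have h1 : ∑ k, J⁻¹ i k • ∑ j, J k j • x j = 0 := by simp [h.sum_eq_zero]
      simp_rw [Finset.smul_sum, smul_smul] at h1
      rw [Finset.sum_comm] at h1
      simp_rw [← Finset.sum_smul, ← Matrix.mul_apply, Matrix.nonsing_inv_mul _ hJ] at h1
      simpa [Matrix.one_apply] using h1
    have htop := h.span_eq_top
    rw [show x = 0 from funext hx, Submodule.span_eq_bot.2 (by simp)] at htop
    exact (Submodule.subsingleton_iff R).1 (subsingleton_of_bot_eq_top htop)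

end IsPresentedBy

end LogDisc

/-! ### Kähler differentials of a universal algebra of critical points -/

namespace LogDisc

variable {n d : ℕ} {A : Matrix (Fin (n + 1)) (Fin d) ℂ} {b : Fin (n + 1) → ℂ}

theorem coordRing_hom_ext {S : Type*} [CommRing S] {o o' : CoordRing A b →+* S}
    (h1 : o.comp (algebraMap ℂ _) = o'.comp (algebraMap ℂ _))
    (h2 : ∀ j, o (coord A b j) = o' (coord A b j)) : o = o' := by
  refine IsLocalization.ringHom_ext (Submonoid.powers (∏ i, form A b i)) ?_
  exact MvPolynomial.ringHom_ext (fun z => RingHom.congr_fun h1 z) h2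

theorem coordRing_hom_exists {S : Type*} [CommRing S] (c : ℂ →+* S) (x : Fin d → S)
    (h : ∀ i, IsUnit (∑ j, c (A i j) * x j + c (b i))) :
    ∃ o : CoordRing A b →+* S, o.comp (algebraMap ℂ _) = c ∧ ∀ j, o (coord A b j) = x j := by
  have hu : IsUnit (MvPolynomial.eval₂Hom c x (∏ i, form A b i)) := by
    rw [map_prod, IsUnit.prod_iff]
    intro i _
    simpa [form] using h i
  refine ⟨IsLocalization.Away.lift (∏ i, form A b i) hu, ?_, fun j => ?_⟩
  · ext z
    rw [RingHom.comp_apply, IsScalarTower.algebraMap_apply ℂ (MvPolynomial (Fin d) ℂ) (CoordRing A b),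
      IsLocalization.Away.lift_eq]
    simp
  · rw [coord, IsLocalization.Away.lift_eq]
    simp

/-- `S` is a universal algebra over `R` with a map `β` from the coordinate ring such that the
critical point equations with coefficients `τ` hold, up to localization. -/
structure IsCritAlgebra {R S : Type} [CommRing R] [CommRing S] (ι : R →+* S) (κ : ℂ →+* R)
    (τ : Fin (n + 1) → R) (β : CoordRing A b →+* S) : Prop where
  comp_const : ι.comp κ = β.comp (algebraMap ℂ _)
  gradEq_eq_zero : ∀ j, gradEq β (ι ∘ τ) j = 0
  exists_hom : ∀ {S' : Type} [CommRing S'] (p : S' →+* S) [IsLocalHom p] (r : R →+* S')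
    (o : CoordRing A b →+* S'), p.comp r = ι → p.comp o = β →
    r.comp κ = o.comp (algebraMap ℂ _) → (∀ j, gradEq o (r ∘ τ) j = 0) →
    ∃ G : S →+* S', G.comp ι = r ∧ G.comp β = o
  hom_ext : ∀ {S' : Type} [CommRing S'] (G G' : S →+* S'), G.comp ι = G'.comp ι →
    G.comp β = G'.comp β → G = G'

section Derivation

variable {R S : Type} [CommRing R] [CommRing S] [Algebra R S]

theorem derivation_ell {N : Type*} [AddCommGroup N] [Module S N] {κ : ℂ →+* R}
    {β : CoordRing A b →+* S} (h : (algebraMap R S).comp κ = β.comp (algebraMap ℂ _))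
    [Module R N] [IsScalarTower R S N]
    (δ : Derivation R S N) (k : Fin (n + 1)) :
    δ (β (ell A b k)) = ∑ l, β (algebraMap ℂ _ (A k l)) • δ (β (coord A b l)) := by
  have hc : ∀ z, δ (β (algebraMap ℂ _ z)) = 0 := fun z => by
    rw [← RingHom.comp_apply, ← h, RingHom.comp_apply, Derivation.map_algebraMap]
  simp [ell_eq, Derivation.leibniz, hc]

theorem derivation_ellInv {N : Type*} [AddCommGroup N] [Module S N] {κ : ℂ →+* R}
    {β : CoordRing A b →+* S} (h : (algebraMap R S).comp κ = β.comp (algebraMap ℂ _))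
    [Module R N] [IsScalarTower R S N]
    (δ : Derivation R S N) (k : Fin (n + 1)) :
    δ (β (ellInv A b k)) = - ∑ l, (β (algebraMap ℂ _ (A k l)) * β (ellInv A b k) ^ 2) •
      δ (β (coord A b l)) := by
  have h1 : β (ell A b k) * β (ellInv A b k) = 1 := by rw [← map_mul, ell_mul_ellInv, map_one]
  have h2 := congrArg δ h1
  rw [Derivation.leibniz, Derivation.map_one_eq_zero, derivation_ell h] at h2
  have h3 := congrArg (β (ellInv A b k) • ·) h2
  simp only [smul_add, smul_smul, Finset.smul_sum, smul_zero] at h3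
  rw [mul_comm, h1, one_smul] at h3
  rw [eq_neg_of_add_eq_zero_left h3]
  congr 1
  exact Finset.sum_congr rfl fun l _ => by congr 1; ring

theorem derivation_gradEq {N : Type*} [AddCommGroup N] [Module S N] {κ : ℂ →+* R}
    {β : CoordRing A b →+* S} (h : (algebraMap R S).comp κ = β.comp (algebraMap ℂ _))
    [Module R N] [IsScalarTower R S N] (τ : Fin (n + 1) → R)
    (δ : Derivation R S N) (j : Fin d) :
    δ (gradEq β (algebraMap R S ∘ τ) j) =
      - ∑ l, gram β (quot β (algebraMap R S ∘ τ)) j l • δ (β (coord A b l)) := by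
  have hc : ∀ z, δ (β (algebraMap ℂ _ z)) = 0 := fun z => by
    rw [← RingHom.comp_apply, ← h, RingHom.comp_apply, Derivation.map_algebraMap]
  simp only [gradEq, map_sum, logDerivForm_eq, map_mul, Derivation.leibniz, Function.comp_apply,
    Derivation.map_algebraMap, hc, smul_zero, add_zero, derivation_ellInv h, gram, Matrix.of_apply,
    quot, Finset.sum_smul, smul_neg, Finset.smul_sum, smul_smul, Finset.sum_neg_distrib]
  rw [Finset.sum_comm]
  congr 1
  refine Finset.sum_congr rfl fun l _ => Finset.sum_congr rfl fun k _ => ?_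
  congr 1
  ring

/-- A derivation `δ` is encoded as the ring map `a ↦ a + ε δ(a)` into the square-zero extension by
`N`, and ring maps out of the coordinate ring are determined by constants and coordinates. -/
theorem derivation_comp_eq_zero {N : Type*} [AddCommGroup N] [Module S N] {κ : ℂ →+* R}
    {β : CoordRing A b →+* S} (h : (algebraMap R S).comp κ = β.comp (algebraMap ℂ _))
    [Module R N] [IsScalarTower R S N]
    (δ : Derivation R S N) (hδ : ∀ j, δ (β (coord A b j)) = 0) (r : CoordRing A b) :
    δ (β r) = 0 := by
  let _ : Module Sᵐᵒᵖ N := Module.compHom N ((RingHom.id S).fromOpposite mul_comm)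
  have : IsCentralScalar S N := ⟨fun _ _ => rfl⟩
  let g : S →+* TrivSqZeroExt S N :=
    { toFun := fun a => TrivSqZeroExt.inl a + TrivSqZeroExt.inr (δ a)
      map_one' := by simp
      map_zero' := by simp
      map_add' := fun x y => by ext <;> simp
      map_mul' := fun x y => by ext <;> simp [add_comm] }
  have hg : ∀ a, (g a).snd = δ a := fun a => by simp [g]
  have h1 : g.comp β = (TrivSqZeroExt.inlHom S N).comp β := by
    refine coordRing_hom_ext ?_ fun j => ?_
    · ext z
      · simp [g]
      · simp only [RingHom.comp_apply, hg, TrivSqZeroExt.inlHom_apply, TrivSqZeroExt.snd_inl]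
        rw [← RingHom.comp_apply, ← h, RingHom.comp_apply, Derivation.map_algebraMap]
    · simp [g, hδ]
  rw [← hg]
  have := RingHom.congr_fun h1 r
  rw [RingHom.comp_apply] at this
  simp [this]

end Derivation

namespace IsCritAlgebra

variable {R S : Type} [CommRing R] [CommRing S] [Algebra R S] {κ : ℂ →+* R} {τ : Fin (n + 1) → R}
  {β : CoordRing A b →+* S} (H : IsCritAlgebra (algebraMap R S) κ τ β)
include H

theorem derivation_eq_zero {N : Type} [AddCommGroup N] [Module S N] [Module R N]
    [IsScalarTower R S N] (δ : Derivation R S N) (hδ : ∀ j, δ (β (coord A b j)) = 0) : δ = 0 := by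
  let _ : Module Sᵐᵒᵖ N := Module.compHom N ((RingHom.id S).fromOpposite mul_comm)
  have : IsCentralScalar S N := ⟨fun _ _ => rfl⟩
  let g : S →+* TrivSqZeroExt S N :=
    { toFun := fun a => TrivSqZeroExt.inl a + TrivSqZeroExt.inr (δ a)
      map_one' := by simp
      map_zero' := by simp
      map_add' := fun x y => by ext <;> simp
      map_mul' := fun x y => by ext <;> simp [add_comm] }
  have hg : ∀ a, (g a).snd = δ a := fun a => by simp [g]
  have h1 : g = TrivSqZeroExt.inlHom S N := by
    refine H.hom_ext _ _ ?_ ?_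
    · ext x
      · simp [g]
      · simp [hg]
    · ext x
      · simp [g]
      · simp [hg, derivation_comp_eq_zero H.comp_const δ hδ]
  ext x
  rw [← hg, h1]
  simp

/-- Deform `x_j` to `x_j + ε v_j` in the square-zero extension. The `ℓ_i` stay invertible, and the
condition on `v` says exactly that the critical equations persist to first order. The universal
property gives a lift `G` of the identity, whose `ε`-part is the derivation. -/
theorem exists_derivation {N : Type} [AddCommGroup N] [Module S N] [Module R N]
    [IsScalarTower R S N] (v : Fin d → N)
    (hv : ∀ j, ∑ l, gram β (quot β (algebraMap R S ∘ τ)) j l • v l = 0) :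
    ∃ δ : Derivation R S N, ∀ j, δ (β (coord A b j)) = v j := by
  let _ : Module Sᵐᵒᵖ N := Module.compHom N ((RingHom.id S).fromOpposite mul_comm)
  have : IsCentralScalar S N := ⟨fun _ _ => rfl⟩
  let p : TrivSqZeroExt S N →+* S := (TrivSqZeroExt.fstHom S S N).toRingHom
  have hloc : IsLocalHom p := ⟨fun x hx => TrivSqZeroExt.isUnit_iff_isUnit_fst.2 hx⟩
  let r : R →+* TrivSqZeroExt S N := (TrivSqZeroExt.inlHom S N).comp (algebraMap R S)
  have hp : ∀ x, p x = x.fst := fun x => rfl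
  have hell : ∀ i, ∑ j, ((TrivSqZeroExt.inlHom S N).comp (β.comp (algebraMap ℂ _))) (A i j) *
      (TrivSqZeroExt.inl (β (coord A b j)) + TrivSqZeroExt.inr (v j)) +
      ((TrivSqZeroExt.inlHom S N).comp (β.comp (algebraMap ℂ _))) (b i) =
      TrivSqZeroExt.inl (β (ell A b i)) +
        TrivSqZeroExt.inr (∑ j, β (algebraMap ℂ _ (A i j)) • v j) := fun i => by
    ext <;> simp [ell_eq, TrivSqZeroExt.fst_sum, TrivSqZeroExt.snd_sum]
  obtain ⟨o, ho1, ho2⟩ := coordRing_hom_exists (A := A) (b := b)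
    ((TrivSqZeroExt.inlHom S N).comp (β.comp (algebraMap ℂ _)))
    (fun j => TrivSqZeroExt.inl (β (coord A b j)) + TrivSqZeroExt.inr (v j)) fun i => by
      rw [hell, TrivSqZeroExt.isUnit_iff_isUnit_fst]
      rw [TrivSqZeroExt.fst_add, TrivSqZeroExt.fst_inl, TrivSqZeroExt.fst_inr, add_zero]
      exact (isUnit_form A b i).map β
  have ho3 : ∀ i, o (ell A b i) = TrivSqZeroExt.inl (β (ell A b i)) +
        TrivSqZeroExt.inr (∑ j, β (algebraMap ℂ _ (A i j)) • v j) := fun i => by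
    rw [← hell, ell_eq]
    simp only [map_add, map_sum, map_mul, ho2, ← ho1, RingHom.comp_apply]
  have ho4 : ∀ z, o (algebraMap ℂ _ z) = TrivSqZeroExt.inl (β (algebraMap ℂ _ z)) := fun z =>
    RingHom.congr_fun ho1 z
  have hpo : p.comp o = β := by
    refine coordRing_hom_ext ?_ fun j => ?_
    · rw [RingHom.comp_assoc, ho1]; rfl
    · rw [RingHom.comp_apply, ho2, hp]; simp
  have ho5 : ∀ i, o (ellInv A b i) = TrivSqZeroExt.inl (β (ellInv A b i)) -
      TrivSqZeroExt.inr (∑ j, (β (algebraMap ℂ _ (A i j)) * β (ellInv A b i) ^ 2) • v j) :=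
      fun i => by
    have h1 : β (ell A b i) * β (ellInv A b i) = 1 := by rw [← map_mul, ell_mul_ellInv, map_one]
    have h2 : o (ell A b i) * o (ellInv A b i) = 1 := by rw [← map_mul, ell_mul_ellInv, map_one]
    refine left_inv_eq_right_inv (a := o (ell A b i)) ((mul_comm _ _).trans h2) ?_
    rw [ho3]
    ext
    · simp [h1]
    · simp only [TrivSqZeroExt.snd_mul]
      simp only [TrivSqZeroExt.fst_add, TrivSqZeroExt.fst_sub, TrivSqZeroExt.snd_add,
        TrivSqZeroExt.snd_sub, TrivSqZeroExt.fst_inl, TrivSqZeroExt.snd_inl,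
        TrivSqZeroExt.fst_inr, TrivSqZeroExt.snd_inr, op_smul_eq_smul, add_zero, zero_add, zero_sub,
        sub_zero, TrivSqZeroExt.snd_one, smul_neg, Finset.smul_sum, smul_smul]
      rw [neg_add_eq_zero]
      refine Finset.sum_congr rfl fun l _ => ?_
      congr 1
      linear_combination β (algebraMap ℂ _ (A i l)) * β (ellInv A b i) * h1
  obtain ⟨G, hG1, hG2⟩ := H.exists_hom p r o (by ext x; simp [r, hp]) hpo (by
    rw [ho1, ← H.comp_const]; rfl) (fun j => by
      have h1 := H.gradEq_eq_zero j
      simp only [gradEq, logDerivForm_eq, map_mul, Function.comp_apply] at h1 ⊢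
      have h2 := hv j
      ext
      · rw [TrivSqZeroExt.fst_sum]
        simpa [r, ho4, ho5] using h1
      · rw [TrivSqZeroExt.snd_sum]
        simp only [gram, quot, Matrix.of_apply, Function.comp_apply, Finset.sum_smul] at h2
        rw [Finset.sum_comm] at h2
        rw [TrivSqZeroExt.snd_zero, ← neg_eq_zero, ← h2, ← Finset.sum_neg_distrib]
        refine Finset.sum_congr rfl fun k _ => ?_
        simp only [r, ho4, ho5, RingHom.comp_apply,
          TrivSqZeroExt.inlHom_apply, TrivSqZeroExt.snd_mul, TrivSqZeroExt.snd_inl,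
          TrivSqZeroExt.fst_inl, TrivSqZeroExt.snd_sub, TrivSqZeroExt.snd_inr, smul_zero, add_zero,
          zero_sub, smul_neg, neg_neg, Finset.smul_sum, smul_smul]
        refine Finset.sum_congr rfl fun l _ => ?_
        congr 1
        simp only [map_mul]
        ring)
  have hpG : p.comp G = RingHom.id S := H.hom_ext _ _ (by
    rw [RingHom.comp_assoc, hG1]; ext x; simp [r, hp]) (by
    rw [RingHom.comp_assoc, hG2, hpo]; rfl)
  have hfst : ∀ x, (G x).fst = x := fun x => RingHom.congr_fun hpG x
  refine ⟨Derivation.mk' { toFun := fun x => (G x).snd, map_add' := by simp, map_smul' := ?_ } ?_,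
    fun j => ?_⟩
  · intro a x
    rw [Algebra.smul_def, map_mul, ← RingHom.comp_apply, hG1]
    simp [r]
  · intro x y
    simp [hfst]
  · have := RingHom.congr_fun hG2 (coord A b j)
    rw [RingHom.comp_apply, ho2] at this
    simp [this]

theorem isPresentedBy : IsPresentedBy
    (fun j => KaehlerDifferential.D R S (β (coord A b j)))
    (gram β (quot β (algebraMap R S ∘ τ))) where
  span_eq_top := by
    set x := fun j => KaehlerDifferential.D R S (β (coord A b j))
    set W := Submodule.span S (Set.range x)
    have h0 : (W.mkQ).compDer (KaehlerDifferential.D R S) = 0 := by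
      refine H.derivation_eq_zero _ fun j => ?_
      exact (Submodule.Quotient.mk_eq_zero W).2 (Submodule.subset_span ⟨j, rfl⟩)
    rw [eq_top_iff, ← KaehlerDifferential.span_range_derivation R S, Submodule.span_le]
    rintro _ ⟨s, rfl⟩
    exact (Submodule.Quotient.mk_eq_zero W).1 (DFunLike.congr_fun h0 s)
  sum_eq_zero := fun i => by
    have h1 := derivation_gradEq H.comp_const τ (KaehlerDifferential.D R S) i
    rw [H.gradEq_eq_zero, map_zero] at h1
    exact neg_eq_zero.1 h1.symm
  exists_vecMul := fun c hc => by
    set J := gram β (quot β (algebraMap R S ∘ τ))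
    -- The test module is the cokernel of `J`: the derivation sending `x_j` to the class of the
    -- `j`-th unit vector carries a relation `c` between the differentials to the class of `c`,
    -- which must vanish.
    set W := Submodule.span S (Set.range J)
    have hpi : ∀ c : Fin d → S, ∑ l, c l • W.mkQ (Pi.single l 1) = W.mkQ c := fun c => by
      conv_rhs => rw [pi_eq_sum_univ' c]
      simp only [map_sum, map_smul]
    obtain ⟨δ, hδ⟩ := H.exists_derivation (N := (Fin d → S) ⧸ W)
      (fun j => W.mkQ (Pi.single j 1)) fun j => by
        rw [hpi]
        exact (Submodule.Quotient.mk_eq_zero W).2 (Submodule.subset_span ⟨j, rfl⟩)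
    have h1 := congrArg δ.liftKaehlerDifferential hc
    simp only [map_sum, map_smul, Derivation.liftKaehlerDifferential_comp_D, hδ, map_zero] at h1
    rw [hpi] at h1
    obtain ⟨q, hq⟩ := (Submodule.mem_span_range_iff_exists_fun S).1
      ((Submodule.Quotient.mk_eq_zero W).1 h1)
    refine ⟨q, ?_⟩
    rw [← hq]
    ext l
    simp [Matrix.vecMul, dotProduct]

end IsCritAlgebra

end LogDisc

/-! ### Universal critical algebras: localization, base change, charts -/

namespace LogDisc

open PSpace (stdOpen)

variable {n d : ℕ} {A : Matrix (Fin (n + 1)) (Fin d) ℂ} {b : Fin (n + 1) → ℂ}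

/-- `S` is the universal algebra over `R` with a map `β` from the coordinate ring such that the
critical point equations with coefficients `τ` hold. -/
structure IsUnivCrit {R S : Type} [CommRing R] [CommRing S] (ι : R →+* S) (κ : ℂ →+* R)
    (τ : Fin (n + 1) → R) (β : CoordRing A b →+* S) : Prop where
  comp_const : ι.comp κ = β.comp (algebraMap ℂ _)
  gradEq_eq_zero : ∀ j, gradEq β (ι ∘ τ) j = 0
  exists_hom : ∀ {T : Type} [CommRing T] (r : R →+* T) (o : CoordRing A b →+* T),
    r.comp κ = o.comp (algebraMap ℂ _) → (∀ j, gradEq o (r ∘ τ) j = 0) →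
    ∃ G : S →+* T, G.comp ι = r ∧ G.comp β = o
  hom_ext : ∀ {T : Type} [CommRing T] (G G' : S →+* T), G.comp ι = G'.comp ι →
    G.comp β = G'.comp β → G = G'

namespace IsUnivCrit

section

variable {R S : Type} [CommRing R] [CommRing S] {ι : R →+* S} {κ : ℂ →+* R}
    {τ : Fin (n + 1) → R} {β : CoordRing A b →+* S} (H : IsUnivCrit ι κ τ β)
include H

theorem isCritAlgebra : IsCritAlgebra ι κ τ β where
  comp_const := H.comp_const
  gradEq_eq_zero := H.gradEq_eq_zero
  exists_hom _ _ r o _ _ h1 h2 := H.exists_hom r o h1 h2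
  hom_ext := H.hom_ext

/-- Elements inverted in `S'` need not become invertible in an arbitrary test ring, but they do in
one with a local homomorphism to `S'`. Projections of square-zero extensions are of this kind, which
is all that derivations require. -/
theorem isCritAlgebra_of_isLocalization {R' S' : Type} [CommRing R'] [CommRing S'] [Algebra R R']
    [Algebra S S'] (N : Submonoid R) (M : Submonoid S) [IsLocalization N R'] [IsLocalization M S']
    {ι' : R' →+* S'} (h : ι'.comp (algebraMap R R') = (algebraMap S S').comp ι) :
    IsCritAlgebra ι' ((algebraMap R R').comp κ) (algebraMap R R' ∘ τ)
      ((algebraMap S S').comp β) where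
  comp_const := by
    rw [← RingHom.comp_assoc, h, RingHom.comp_assoc, H.comp_const, RingHom.comp_assoc]
  gradEq_eq_zero j := by
    have h1 : (ι' ∘ algebraMap R R' ∘ τ) = (algebraMap S S') ∘ ι ∘ τ :=
      funext fun k => RingHom.congr_fun h (τ k)
    rw [h1, ← map_gradEq, H.gradEq_eq_zero, map_zero]
  exists_hom {T} _ p _ r o h1 h2 h3 h4 := by
    obtain ⟨G, hG1, hG2⟩ := H.exists_hom (r.comp (algebraMap R R')) o
      (by rw [RingHom.comp_assoc, h3]) h4
    have hp : p.comp G = algebraMap S S' := H.hom_ext _ _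
      (by rw [RingHom.comp_assoc, hG1, ← RingHom.comp_assoc, h1, h])
      (by rw [RingHom.comp_assoc, hG2, h2])
    have hu : ∀ m : M, IsUnit (G m) := fun m => by
      refine isUnit_of_map_unit p _ ?_
      rw [← RingHom.comp_apply, hp]
      exact IsLocalization.map_units S' m
    refine ⟨IsLocalization.lift hu, ?_, ?_⟩
    · refine IsLocalization.ringHom_ext N ?_
      rw [RingHom.comp_assoc, h, ← RingHom.comp_assoc, IsLocalization.lift_comp, hG1]
    · rw [← RingHom.comp_assoc, IsLocalization.lift_comp, hG2]
  hom_ext G G' h1 h2 := by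
    refine IsLocalization.ringHom_ext M (H.hom_ext _ _ ?_ ?_)
    · rw [RingHom.comp_assoc, RingHom.comp_assoc, ← h, ← RingHom.comp_assoc, h1, RingHom.comp_assoc]
    · rw [RingHom.comp_assoc, h2, RingHom.comp_assoc]

end

theorem of_isPushout {R S R' S' : CommRingCat.{0}} {ι : R ⟶ S} {κ : ℂ →+* R}
    {τ : Fin (n + 1) → R} {β : CoordRing A b →+* S} (H : IsUnivCrit ι.hom κ τ β)
    {f : R ⟶ R'} {g : S ⟶ S'} {ι' : R' ⟶ S'} (hp : IsPushout ι f g ι') :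
    IsUnivCrit ι'.hom (f.hom.comp κ) (f.hom ∘ τ) (g.hom.comp β) where
  comp_const := by
    rw [← RingHom.comp_assoc, ← CommRingCat.hom_comp, ← hp.w, CommRingCat.hom_comp,
      RingHom.comp_assoc, H.comp_const, RingHom.comp_assoc]
  gradEq_eq_zero j := by
    have h1 : (ι'.hom ∘ f.hom ∘ τ) = g.hom ∘ ι.hom ∘ τ :=
      funext fun k => congrArg (fun u : R ⟶ S' => u.hom (τ k)) hp.w.symm
    rw [h1, ← map_gradEq, H.gradEq_eq_zero, map_zero]
  exists_hom {T} _ r o h3 h4 := by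
    obtain ⟨G, hG1, hG2⟩ := H.exists_hom (r.comp f.hom) o (by rw [RingHom.comp_assoc, h3]) h4
    have hw : ι ≫ CommRingCat.ofHom G = f ≫ CommRingCat.ofHom r := CommRingCat.hom_ext hG1
    refine ⟨(hp.desc _ _ hw).hom, ?_, ?_⟩
    · exact congrArg (fun u => u.hom) (hp.inr_desc _ _ hw)
    · rw [← RingHom.comp_assoc, ← hG2]
      exact congrArg (fun u => u.hom.comp β) (hp.inl_desc _ _ hw)
  hom_ext {T} _ G G' h1 h2 := by
    have h3 : G.comp g.hom = G'.comp g.hom := H.hom_ext _ _ (by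
      rw [RingHom.comp_assoc, RingHom.comp_assoc, ← CommRingCat.hom_comp, hp.w,
        CommRingCat.hom_comp, ← RingHom.comp_assoc, h1, RingHom.comp_assoc]) h2
    have h : CommRingCat.ofHom G = CommRingCat.ofHom G' := hp.hom_ext (CommRingCat.hom_ext h3)
      (CommRingCat.hom_ext h1)
    exact congrArg (fun u => u.hom) h

end IsUnivCrit

/-- Here `hex` and `hext` say that `Q` is the coproduct of `R` and the coordinate ring over `ℂ`; its
quotient by the critical equations is then universal. -/
theorem isUnivCrit_comp {R Q S : Type} [CommRing R] [CommRing Q] [CommRing S] {φ : Q →+* S}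
    (hsurj : Function.Surjective φ) {ι : R →+* Q} {κ : ℂ →+* R}
    {τ : Fin (n + 1) → R} {β : CoordRing A b →+* Q} (hc : ι.comp κ = β.comp (algebraMap ℂ _))
    (hker : RingHom.ker φ = gradIdeal β (ι ∘ τ))
    (hex : ∀ {T : Type} [CommRing T] (r : R →+* T) (o : CoordRing A b →+* T),
      r.comp κ = o.comp (algebraMap ℂ _) → ∃ c : Q →+* T, c.comp ι = r ∧ c.comp β = o)
    (hext : ∀ {T : Type} [CommRing T] (c c' : Q →+* T), c.comp ι = c'.comp ι →
      c.comp β = c'.comp β → c = c') :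
    IsUnivCrit (φ.comp ι) κ τ (φ.comp β) := by
  refine ⟨?_, fun j => ?_, fun {T} _ r o h1 h2 => ?_, fun {T} _ G G' h1 h2 => ?_⟩
  · rw [RingHom.comp_assoc, hc, RingHom.comp_assoc]
  · have : gradEq β (ι ∘ τ) j ∈ RingHom.ker φ := by
      rw [hker]; exact Ideal.subset_span ⟨j, rfl⟩
    rw [RingHom.mem_ker, map_gradEq] at this
    exact this
  · obtain ⟨c, hc1, hc2⟩ := hex r o h1
    have hle : RingHom.ker φ ≤ RingHom.ker c := by
      rw [hker, gradIdeal, Ideal.span_le]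
      rintro _ ⟨j, rfl⟩
      change c _ = 0
      rw [map_gradEq, hc2, ← h2 j, ← hc1]
      rfl
    refine ⟨φ.liftOfSurjective hsurj ⟨c, hle⟩, ?_, ?_⟩
    · rw [← RingHom.comp_assoc, RingHom.liftOfRightInverse_comp]
      exact hc1
    · rw [← RingHom.comp_assoc, RingHom.liftOfRightInverse_comp]
      exact hc2
  · have := hext (G.comp φ) (G'.comp φ) h1 h2
    exact (RingHom.cancel_right hsurj).1 this

variable (A b) in
/-- The open subset of the likelihood correspondence over `{u_i ≠ 0}`. -/
abbrev likChart (i : Fin (n + 1)) : (Likelihood A b).Opens :=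
  (likelihoodIdeal A b).subschemeι ⁻¹ᵁ chart A b i

theorem isAffineOpen_likChart (i : Fin (n + 1)) : IsAffineOpen (likChart A b i) :=
  (isAffineOpen_chart A b i).preimage _

variable (A b) in
/-- The pullback of functions on `X` to the likelihood correspondence over `{u_i ≠ 0}`. -/
def likHom (i : Fin (n + 1)) : CoordRing A b →+* Γ(Likelihood A b, likChart A b i) :=
  ((likelihoodIdeal A b).subschemeι.app (chart A b i)).hom.comp (pullHom A b i)

theorem isUnivCrit_chart {i : Fin (n + 1)} (h : (likelihoodIdeal A b).ideal (affineChart A b i) =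
      gradIdeal (pullHom A b i) (ratio A b i)) :
    IsUnivCrit ((likelihoodProj A b).app (stdOpen i)).hom (PSpace.const i) (PSpace.ratio i)
      (likHom A b i) :=
  isUnivCrit_comp (φ := ((likelihoodIdeal A b).subschemeι.app (chart A b i)).hom)
    ((likelihoodIdeal A b).subschemeι_app_surjective (affineChart A b i))
    (pullP_comp_const A b i)
    (((likelihoodIdeal A b).ker_subschemeι_app (affineChart A b i)).trans h)
    (fun r o => chart_hom_exists A b i r o) (fun _ _ => chart_hom_ext A b i)

end LogDisc

/-! ### The ramification ideal is generated by the Hessian -/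

namespace LogDisc

open PSpace (stdOpen)

variable {n d : ℕ} {A : Matrix (Fin (n + 1)) (Fin d) ℂ} {b : Fin (n + 1) → ℂ}

/-- The Jacobian determinant of a universal algebra of critical points. -/
def jacDet {R S : Type} [CommRing R] [CommRing S] (ι : R →+* S) (τ : Fin (n + 1) → R)
    (β : CoordRing A b →+* S) : S := (gram β (quot β (ι ∘ τ))).det

theorem map_jacDet {R S R' S' : Type} [CommRing R] [CommRing S] [CommRing R'] [CommRing S']
    {ι : R →+* S} {τ : Fin (n + 1) → R} {β : CoordRing A b →+* S} {ι' : R' →+* S'} {f : R →+* R'}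
    {g : S →+* S'} (h : ι'.comp f = g.comp ι) :
    g (jacDet ι τ β) = jacDet ι' (f ∘ τ) (g.comp β) := by
  have h1 : (ι' ∘ f ∘ τ) = g ∘ ι ∘ τ := funext fun k => RingHom.congr_fun h (τ k)
  rw [jacDet, jacDet, h1, RingHom.map_det]
  congr 1
  ext i j
  simp [gram, quot]

theorem IsCritAlgebra.fittingIdealZero_eq {R S : Type} [CommRing R] [CommRing S] {ι : R →+* S}
    {κ : ℂ →+* R} {τ : Fin (n + 1) → R} {β : CoordRing A b →+* S} (H : IsCritAlgebra ι κ τ β) :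
    letI := ι.toAlgebra
    fittingIdealZero S (KaehlerDifferential R S) = Ideal.span {jacDet ι τ β} :=
  letI := ι.toAlgebra
  IsPresentedBy.fittingIdealZero_eq (IsCritAlgebra.isPresentedBy (R := R) (S := S) H)

/-- The stalks are localizations of sections over affine opens, so the universal property, and with
it the presentation of the differentials, passes to them. -/
theorem ramificationStalk_eq {X Y : Scheme.{0}} (f : X ⟶ Y) {V : Y.Opens} (hV : IsAffineOpen V)
    (hW : IsAffineOpen (f ⁻¹ᵁ V)) {κ : ℂ →+* Γ(Y, V)} {τ : Fin (n + 1) → Γ(Y, V)}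
    {β : CoordRing A b →+* Γ(X, f ⁻¹ᵁ V)} (H : IsUnivCrit (f.app V).hom κ τ β) (x : X)
    (hx : x ∈ f ⁻¹ᵁ V) :
    ramificationStalk f x =
      Ideal.span {(X.presheaf.germ _ x hx).hom (jacDet (f.app V).hom τ β)} := by
  let _ := Y.presheaf.algebra_section_stalk (U := V) ⟨f x, hx⟩
  let _ := X.presheaf.algebra_section_stalk (U := f ⁻¹ᵁ V) ⟨x, hx⟩
  have h1 : IsLocalization (hV.primeIdealOf ⟨f x, hx⟩).asIdeal.primeCompl
    (Y.presheaf.stalk (f x)) := hV.isLocalization_stalk ⟨f x, hx⟩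
  have h2 : IsLocalization (hW.primeIdealOf ⟨x, hx⟩).asIdeal.primeCompl (X.presheaf.stalk x) :=
    hW.isLocalization_stalk ⟨x, hx⟩
  have hw : (f.stalkMap x).hom.comp (algebraMap Γ(Y, V) (Y.presheaf.stalk (f x))) =
      (algebraMap Γ(X, f ⁻¹ᵁ V) (X.presheaf.stalk x)).comp (f.app V).hom :=
    congrArg (fun g => g.hom) (Scheme.Hom.germ_stalkMap f V x hx)
  have H' := H.isCritAlgebra_of_isLocalization (R' := Y.presheaf.stalk (f x))
    (S' := X.presheaf.stalk x) (hV.primeIdealOf ⟨f x, hx⟩).asIdeal.primeCompl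
    (hW.primeIdealOf ⟨x, hx⟩).asIdeal.primeCompl (ι' := (f.stalkMap x).hom) hw
  refine H'.fittingIdealZero_eq.trans ?_
  rw [← map_jacDet hw]
  rfl

theorem ramificationIdeal_ideal_le {X Y : Scheme.{0}} (f : X ⟶ Y) (V : X.affineOpens) (x : X)
    (hx : x ∈ V.1) : (ramificationIdeal f).ideal V ≤
      (ramificationStalk f x).comap (X.presheaf.germ V.1 x hx).hom :=
  (Scheme.IdealSheafData.ideal_ofIdeals_le (fun V : X.affineOpens => ⨅ x : V.1,
    (ramificationStalk f x.1).comap (X.presheaf.germ V.1 x.1 x.2).hom) V).trans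
    (iInf_le (fun x : V.1 => (ramificationStalk f x.1).comap
      (X.presheaf.germ V.1 x.1 x.2).hom) ⟨x, hx⟩)

theorem ramificationIdeal_eq {X Y : Scheme.{0}} (f : X ⟶ Y) {ι : Type} (U : ι → X.affineOpens)
    (hU : ⨆ i, (U i).1 = ⊤) (δ : ∀ i, Γ(X, (U i).1))
    (hδ : ∀ i x (hx : x ∈ (U i).1),
      ramificationStalk f x = Ideal.span {(X.presheaf.germ (U i).1 x hx).hom (δ i)})
    {I : X.IdealSheafData} (hI : ∀ i, I.ideal (U i) = Ideal.span {δ i}) :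
    ramificationIdeal f = I := by
  refine le_antisymm (Scheme.IdealSheafData.le_of_iSup_eq_top U hU fun i => ?_)
    (Scheme.IdealSheafData.le_ofIdeals_iff.2 fun V => le_iInf fun x s hs => ?_)
  · rw [hI, (U i).2.ideal_le_iff]
    intro x hx
    rw [Ideal.map_le_iff_le_comap, Ideal.map_span, Set.image_singleton, ← hδ i x hx]
    exact ramificationIdeal_ideal_le f (U i) x hx
  · have hx : x.1 ∈ ⨆ i, (U i).1 := by rw [hU]; exact TopologicalSpace.Opens.mem_top x.1
    obtain ⟨i, hi⟩ := TopologicalSpace.Opens.mem_iSup.1 hx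
    -- Only the germ at `x` matters, so `V` and `U i` can be compared on a common affine
    -- neighbourhood.
    obtain ⟨_, ⟨W, hW, rfl⟩, hxW, hWle⟩ := X.isBasis_affineOpens.exists_subset_of_mem_open
      (show x.1 ∈ ((V.1 ⊓ (U i).1 : X.Opens) : Set X) from ⟨x.2, hi⟩) (V.1 ⊓ (U i).1).2
    have hV : (⟨W, hW⟩ : X.affineOpens) ≤ V := fun y hy => (hWle hy).1
    have hi' : (⟨W, hW⟩ : X.affineOpens) ≤ U i := fun y hy => (hWle hy).2
    have h1 := I.ideal_le_comap_ideal hV hs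
    rw [← I.map_ideal hi', hI, Ideal.map_span, Set.image_singleton, Ideal.mem_comap] at h1
    have h2 := Ideal.mem_map_of_mem (X.presheaf.germ W x.1 hxW).hom h1
    rw [Ideal.map_span, Set.image_singleton] at h2
    rw [Ideal.mem_comap, hδ i x.1 hi]
    rw [← CommRingCat.comp_apply, ← CommRingCat.comp_apply] at h2
    erw [X.presheaf.germ_res, X.presheaf.germ_res] at h2
    exact h2

variable (A b) in
/-- The Hessian as a function on the likelihood correspondence over `{u_i ≠ 0}`. -/
def hessFun (σ : Matrix (Fin (n + 1)) (Fin d) ℂ) (i : Fin (n + 1)) :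
    Γ(Likelihood A b, likChart A b i) :=
  ((likelihoodIdeal A b).subschemeι.app (chart A b i)).hom
    (evalQuot (pullHom A b i) (ratio A b i) (hessian A b σ))

theorem evalQuot_hessian_comp {R Q S : Type} [CommRing R] [CommRing Q] [CommRing S] {φ : Q →+* S}
    {ι : R →+* Q} {κ : ℂ →+* R} {τ : Fin (n + 1) → R} {β : CoordRing A b →+* Q}
    (H : IsUnivCrit (φ.comp ι) κ τ (φ.comp β)) (σ : Matrix (Fin (n + 1)) (Fin d) ℂ) :
    φ (evalQuot β (ι ∘ τ) (hessian A b σ)) = jacDet (φ.comp ι) τ (φ.comp β) := by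
  rw [← RingHom.comp_apply, comp_evalQuot]
  exact evalQuot_hessian σ H.gradEq_eq_zero

theorem hessFun_eq {i : Fin (n + 1)} (h : (likelihoodIdeal A b).ideal (affineChart A b i) =
      gradIdeal (pullHom A b i) (ratio A b i)) (σ : Matrix (Fin (n + 1)) (Fin d) ℂ) :
    hessFun A b σ i = jacDet ((likelihoodProj A b).app (stdOpen i)).hom (PSpace.ratio i)
      (likHom A b i) :=
  evalQuot_hessian_comp (φ := ((likelihoodIdeal A b).subschemeι.app (chart A b i)).hom)
    (ι := pullP A b i) (isUnivCrit_chart h) σ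

theorem iSup_likChart : ⨆ i, likChart A b i = ⊤ := by
  rw [← Scheme.Hom.preimage_iSup, iSup_chart, Scheme.Hom.preimage_top]

/-- The Hessian equals the Jacobian determinant on each chart, and the ideals it generates there
glue because they are those of `q.ker`. -/
theorem ramificationIdeal_likelihoodProj
    (h : ∀ i, (likelihoodIdeal A b).ideal (affineChart A b i) =
      gradIdeal (pullHom A b i) (ratio A b i)) {σ : Matrix (Fin (n + 1)) (Fin d) ℂ}
    {K : Type} [Field K] (q : Spec (.of K) ⟶ Likelihood A b)
    (hq : ∀ i, RingHom.ker (q.app (likChart A b i)).hom = Ideal.span {hessFun A b σ i}) :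
    ramificationIdeal (likelihoodProj A b) = q.ker := by
  have : QuasiCompact q := quasiCompact_of_finite q
  refine ramificationIdeal_eq _ (fun i => ⟨likChart A b i, isAffineOpen_likChart i⟩) iSup_likChart
    (hessFun A b σ) (fun i x hx => ?_) fun i => (Scheme.Hom.ker_apply q _).trans (hq i)
  rw [hessFun_eq (h i)]
  exact ramificationStalk_eq (likelihoodProj A b) (PSpace.isAffineOpen_stdOpen i)
    (isAffineOpen_likChart i) (isUnivCrit_chart (h i)) x hx

end LogDisc

/-! ### Scheme-theoretic images, and finite reduced algebras in characteristic zero -/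

namespace LogDisc

theorem isSchemeTheoreticallyDominant_toImage {X Y : Scheme.{0}} (f : X ⟶ Y) [QuasiCompact f] :
    IsSchemeTheoreticallyDominant f.toImage := by
  rw [isSchemeTheoreticallyDominant_iff, eq_bot_iff]
  refine Scheme.IdealSheafData.le_of_iSup_eq_top
    (fun U : Y.affineOpens => ⟨f.imageι ⁻¹ᵁ U.1, U.2.preimage f.imageι⟩) ?_ fun U => ?_
  · rw [← Scheme.Hom.preimage_iSup, iSup_affineOpens_eq_top, Scheme.Hom.preimage_top]
  · rw [Scheme.Hom.ker_apply]
    exact ((RingHom.injective_iff_ker_eq_bot _).1 (f.toImage_app_injective U)).le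

theorem isReduced_image {X Y : Scheme.{0}} (f : X ⟶ Y) [QuasiCompact f] [IsReduced X] :
    IsReduced f.image :=
  have := isSchemeTheoreticallyDominant_toImage f
  IsSchemeTheoreticallyDominant.isReduced f.toImage

theorem irreducibleSpace_image {X Y : Scheme.{0}} (f : X ⟶ Y) [QuasiCompact f]
    [IrreducibleSpace X] : IrreducibleSpace f.image := by
  rw [irreducibleSpace_def, Set.top_eq_univ, ← f.toImage.denseRange.closure_range, ← Set.image_univ]
  exact ((IrreducibleSpace.isIrreducible_univ X).image _ f.toImage.continuous.continuousOn).closure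

theorem formallyUnramified_of_finite {K F : Type} [Field K] [CharZero K] [CommRing F] [Algebra K F]
    [Algebra.FiniteType K F] [IsReduced F] [Finite (PrimeSpectrum F)] :
    Algebra.FormallyUnramified K F := by
  -- A Jacobson ring with finite spectrum has dimension zero, so `F` is Artinian and, being reduced,
  -- a finite product of finite field extensions of `K`. These are separable in characteristic zero.
  have : IsJacobsonRing F := isJacobsonRing_of_finiteType (A := K)
  have h0 : Ring.KrullDimLE 0 F :=
    (PrimeSpectrum.discreteTopology_iff_finite_and_krullDimLE_zero.1 inferInstance).2
  have : IsNoetherianRing F := Algebra.FiniteType.isNoetherianRing K F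
  have : IsArtinianRing F := IsNoetherianRing.isArtinianRing_of_krullDimLE_zero
  have : Module.Finite K F := Module.finite_of_isArtinianRing K F
  let _ : ∀ I : MaximalSpectrum F, Field (F ⧸ I.asIdeal) := fun I => Ideal.Quotient.field _
  have : Algebra.FormallyEtale K F := Algebra.FormallyEtale.iff_exists_algEquiv_prod K F |>.2
    ⟨MaximalSpectrum F, inferInstance, fun I => F ⧸ I.asIdeal, inferInstance, inferInstance,
      (IsArtinianRing.equivPi F).restrictScalars K, fun _ => inferInstance⟩
  infer_instance

theorem unramified_iff {K F : Type} [Field K] [CharZero K] [CommRing F] [Algebra K F]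
    [Algebra.FiniteType K F] :
    Algebra.FormallyUnramified K F ↔ Finite (PrimeSpectrum F) ∧ IsReduced F := by
  refine ⟨fun h => ?_, fun ⟨_, _⟩ => formallyUnramified_of_finite⟩
  have : Module.Finite K F := Algebra.FormallyUnramified.finite_of_free K F
  have : IsArtinianRing F := IsArtinianRing.of_finite K F
  exact ⟨inferInstance, Algebra.FormallyUnramified.isReduced_of_field K F⟩

end LogDisc

/-! ### Fibres of the projection and the discriminant as a closed set -/

namespace LogDisc

open PSpace (stdOpen)

variable {n d : ℕ} {A : Matrix (Fin (n + 1)) (Fin d) ℂ} {b : Fin (n + 1) → ℂ}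

theorem IsCritAlgebra.formallyUnramified_iff {R S : Type} [CommRing R] [CommRing S] [Algebra R S]
    {κ : ℂ →+* R} {τ : Fin (n + 1) → R} {β : CoordRing A b →+* S}
    (H : IsCritAlgebra (algebraMap R S) κ τ β) :
    Algebra.FormallyUnramified R S ↔ IsUnit (jacDet (algebraMap R S) τ β) :=
  (Algebra.formallyUnramified_iff R S).trans H.isPresentedBy.subsingleton_iff

/-- The fibre algebra is again universal over `K`, so its differentials vanish iff the Jacobian
determinant is a unit. `K` has characteristic zero because it receives `ℂ`. -/
theorem finite_and_isReduced_iff_isUnit {R S F : CommRingCat.{0}} {K : Type} [Field K] {ι : R ⟶ S}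
    {κ : ℂ →+* R} {τ : Fin (n + 1) → R} {β : CoordRing A b →+* S} (H : IsUnivCrit ι.hom κ τ β)
    {f : R ⟶ .of K} {g : S ⟶ F} {ι' : .of K ⟶ F} (hp : IsPushout ι f g ι')
    (hft : ι'.hom.FiniteType) :
    Finite (PrimeSpectrum F) ∧ _root_.IsReduced F ↔ IsUnit (g.hom (jacDet ι.hom τ β)) := by
  let _ : Algebra K F := ι'.hom.toAlgebra
  have : Algebra.FiniteType K F := hft
  have : CharZero K := charZero_of_injective_ringHom (f.hom.comp κ).injective
  have H' : IsCritAlgebra (algebraMap K F) (f.hom.comp κ) (f.hom ∘ τ) (g.hom.comp β) :=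
    (H.of_isPushout hp).isCritAlgebra
  have hw : (algebraMap K F).comp f.hom = g.hom.comp ι.hom :=
    congrArg (fun u => u.hom) hp.w.symm
  rw [← unramified_iff (K := K), H'.formallyUnramified_iff, map_jacDet hw]

theorem isUnit_appLE_iff {X Z : Scheme.{0}} (g : Z ⟶ X) {W : X.Opens} (h : ⊤ ≤ g ⁻¹ᵁ W)
    (δ : Γ(X, W)) : IsUnit ((g.appLE W ⊤ h).hom δ) ↔ ∀ z, g z ∈ X.basicOpen δ := by
  have h1 : ∀ z, g z ∈ X.basicOpen δ ↔ z ∈ Z.basicOpen ((g.appLE W ⊤ h).hom δ) := fun z => by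
    change z ∈ g ⁻¹ᵁ X.basicOpen δ ↔ _
    rw [Scheme.preimage_basicOpen, Scheme.Hom.appLE, CommRingCat.comp_apply, Scheme.basicOpen_res]
    simp
  simp_rw [h1]
  refine ⟨fun hu z => ?_, fun hz => Z.toRingedSpace.isUnit_of_isUnit_germ ⊤ _ fun z hz' => ?_⟩
  · rw [Scheme.basicOpen_of_isUnit _ hu]; trivial
  · exact (Z.mem_basicOpen _ _ hz').1 (hz z)

theorem isReduced_iff_of_isAffine (Z : Scheme.{0}) [IsAffine Z] :
    IsReduced Z ↔ _root_.IsReduced Γ(Z, ⊤) := by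
  rw [← affine_isReduced_iff]
  exact ⟨fun _ => isReduced_of_isOpenImmersion Z.isoSpec.inv,
    fun _ => isReduced_of_isOpenImmersion Z.isoSpec.hom⟩

theorem finite_iff_of_isAffine (Z : Scheme.{0}) [IsAffine Z] :
    Finite Z ↔ Finite (PrimeSpectrum Γ(Z, ⊤)) :=
  (Scheme.homeoOfIso Z.isoSpec).toEquiv.finite_iff

theorem finite_and_isReduced_fiber_iff {X Y : Scheme.{0}} (f : X ⟶ Y) [IsAffineHom f]
    [LocallyOfFiniteType f] {V : Y.Opens} (hV : IsAffineOpen V) {κ : ℂ →+* Γ(Y, V)}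
    {τ : Fin (n + 1) → Γ(Y, V)} {β : CoordRing A b →+* Γ(X, f ⁻¹ᵁ V)}
    (H : IsUnivCrit (f.app V).hom κ τ β) {u : Y} (hu : u ∈ V) :
    Finite (f.fiber u) ∧ IsReduced (f.fiber u) ↔
      ∀ x, f x = u → x ∈ X.basicOpen (jacDet (f.app V).hom τ β) := by
  have h1 : ⊤ ≤ Y.fromSpecResidueField u ⁻¹ᵁ V := fun z _ => by
    have : Y.fromSpecResidueField u z ∈ Set.range (Y.fromSpecResidueField u) := ⟨z, rfl⟩
    rw [Scheme.range_fromSpecResidueField] at this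
    change Y.fromSpecResidueField u z ∈ V
    rwa [this]
  have h2 : ⊤ ≤ f.fiberι u ⁻¹ᵁ (f ⁻¹ᵁ V) := fun z _ => by
    have : f.fiberι u z ∈ Set.range (f.fiberι u) := ⟨z, rfl⟩
    rw [Scheme.Hom.range_fiberι] at this
    change f (f.fiberι u z) ∈ V
    rwa [this]
  have hpb : IsPullback (f.fiberι u) (f.fiberToSpecResidueField u) f (Y.fromSpecResidueField u) :=
    IsPullback.of_hasPullback f (Y.fromSpecResidueField u)
  have hpo : IsPushout (f.app V) ((Y.fromSpecResidueField u).appLE V ⊤ h1)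
      ((f.fiberι u).appLE (f ⁻¹ᵁ V) ⊤ h2) ((f.fiberToSpecResidueField u).appLE ⊤ ⊤ le_top) := by
    rw [← Scheme.Hom.appLE_eq_app]
    exact (isIso_pushoutSection_iff hpb (US := V) (UT := ⊤) (UX := f ⁻¹ᵁ V) (UY := ⊤) h1 le_rfl
      (by rw [top_le_iff.1 h2]; simp)).1 (isIso_pushoutSection_of_isAffineOpen _ _ _ _ hV
      (isAffineOpen_top _) (hV.preimage f))
  have hft : ((f.fiberToSpecResidueField u).appLE ⊤ ⊤ le_top).hom.FiniteType := by
    have h3 : LocallyOfFiniteType (f.fiberToSpecResidueField u) :=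
      locallyOfFiniteType_isStableUnderBaseChange.of_isPullback hpb inferInstance
    have h4 := (HasRingHomProperty.iff_of_isAffine (P := @LocallyOfFiniteType)).1 h3
    have h5 : (f.fiberToSpecResidueField u).appLE ⊤ ⊤ le_top =
      (f.fiberToSpecResidueField u).appTop := Scheme.Hom.appLE_eq_app _
    rw [h5]
    exact h4
  let e : Γ(Spec (Y.residueField u), ⊤) ≅ Y.residueField u := Scheme.ΓSpecIso (Y.residueField u)
  have hiso : IsPushout ((f.fiberToSpecResidueField u).appLE ⊤ ⊤ le_top) e.hom (𝟙 _)
      (e.inv ≫ (f.fiberToSpecResidueField u).appLE ⊤ ⊤ le_top) :=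
    IsPushout.of_vert_isIso ⟨by rw [Category.comp_id, Iso.hom_inv_id_assoc]⟩
  have hpo' := hpo.paste_vert hiso
  rw [isReduced_iff_of_isAffine, finite_iff_of_isAffine]
  refine (finite_and_isReduced_iff_isUnit H hpo' ?_).trans ?_
  · exact hft.comp (RingHom.FiniteType.of_surjective _
      (ConcreteCategory.bijective_of_isIso e.inv).2)
  · rw [Category.comp_id, isUnit_appLE_iff]
    refine ⟨fun h x hx => ?_, fun h z => h _ ?_⟩
    · have : x ∈ Set.range (f.fiberι u) := by rw [Scheme.Hom.range_fiberι]; exact hx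
      obtain ⟨z, rfl⟩ := this
      exact h z
    · have : f.fiberι u z ∈ Set.range (f.fiberι u) := ⟨z, rfl⟩
      rwa [Scheme.Hom.range_fiberι] at this

theorem jacobsonSpace_PSpace (n : ℕ) : JacobsonSpace (PSpace n) := by
  have hc : TopologicalSpace.IsOpenCover (fun i : Fin (n + 1) => stdOpen i) := PSpace.iSup_stdOpen
  rw [hc.jacobsonSpace_iff]
  intro i
  have : IsJacobsonRing Γ(PSpace n, stdOpen i) :=
    isJacobsonRing_of_surjective ⟨_, PSpace.eval₂_ratio_surjective i⟩
  exact LocallyOfFiniteType.jacobsonSpace (PSpace.isAffineOpen_stdOpen i).isoSpec.hom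

variable (A b) in
theorem locallyOfFiniteType_toP : LocallyOfFiniteType (toP A b) := by
  have h : LocallyOfFiniteType (Complement.toSpec A b) := by
    refine (HasRingHomProperty.Spec_iff (P := @LocallyOfFiniteType)).2 ?_
    have : Algebra.FiniteType (MvPolynomial (Fin d) ℂ) (CoordRing A b) :=
      IsLocalization.finiteType_of_monoid_fg (Submonoid.powers (∏ i, form A b i)) _
    have h1 : Algebra.FiniteType ℂ (CoordRing A b) :=
      (inferInstance : Algebra.FiniteType ℂ (MvPolynomial (Fin d) ℂ)).trans this
    exact RingHom.finiteType_algebraMap.2 h1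
  exact locallyOfFiniteType_isStableUnderBaseChange.of_isPullback
    (IsPullback.of_hasPullback (PSpace.toSpec n) (Complement.toSpec A b)).flip h

instance : LocallyOfFiniteType (likelihoodProj A b) :=
  have := locallyOfFiniteType_toP A b
  locallyOfFiniteType_comp (likelihoodIdeal A b).subschemeι (toP A b)

instance : IsAffineHom (likelihoodProj A b) :=
  inferInstanceAs (IsAffineHom ((likelihoodIdeal A b).subschemeι ≫ toP A b))

theorem mem_support_iff_of_span {X : Scheme.{0}} {I : X.IdealSheafData} {U : X.affineOpens}
    {δ : Γ(X, U.1)} (h : I.ideal U = Ideal.span {δ}) {x : X} (hx : x ∈ U.1) :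
    x ∈ I.support ↔ x ∉ X.basicOpen δ := by
  rw [I.mem_support_iff_of_mem hx, h, Scheme.zeroLocus_span, Scheme.mem_zeroLocus_iff]
  simp

/-- The source is Jacobson too, so its closed points are dense, and a morphism locally of finite
type sends them to closed points. -/
theorem closure_isClosed_range {X Y : Scheme.{0}} (g : X ⟶ Y) [JacobsonSpace Y]
    [LocallyOfFiniteType g] :
    closure {u | IsClosed {u} ∧ u ∈ Set.range g} = closure (Set.range g) := by
  have : JacobsonSpace X := LocallyOfFiniteType.jacobsonSpace g
  refine (closure_mono fun u hu => hu.2).antisymm (closure_minimal ?_ isClosed_closure)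
  rintro _ ⟨x, rfl⟩
  have hx : x ∈ closure (closedPoints X) := by rw [closure_closedPoints]; trivial
  refine closure_mono ?_ (image_closure_subset_closure_image g.continuous ⟨x, hx, rfl⟩)
  rintro _ ⟨y, hy, rfl⟩
  exact ⟨g.closePoints_subset_preimage_closedPoints hy, y, rfl⟩

theorem infinite_or_not_isReduced_crit_iff
    (h : ∀ i, (likelihoodIdeal A b).ideal (affineChart A b i) =
      gradIdeal (pullHom A b i) (ratio A b i)) {σ : Matrix (Fin (n + 1)) (Fin d) ℂ}
    (hr : ∀ i, (ramificationIdeal (likelihoodProj A b)).ideal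
      ⟨likChart A b i, isAffineOpen_likChart i⟩ = Ideal.span {hessFun A b σ i}) (u : PSpace n) :
    Infinite (Crit A b u) ∨ ¬ IsReduced (Crit A b u) ↔
      u ∈ Set.range (Ram.ι (likelihoodProj A b) ≫ likelihoodProj A b) := by
  have hu : u ∈ ⨆ i, stdOpen i := by rw [PSpace.iSup_stdOpen]; trivial
  obtain ⟨i, hi⟩ := TopologicalSpace.Opens.mem_iSup.1 hu
  rw [← not_finite_iff_infinite, ← not_and_or, finite_and_isReduced_fiber_iff
    (likelihoodProj A b) (PSpace.isAffineOpen_stdOpen i) (isUnivCrit_chart (h i)) hi,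
    ← hessFun_eq (h i) σ]
  push Not
  rw [Scheme.Hom.comp_base, TopCat.coe_comp, Set.range_comp]
  have hs : ∀ x, likelihoodProj A b x = u →
      (x ∉ (Likelihood A b).basicOpen (hessFun A b σ i) ↔
        x ∈ Set.range (Ram.ι (likelihoodProj A b))) := fun x hx => by
    have hxi : x ∈ likChart A b i := by
      change likelihoodProj A b x ∈ stdOpen i
      rwa [hx]
    rw [Scheme.IdealSheafData.range_subschemeι]
    exact (mem_support_iff_of_span (hr i) hxi).symm
  exact ⟨fun ⟨x, hx, h1⟩ => ⟨x, (hs x hx).1 h1, hx⟩, fun ⟨x, h1, hx⟩ => ⟨x, hx, (hs x hx).2 h1⟩⟩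

/-- The subscheme defined by `q.ker` is the scheme-theoretic image of the spectrum of a field, and
the branch scheme is an image in turn. -/
theorem isReduced_and_irreducibleSpace_of_eq_ker {X Y : Scheme.{0}} (f : X ⟶ Y) [QuasiCompact f]
    {K : Type} [Field K] {q : Spec (.of K) ⟶ X} (hq : ramificationIdeal f = q.ker) :
    (IsReduced (Ram f) ∧ IrreducibleSpace (Ram f)) ∧
      IsReduced (Branch f) ∧ IrreducibleSpace (Branch f) := by
  have : QuasiCompact q := quasiCompact_of_finite q
  have h1 : IsReduced (Ram f) := by rw [Ram, hq]; exact isReduced_image q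
  have h2 : IrreducibleSpace (Ram f) := by rw [Ram, hq]; exact irreducibleSpace_image q
  exact ⟨⟨h1, h2⟩, isReduced_image _, irreducibleSpace_image _⟩

theorem isIrreducible_logDiscriminantSet
    (h : ∀ i, (likelihoodIdeal A b).ideal (affineChart A b i) =
      gradIdeal (pullHom A b i) (ratio A b i)) {σ : Matrix (Fin (n + 1)) (Fin d) ℂ}
    (hr : ∀ i, (ramificationIdeal (likelihoodProj A b)).ideal
      ⟨likChart A b i, isAffineOpen_likChart i⟩ = Ideal.span {hessFun A b σ i})
    [IrreducibleSpace (Ram (likelihoodProj A b))] :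
    IsIrreducible (logDiscriminantSet A b) := by
  have := jacobsonSpace_PSpace n
  have h1 : logDiscriminantSet A b =
      closure (Set.range (Ram.ι (likelihoodProj A b) ≫ likelihoodProj A b)) := by
    rw [← closure_isClosed_range, logDiscriminantSet]
    simp_rw [infinite_or_not_isReduced_crit_iff h hr]
  rw [h1, ← Set.image_univ]
  exact ((IrreducibleSpace.isIrreducible_univ _).image _
    (Ram.ι (likelihoodProj A b) ≫ likelihoodProj A b).continuous.continuousOn).closure

end LogDisc

end

/-! ### The theorem -/

open LogDisc in
theorem theorem5p1 (n d : ℕ) (hd : 1 ≤ d) (hn : d + 2 ≤ n + 1)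
    (A : Matrix (Fin (n + 1)) (Fin d) ℂ) (b : Fin (n + 1) → ℂ)
    (hA : ∀ i, A i ≠ 0)
    (hU : ∃ s : Fin (d + 2) ↪ Fin (n + 1),
      IsUniform ((matrixL A b).submatrix id s) ∧ IsUniform (A.transpose.submatrix id s)) :
    (IsReduced (Ram (likelihoodProj A b)) ∧ IrreducibleSpace (Ram (likelihoodProj A b))) ∧
    (IsReduced (logDiscriminant A b) ∧ IrreducibleSpace (logDiscriminant A b)) ∧
    IsIrreducible (logDiscriminantSet A b) := by
  obtain ⟨σ, hσ, hprime, hv⟩ := exists_hessian_prime hd hA hU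
  have := isDomain_coordRing (b := b) hA
  have h := likelihoodIdeal_ideal (b := b) hσ
    (hv.imp fun k hk h0 => hk (h0 ▸ dvd_zero (hessian A b σ)))
  obtain ⟨K, _, q, hq⟩ := exists_likelihood_point hσ hprime hv
  have hram := ramificationIdeal_likelihoodProj h q hq
  have hr : ∀ i, (ramificationIdeal (likelihoodProj A b)).ideal
      ⟨likChart A b i, isAffineOpen_likChart i⟩ = Ideal.span {hessFun A b σ i} := fun i => by
    have : QuasiCompact q := quasiCompact_of_finite q
    rw [hram]
    exact (Scheme.Hom.ker_apply q _).trans (hq i)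
  obtain ⟨h1, h2⟩ := isReduced_and_irreducibleSpace_of_eq_ker _ hram
  have := h1.2
  exact ⟨h1, h2, isIrreducible_logDiscriminantSet h hr⟩
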